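/- **Setting.** Let $U,V\subset\mathbb R^n$ be domains, let $I_{x,y}$ be a nonempty open interval for each $(x,y)\in U\times V$, let $\Gamma=\{(x,y,z): x\in U,\ y\in V,\ z\in I_{x,y}\}$ be a bounded domain, and let $J$ be a nonempty open interval. A *generating function* is a function $g\in C^4(\overline\Gamma)$ with $J\subset g(x,y,I_{x,y})$ for all $(x,y)\in U\times V$ such that * (A1) with $\mathcal U=\{(x,g(x,y,z),g_x(x,y,z)):(x,y,z)\in\Gamma\}$, for every $(x,u,p)\in\mathcal U$ there is a unique $(y,z)=:(Y(x,u,p),Z(x,u,p))$ with $(x,y,z)\in\Gamma$, $g(x,y,z)=u$, $g_x(x,y,z)=p$; * (A1$^*$) for each fixed $y,z$ the map $x\mapsto \frac{g_y}{g_z}(x,y,z)$ is injective on its domain $\{x:(x,y,z)\in\Gamma\}$; * (A2) on $\overline\Gamma$: $g_z<0$ and $\det E\ne0$, where $E_{ij}=g_{i,j}-g_z^{-1}g_{i,z}g_{,j}$ (subscripts before and after the comma denote derivatives in $x$ and in $y$ or $z$). Put $A_{ij}(x,u,p)=g_{x_ix_j}(x,Y(x,u,p),Z(x,u,p))$ on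 $\mathcal U$. *A3w* means $D_{p_kp_l}A_{ij}(x,u,p)\xi_i\xi_j\eta_k\eta_l\ge0$ for all $(x,u,p)\in\mathcal U$ and all orthogonal unit vectors $\xi,\eta$. For a domain $\Omega\subset U$, $g(\cdot,y,z)$ is a *$g$-support* of $u\in C^0(\overline\Omega)$ at $x_0\in\Omega$ if $(x,y,z)\in\Gamma$ for $x\in\Omega$, $u(x_0)=g(x_0,y,z)$, $u\ge g(\cdot,y,z)$ in $\Omega$ and $g(\overline\Omega,y,z)\subset J$; $u$ is *$g$-convex* if it has a $g$-support at every point of $\Omega$. A number $C_0$ is a *good shape constant* of a convex set if the ratio of any two semi-axes of its ellipsoid of minimal volume (among ellipsoids containing it) is at most $C_0$. **Statement.** Let $g$ be a generating function satisfying A3w, with $\lambda\le|g_z|\le\Lambda$ on $\Gamma$ and the entries of $E$ and $E^{-1}$ bounded by $\Lambda$ on $\Gamma$, where $\lambda>0$. Let $\Omega\subset U$ be a domain and let $u\in C^4(\Omega)\cap C^2(\overline\Omega)$ be a $g$-convex solution of $$\det[D^2u-A(\cdot,u,Du)]=f_0\ \text{ in }\Omega,\qquad u=u_0:=g(\cdot,y,z-h)\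 \text{ on }\partial\Omega,$$ where $f_0\ge m>0$ is a constant, $h>0$, $g(\cdot,y,z)$ is a $g$-support of $u$ at some $\overline x\in\Omega$, and $(x,y,z-h)\in\Gamma$ for $x\in\Omega$. Suppose that $C_0$ is a good shape constant of $\Omega$, or of the image of $\Omega$ under the coordinates $x\mapsto\frac{g_y}{g_z}(x,y,z-h)$ (in particular the set in question is convex). Suppose also that for each $x\in\Omega$ the points $(x,u(x),p)$ with $p$ on the segment from $Du(x)$ to $Du_0(x)$, and the points $(x,s,Du_0(x))$ with $s$ between $u(x)$ and $u_0(x)$, belong to the set $\mathcal U$ on which $A$ is defined. Let $\|A\|_{C^2(\mathcal U)}\le K$ and $\|u\|_{C^1(\Omega)}\le M$. There is $h_0>0$, depending only on $n,K,M,C_0,\lambda,\Lambda,m$, such that if $h\le h_0$ then for each $\tau\in(0,1)$ $$\sup_{S_{\tau h}}|D^2u|\le C,\qquad S_{\tau h}=\{x\in\Omega: u(x)<g(x,y,z-\tau h)\},$$ where $C$ depends only on $n,K,M,\tau,C_0,h$ and the lower bound $\lambda$ of $|g_z|$. -/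

import Mathlib

open Set Filter Topology MeasureTheory
open scoped ENNReal Gradient

noncomputable section

namespace GJE

/-- Euclidean space `ℝⁿ`. -/
abbrev Eu (n : ℕ) : Type := EuclideanSpace ℝ (Fin n)

/-- `ℝⁿ × ℝⁿ × ℝ`, the space of the triples `(x, y, z)`. -/
abbrev XYZ (n : ℕ) : Type := Eu n × Eu n × ℝ

/-- `ℝⁿ × ℝ × ℝⁿ`, the space of the one-jets `(x, u, p)`. -/
abbrev Jet (n : ℕ) : Type := Eu n × ℝ × Eu n

/-! ### Function spaces and norms -/

section Norms

variable {X Y : Type*} [NormedAddCommGroup X] [NormedSpace ℝ X]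
  [NormedAddCommGroup Y] [NormedSpace ℝ Y]

/-- The `C^k` norm of `f` on the open set `S`: the sum of the suprema over `S` of the norms of the
derivatives of order `0, …, k` (possibly infinite). -/
def ckNorm (k : ℕ) (S : Set X) (f : X → Y) : ℝ≥0∞ :=
  ∑ j ∈ Finset.range (k + 1), ⨆ x ∈ S, ‖iteratedFDeriv ℝ j f x‖ₑ

/-- `f ∈ C^k(closure S)` for an open set `S`: `f` is `C^k` in `S`, continuous on the closure, and
all the derivatives of order at most `k` extend continuously to the closure. -/
def CkClosure (k : ℕ) (f : X → Y) (S : Set X) : Prop :=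
  ContDiffOn ℝ k f S ∧ ContinuousOn f (closure S) ∧
    ∀ j ≤ k, ∀ x ∈ closure S, ∃ l, Tendsto (iteratedFDeriv ℝ j f) (𝓝[S] x) (𝓝 l)

end Norms

/-! ### Minimum ellipsoids and good shape constants -/

variable {n : ℕ}

/-- The ellipsoid with centre `c`, orthonormal axis directions `b i` and semi-axes `r i`. -/
def ellipsoid (c : Eu n) (b : OrthonormalBasis (Fin n) ℝ (Eu n)) (r : Fin n → ℝ) : Set (Eu n) :=
  {x | ∑ i, (inner ℝ (b i) (x - c)) ^ 2 / (r i) ^ 2 ≤ 1}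

/-- The ellipsoid given by `c`, `b`, `r` has minimal volume among all ellipsoids containing `S`. -/
def IsMinEllipsoid (S : Set (Eu n)) (c : Eu n) (b : OrthonormalBasis (Fin n) ℝ (Eu n))
    (r : Fin n → ℝ) : Prop :=
  (∀ i, 0 < r i) ∧ S ⊆ ellipsoid c b r ∧
    ∀ (c' : Eu n) (b' : OrthonormalBasis (Fin n) ℝ (Eu n)) (r' : Fin n → ℝ),
      (∀ i, 0 < r' i) → S ⊆ ellipsoid c' b' r' →
        volume (ellipsoid c b r) ≤ volume (ellipsoid c' b' r')

/-- `C` is a good shape constant of the convex set `S`: the ratio of any two semi-axes of the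
minimum ellipsoid of `S` is at most `C`. -/
def IsGoodShapeConst (C : ℝ) (S : Set (Eu n)) : Prop :=
  Convex ℝ S ∧ ∃ (c : Eu n) (b : OrthonormalBasis (Fin n) ℝ (Eu n)) (r : Fin n → ℝ),
    IsMinEllipsoid S c b r ∧ ∀ i j, r i ≤ C * r j

/-! ### Partial derivatives of a function `g(x, y, z)` -/

/-- `g_x`. -/
def gX (g : XYZ n → ℝ) (q : XYZ n) : Eu n := ∇ (fun x => g (x, q.2.1, q.2.2)) q.1

/-- `g_y`. -/
def gY (g : XYZ n → ℝ) (q : XYZ n) : Eu n := ∇ (fun y => g (q.1, y, q.2.2)) q.2.1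

/-- `g_z`. -/
def gZ (g : XYZ n → ℝ) (q : XYZ n) : ℝ := deriv (fun z => g (q.1, q.2.1, z)) q.2.2

/-- `g_{xx}`, as a bilinear form. -/
def gXX (g : XYZ n → ℝ) (q : XYZ n) : (Eu n) [×2]→L[ℝ] ℝ :=
  iteratedFDeriv ℝ 2 (fun x => g (x, q.2.1, q.2.2)) q.1

/-- The matrix `E_{ij} = g_{i,j} - g_z⁻¹ g_{i,z} g_{,j}`; subscripts before the comma are
derivatives in `x`, those after the comma are derivatives in `y` (or in `z`). -/
def matE (g : XYZ n → ℝ) (q : XYZ n) : Matrix (Fin n) (Fin n) ℝ :=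
  Matrix.of fun i j =>
    fderiv ℝ (fun y => gX g (q.1, y, q.2.2) i) q.2.1 (EuclideanSpace.single j 1)
      - (gZ g q)⁻¹ * deriv (fun z => gX g (q.1, q.2.1, z) i) q.2.2 * gY g q j

/-- The coordinates `x ↦ (g_y / g_z)(x, y, z)`. -/
def coordChange (g : XYZ n → ℝ) (y : Eu n) (z : ℝ) (x : Eu n) : Eu n :=
  (gZ g (x, y, z))⁻¹ • gY g (x, y, z)

/-! ### Generating functions -/

/-- `Γ = {(x, y, z) : x ∈ U, y ∈ V, z ∈ I_{x,y}}`. -/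
def Gam (U V : Set (Eu n)) (I : Eu n → Eu n → Set ℝ) : Set (XYZ n) :=
  {q | q.1 ∈ U ∧ q.2.1 ∈ V ∧ q.2.2 ∈ I q.1 q.2.1}

/-- `𝒰 = {(x, g(x, y, z), g_x(x, y, z)) : (x, y, z) ∈ Γ}`. -/
def jetSet (Γ : Set (XYZ n)) (g : XYZ n → ℝ) : Set (Jet n) :=
  (fun q : XYZ n => (q.1, g q, gX g q)) '' Γ

/-- `q = (y, z)` solves `g(x, y, z) = u`, `g_x(x, y, z) = p`, with `(x, y, z) ∈ Γ`. -/
def SolvesYZ (Γ : Set (XYZ n)) (g : XYZ n → ℝ) (w : Jet n) (q : Eu n × ℝ) : Prop :=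
  (w.1, q) ∈ Γ ∧ g (w.1, q) = w.2.1 ∧ gX g (w.1, q) = w.2.2

/-- A domain: a nonempty, open and connected set. -/
def IsDomainSet {X : Type*} [TopologicalSpace X] (S : Set X) : Prop := IsOpen S ∧ IsConnected S

/-- A nonempty open interval (possibly unbounded). -/
def IsOpenInterval (S : Set ℝ) : Prop := IsOpen S ∧ S.OrdConnected ∧ S.Nonempty

/-- Generating functions, i.e. the conditions A0, A1, A1* and A2. The derivatives of `g` at the
points of the closure of `Γ` are the continuous extensions of those in `Γ`. -/
structure IsGenerating (U V : Set (Eu n)) (I : Eu n → Eu n → Set ℝ) (J : Set ℝ)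
    (g : XYZ n → ℝ) : Prop where
  domU : IsDomainSet U
  domV : IsDomainSet V
  intI : ∀ x ∈ U, ∀ y ∈ V, IsOpenInterval (I x y)
  domΓ : IsDomainSet (Gam U V I)
  bddΓ : Bornology.IsBounded (Gam U V I)
  smooth : CkClosure 4 g (Gam U V I)
  intJ : IsOpenInterval J
  rangeJ : ∀ x ∈ U, ∀ y ∈ V, J ⊆ (fun z => g (x, y, z)) '' I x y
  A1 : ∀ w ∈ jetSet (Gam U V I) g, ∃! q : Eu n × ℝ, SolvesYZ (Gam U V I) g w q
  A1star : ∀ (y : Eu n) (z : ℝ), InjOn (coordChange g y z) {x | (x, y, z) ∈ Gam U V I}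
  A2_gz : ∀ q ∈ closure (Gam U V I), extendFrom (Gam U V I) (gZ g) q < 0
  A2_E : ∀ q ∈ closure (Gam U V I), (extendFrom (Gam U V I) (matE g) q).det ≠ 0

/-- The pair `(Y(x, u, p), Z(x, u, p))`, for `(x, u, p) ∈ 𝒰`. -/
def YZ (Γ : Set (XYZ n)) (g : XYZ n → ℝ) (w : Jet n) : Eu n × ℝ :=
  Classical.epsilon (SolvesYZ Γ g w)

/-- `A(x, u, p) = g_{xx}(x, Y(x, u, p), Z(x, u, p))`, as a bilinear form. -/
def matA (Γ : Set (XYZ n)) (g : XYZ n → ℝ) (w : Jet n) : (Eu n) [×2]→L[ℝ] ℝ :=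
  gXX g (w.1, YZ Γ g w)

/-- The condition A3w: `D_{p_k p_l} A_{ij}(x, u, p) ξ_i ξ_j η_k η_l ≥ 0` for all `(x, u, p) ∈ 𝒰`
and all orthogonal unit vectors `ξ`, `η`. -/
def A3w (Γ : Set (XYZ n)) (g : XYZ n → ℝ) : Prop :=
  ∀ w ∈ jetSet Γ g, ∀ ξ η : Eu n, ‖ξ‖ = 1 → ‖η‖ = 1 → inner ℝ ξ η = 0 →
    0 ≤ iteratedFDeriv ℝ 2 (fun p => matA Γ g (w.1, w.2.1, p)) w.2.2 ![η, η] ![ξ, ξ]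

/-- Quantitative form of A2: `lam ≤ |g_z| ≤ Lam` on `Γ`, and the entries of `E` and of `E⁻¹`
are bounded by `Lam` there. Every generating function satisfies it for some
`lam > 0` and some `Lam`, since the closure of `Γ` is compact. -/
def StructureBounds (Γ : Set (XYZ n)) (g : XYZ n → ℝ) (lam Lam : ℝ) : Prop :=
  ∀ q ∈ Γ, lam ≤ -gZ g q ∧ -gZ g q ≤ Lam ∧
    ∀ i j, |matE g q i j| ≤ Lam ∧ |(matE g q)⁻¹ i j| ≤ Lam

/-! ### `g`-convex functions and the equation -/

/-- `g(·, y, z)` is a `g`-support of `u : Ω → ℝ` at `x₀`. -/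
def IsGSupport (Γ : Set (XYZ n)) (J : Set ℝ) (g : XYZ n → ℝ) (Ω : Set (Eu n)) (u : Eu n → ℝ)
    (x₀ y : Eu n) (z : ℝ) : Prop :=
  (∀ x ∈ Ω, (x, y, z) ∈ Γ) ∧ u x₀ = g (x₀, y, z) ∧
    (∀ x ∈ Ω, x ≠ x₀ → g (x, y, z) ≤ u x) ∧ ∀ x ∈ closure Ω, g (x, y, z) ∈ J

/-- `u` is `g`-convex in `Ω`. -/
def GConvex (Γ : Set (XYZ n)) (J : Set ℝ) (g : XYZ n → ℝ) (Ω : Set (Eu n))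
    (u : Eu n → ℝ) : Prop :=
  ContinuousOn u (closure Ω) ∧ ∀ x₀ ∈ Ω, ∃ (y : Eu n) (z : ℝ), IsGSupport Γ J g Ω u x₀ y z

/-- The one-jet `(x, u(x), Du(x))`. -/
def jet (u : Eu n → ℝ) (x : Eu n) : Jet n := (x, u x, ∇ u x)

/-- The matrix `D²u(x) - A(x, u(x), Du(x))`. -/
def matW (Γ : Set (XYZ n)) (g : XYZ n → ℝ) (u : Eu n → ℝ) (x : Eu n) :
    Matrix (Fin n) (Fin n) ℝ :=
  Matrix.of fun i j =>
    (iteratedFDeriv ℝ 2 u x - matA Γ g (jet u x))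
      ![EuclideanSpace.single i 1, EuclideanSpace.single j 1]

/-- `u` solves `det [D²u - A(·, u, Du)] = f₀` in `Ω`; this includes that the one-jets of `u` lie in
the set `𝒰` where `A` is defined. -/
def SolvesMATE (Γ : Set (XYZ n)) (g : XYZ n → ℝ) (Ω : Set (Eu n)) (u : Eu n → ℝ)
    (f₀ : ℝ) : Prop :=
  ∀ x ∈ Ω, jet u x ∈ jetSet Γ g ∧ (matW Γ g u x).det = f₀

/-- `A(x, ·, ·)` is defined on the two segments that join the one-jet of `u` at `x` to that of
`u₀ = g(·, y, z)`: the segment from `(u, Du)` to `(u, Du₀)` and the segment from `(u, Du₀)` to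
`(u₀, Du₀)`, for all `x ∈ Ω`. -/
def JetsJoined (Γ : Set (XYZ n)) (g : XYZ n → ℝ) (Ω : Set (Eu n)) (u : Eu n → ℝ)
    (y : Eu n) (z : ℝ) : Prop :=
  ∀ x ∈ Ω,
    (∀ p ∈ segment ℝ (∇ u x) (gX g (x, y, z)), (x, u x, p) ∈ jetSet Γ g) ∧
    (∀ s ∈ segment ℝ (u x) (g (x, y, z)), (x, s, gX g (x, y, z)) ∈ jetSet Γ g)

/-- The section `{x ∈ Ω : u(x) < g(x, y, z)}`. -/
def gSection (g : XYZ n → ℝ) (Ω : Set (Eu n)) (u : Eu n → ℝ) (y : Eu n) (z : ℝ) : Set (Eu n) :=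
  {x ∈ Ω | u x < g (x, y, z)}

end GJE

end

open GJE

namespace GJE

/-! ### Directional derivatives -/

section Directional

variable {E F : Type*} [NormedAddCommGroup E] [NormedSpace ℝ E]
  [NormedAddCommGroup F] [NormedSpace ℝ F]

/-! The proof is Pogorelov's interior estimate, run on a domain that is first shown to be small.
Write u₀ = g(·, y, z - h), v = u - u₀, W = D²u - A(·, u, Du), F = W⁻¹, and let Lφ = F^{ij}(φ_ij -
D_{p_k}A_ij φ_k) be the linearised operator.

Consider a maximum, over points and unit directions ξ, of log W_ξξ + 12 log(u₀ - u) + |Du|²/(4P³) +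
50P²|x - x̄|²; there ξ may be taken to be a top eigenvector of W. Differentiating det W = f₀ twice
along ξ bounds L W_ξξ from below by a nonnegative term quadratic in the derivatives of W, minus C(1
+ tr F)W_ξξ. The dangerous terms F^{ii} D_{p_ξ p_ξ}A_ii W_ξξ² are nonnegative by A3w in the
directions orthogonal to ξ, and along ξ the factor F^{ξξ} = 1/W_ξξ removes one power
(`sum_second_deriv_eigenvalue_ge`). A3w enters a second time through a one-sided Taylor expansion of
A about the one-jet of u, which gives Lv ≤ n + C(|v| tr F + F^{ii}|v_i|) (`CoefBounds.sub_sub_le`).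
The term |Du|² contributes a multiple of W_ξξ (`sum_second_deriv_gradient_ge`), and |x - x̄|²
contributes a multiple of tr F that absorbs all the others. The first order condition removes
v_i²/v², and a quadratic inequality for W_ξξ(u₀ - u) remains (`eigenvalue_mul_neg_le`,
`eigenvalue_bound_at_max`, `augHess_mul_pow_le`).

The term |x - x̄|² is only useful when Ω has small diameter; this is where h₀ comes from. Comparison
within the family z ↦ g(·, y, z) gives 0 < u₀ - u ≤ Λh (`GConvex.lt_section`,
`IsGenerating.sub_bounds`). Since det W ≥ m, a function v of such small height cannot live on a
large ball (`sq_radius_le`). Good shape converts a small inradius into a small diameter: an open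
convex set contains a definite ball about the centre of its minimal ellipsoid
(`IsMinEllipsoid.closedBall_subset`), and the coordinates g_y/g_z distort distances by a bounded
factor (`IsGenerating.exists_ball_of_shape`).

On S_{τh} one has u₀ - u ≥ λ(1 - τ)h, so the weighted bound becomes a bound for D²u in which only λ
survives from the bounds on g_z. -/

/-- The derivative of `f` in the direction `v`. -/
noncomputable def dirD (v : E) (f : E → F) (x : E) : F := fderiv ℝ f x v

theorem contDiffAt_dirD {f : E → F} {x : E} {k l : ℕ} (hf : ContDiffAt ℝ l f x) (h : k + 1 ≤ l)
    (v : E) : ContDiffAt ℝ k (dirD v f) x := by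
  have h1 : ContDiffAt ℝ k (fderiv ℝ f) x := hf.fderiv_right (by exact_mod_cast h)
  exact h1.clm_apply contDiffAt_const

theorem dirD_congr {f g : E → F} {x : E} (h : f =ᶠ[𝓝 x] g) (v : E) :
    dirD v f =ᶠ[𝓝 x] dirD v g := by
  filter_upwards [h.eventuallyEq_nhds] with y hy
  simp only [dirD, hy.fderiv_eq]

theorem dirD_dirD {f : E → F} {x : E} (hf : ContDiffAt ℝ 2 f x) (v w : E) :
    dirD v (dirD w f) x = fderiv ℝ (fderiv ℝ f) x v w := by
  have h1 : DifferentiableAt ℝ (fderiv ℝ f) x :=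
    (hf.fderiv_right (m := 1) (by norm_num)).differentiableAt (by norm_num)
  have := fderiv_clm_apply h1 (differentiableAt_const w)
  change fderiv ℝ (fun y => fderiv ℝ f y w) x v = _
  rw [this]
  simp

theorem dirD_comm {f : E → F} {x : E} (hf : ContDiffAt ℝ 2 f x) (v w : E) :
    dirD v (dirD w f) x = dirD w (dirD v f) x := by
  rw [dirD_dirD hf, dirD_dirD hf]
  exact (hf.isSymmSndFDerivAt (by simp)) v w

theorem hasDerivAt_line {f : E → F} {x v : E} {t : ℝ} (hf : DifferentiableAt ℝ f (x + t • v)) :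
    HasDerivAt (fun s : ℝ => f (x + s • v)) (dirD v f (x + t • v)) t := by
  have h1 : HasDerivAt (fun s : ℝ => x + s • v) v t := by
    simpa using ((hasDerivAt_id t).smul_const v).const_add x
  exact hf.hasFDerivAt.comp_hasDerivAt t h1

/-- If the second derivative along a line were positive, the point would also be a local minimum on
that line, so the function would be constant there and the second derivative would vanish. -/
theorem dirD_dirD_nonpos_of_isLocalMax {f : E → ℝ} {x : E} (h : IsLocalMax f x)
    (hf : ContDiffAt ℝ 2 f x) (v : E) : dirD v f x = 0 ∧ dirD v (dirD v f) x ≤ 0 := by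
  have h0 : dirD v f x = 0 := by simp [dirD, h.fderiv_eq_zero]
  refine ⟨h0, ?_⟩
  by_contra! hpos
  set c : ℝ → E := fun s => x + s • v with hc
  have hcc : Continuous c := by fun_prop
  have hc0 : c 0 = x := by simp [hc]
  have hev : ∀ᶠ y in 𝓝 x, DifferentiableAt ℝ f y := by
    filter_upwards [hf.eventually (by simp)] with y hy using hy.differentiableAt (by norm_num)
  have htend : Tendsto c (𝓝 0) (𝓝 x) := by simpa [hc0] using hcc.tendsto 0
  have h1 : deriv (fun s => f (c s)) =ᶠ[𝓝 0] fun s => dirD v f (c s) := by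
    filter_upwards [htend.eventually hev] with s hs using (hasDerivAt_line hs).deriv
  have hd : DifferentiableAt ℝ (dirD v f) (x + (0 : ℝ) • v) := by
    simpa using (contDiffAt_dirD (k := 1) (l := 2) (by exact_mod_cast hf) (by norm_num)
      v).differentiableAt (by norm_num)
  have h2 : deriv (deriv fun s => f (c s)) 0 = dirD v (dirD v f) x := by
    rw [h1.deriv_eq, (hasDerivAt_line hd).deriv]; simp
  have h3 : deriv (fun s => f (c s)) 0 = 0 := by rw [h1.eq_of_nhds, hc0, h0]
  have hcont : ContinuousAt (fun s => f (c s)) 0 :=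
    ContinuousAt.comp (by rw [hc0]; exact hf.continuousAt) hcc.continuousAt
  have hmin := isLocalMin_of_deriv_deriv_pos (by rw [h2]; exact hpos) h3 hcont
  have hmax : ∀ᶠ s in 𝓝 (0 : ℝ), f (c s) ≤ f x := htend.eventually h
  have hconst : (fun s => f (c s)) =ᶠ[𝓝 0] fun _ => f x := by
    filter_upwards [hmin, hmax] with s hs1 hs2
    simp only [hc0] at hs1
    exact le_antisymm hs2 hs1
  have h4 : deriv (fun s => f (c s)) =ᶠ[𝓝 0] fun _ => 0 := by
    filter_upwards [hconst.eventuallyEq_nhds] with s hs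
    rw [hs.deriv_eq]; simp
  rw [h4.deriv_eq] at h2
  simp at h2
  linarith

theorem dirD_comp {a : F → ℝ} {j : E → F} {x : E} (ha : DifferentiableAt ℝ a (j x))
    (hj : DifferentiableAt ℝ j x) (v : E) :
    dirD v (fun y => a (j y)) x = fderiv ℝ a (j x) (dirD v j x) := by
  have := fderiv_comp x ha hj
  simp only [dirD]
  change fderiv ℝ (a ∘ j) x v = _
  rw [this]; rfl

/-- Applied to a coefficient of A along the one-jet of u, the first term is the quadratic expression
in D²A on which A3w acts. -/
theorem dirD_dirD_comp {a : F → ℝ} {j : E → F} {x : E} (ha : ContDiffAt ℝ 2 a (j x))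
    (hj : ContDiffAt ℝ 2 j x) (v : E) :
    dirD v (dirD v fun y => a (j y)) x =
      fderiv ℝ (fderiv ℝ a) (j x) (dirD v j x) (dirD v j x) +
        fderiv ℝ a (j x) (dirD v (dirD v j) x) := by
  have h1 : dirD v (fun y => a (j y)) =ᶠ[𝓝 x] fun y => fderiv ℝ a (j y) (dirD v j y) := by
    filter_upwards [hj.continuousAt.eventually (ha.eventually (by simp)), hj.eventually (by simp)]
      with y h1 h2
    exact dirD_comp (h1.differentiableAt (by norm_num)) (h2.differentiableAt (by norm_num)) v
  have h2 : DifferentiableAt ℝ (fderiv ℝ a) (j x) :=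
    (ha.fderiv_right (m := 1) (by norm_num)).differentiableAt (by norm_num)
  have h3 : DifferentiableAt ℝ j x := hj.differentiableAt (by norm_num)
  have h4 : DifferentiableAt ℝ (dirD v j) x := (contDiffAt_dirD (k := 1) (l := 2)
    (by exact_mod_cast hj) (by norm_num) v).differentiableAt (by norm_num)
  rw [(dirD_congr h1 v).eq_of_nhds]
  have h5 : fderiv ℝ (fun y => fderiv ℝ a (j y)) x = _ := fderiv_comp x h2 h3
  have h6 : fderiv ℝ (fun y => fderiv ℝ a (j y) (dirD v j y)) x = _ :=
    fderiv_clm_apply (h2.comp x h3) h4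
  change fderiv ℝ (fun y => fderiv ℝ a (j y) (dirD v j y)) x v = _
  rw [h6, h5]
  simp [dirD, add_comm]

end Directional

/-! ### Mean value inequalities on an interval -/

/-- Two applications of the mean value theorem. The factor 1/2 of Taylor's formula is given up, and
in return nothing is asked of the continuity of the second derivative. -/
theorem taylor_lower_bound {f f' f'' : ℝ → ℝ} {c : ℝ} (hc : 0 ≤ c)
    (h1 : ∀ t ∈ Icc (0 : ℝ) 1, HasDerivAt f (f' t) t)
    (h2 : ∀ t ∈ Icc (0 : ℝ) 1, HasDerivAt f' (f'' t) t)
    (h3 : ∀ t ∈ Icc (0 : ℝ) 1, -c ≤ f'' t) : f 0 + f' 0 - c ≤ f 1 := by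
  obtain ⟨t, ht, hft⟩ := exists_hasDerivAt_eq_slope f f' one_pos
    (fun t ht => (h1 t ht).continuousAt.continuousWithinAt)
    (fun t ht => h1 t (Ioo_subset_Icc_self ht))
  obtain ⟨s, hs, hfs⟩ := exists_hasDerivAt_eq_slope f' f'' ht.1
    (fun s hs => (h2 s ⟨hs.1, hs.2.trans ht.2.le⟩).continuousAt.continuousWithinAt)
    (fun s hs => h2 s ⟨hs.1.le, (hs.2.trans ht.2).le⟩)
  have h4 := h3 s ⟨hs.1.le, (hs.2.trans ht.2).le⟩
  rw [hfs, le_div_iff₀ (by linarith [ht.1])] at h4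
  have : f' t = f 1 - f 0 := by simpa using hft
  nlinarith [ht.1, ht.2]

/-! ### Curves of matrices with constant determinant -/

section Det

variable {ι : Type*} [Fintype ι] [DecidableEq ι]

/-- Jacobi's formula, by differentiating the Leibniz expansion. -/
theorem hasDerivAt_det {W W' : ℝ → Matrix ι ι ℝ} {t : ℝ}
    (h : ∀ i j, HasDerivAt (fun s => W s i j) (W' t i j) t) :
    HasDerivAt (fun s => (W s).det) ((W t).adjugate * W' t).trace t := by
  have h1 : HasDerivAt (fun s => (W s).det)
      (∑ σ : Equiv.Perm ι, (Equiv.Perm.sign σ : ℝ) *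
        ∑ i, (∏ j ∈ Finset.univ.erase i, W t (σ j) j) * W' t (σ i) i) t := by
    have : (fun s => (W s).det) = fun s => ∑ σ : Equiv.Perm ι, (Equiv.Perm.sign σ : ℝ) *
        ∏ i, W s (σ i) i := by
      ext s; rw [Matrix.det_apply']
    rw [this]
    refine HasDerivAt.fun_sum fun σ _ => HasDerivAt.const_mul _ ?_
    have := HasDerivAt.fun_finsetProd (u := Finset.univ) (f := fun i s => W s (σ i) i)
      (f' := fun i => W' t (σ i) i) (x := t) (fun i _ => h _ _)
    simpa [smul_eq_mul] using this
  convert h1 using 1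
  -- Cramer's rule: a diagonal entry of the adjugate times W' is the determinant with one column
  -- replaced by that of W'. This groups the Leibniz sum.
  have h2 : ∀ i, ((W t).adjugate * W' t) i i = ((W t).updateCol i fun k => W' t k i).det := by
    intro i
    rw [← Matrix.cramer_apply, Matrix.cramer_eq_adjugate_mulVec]
    rfl
  simp only [Matrix.trace, Matrix.diag_apply, h2, Matrix.det_apply', Finset.mul_sum]
  rw [Finset.sum_comm]
  refine Finset.sum_congr rfl fun σ _ => Finset.sum_congr rfl fun i _ => ?_
  congr 1
  rw [← Finset.mul_prod_erase _ _ (Finset.mem_univ i), mul_comm]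
  congr 1
  · refine Finset.prod_congr rfl fun j hj => ?_
    rw [Matrix.updateCol_ne (Finset.ne_of_mem_erase hj)]
  · simp

theorem trace_inv_mul_deriv_eq_zero {W W' : ℝ → Matrix ι ι ℝ} {t c : ℝ}
    (h : ∀ i j, HasDerivAt (fun s => W s i j) (W' t i j) t)
    (hdet : ∀ᶠ s in 𝓝 t, (W s).det = c) : ((W t)⁻¹ * W' t).trace = 0 := by
  have h1 := hasDerivAt_det h
  have h2 : HasDerivAt (fun s => (W s).det) 0 t :=
    (hasDerivAt_const t c).congr_of_eventuallyEq hdet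
  have h3 := h1.unique h2
  have h4 : (W t)⁻¹ = c⁻¹ • (W t).adjugate := by
    rw [Matrix.inv_def, hdet.self_of_nhds, Ring.inverse_eq_inv']
  rw [h4, Matrix.smul_mul, Matrix.trace_smul, h3, smul_zero]

/-- With constant determinant the entries of the inverse are constant multiples of cofactors, hence
differentiable; the value of the derivative then follows by differentiating W⁻¹W = 1. -/
theorem hasDerivAt_matrix_inv {W W' : ℝ → Matrix ι ι ℝ} {t c : ℝ} (hc : c ≠ 0)
    (h : ∀ i j, HasDerivAt (fun s => W s i j) (W' t i j) t)
    (hdet : ∀ᶠ s in 𝓝 t, (W s).det = c) (i j : ι) :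
    HasDerivAt (fun s => (W s)⁻¹ i j) (-((W t)⁻¹ * W' t * (W t)⁻¹) i j) t := by
  have hadj : ∀ i j, ∃ P', HasDerivAt (fun s => (W s)⁻¹ i j) P' t := by
    intro i j
    have h1 : HasDerivAt (fun s => c⁻¹ * ((W s).updateRow j (Pi.single i 1)).det) (c⁻¹ * _) t :=
      (hasDerivAt_det (W := fun s => (W s).updateRow j (Pi.single i 1))
        (W' := fun s => (W' s).updateRow j 0) (t := t) (by
          intro k l
          by_cases hk : k = j
          · subst hk; simpa using hasDerivAt_const t _
          · simpa [Matrix.updateRow_ne hk] using h k l)).const_mul c⁻¹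
    refine ⟨_, h1.congr_of_eventuallyEq ?_⟩
    filter_upwards [hdet] with s hs
    rw [Matrix.inv_def, hs, Ring.inverse_eq_inv', Matrix.smul_apply, Matrix.adjugate_apply,
      smul_eq_mul]
  choose P' hP using hadj
  have hprod : ∀ i j, HasDerivAt (fun s => ((W s)⁻¹ * W s) i j)
      ((Matrix.of P' * W t + (W t)⁻¹ * W' t) i j) t := by
    intro i j
    simp only [Matrix.mul_apply, Matrix.add_apply, Matrix.of_apply, ← Finset.sum_add_distrib]
    exact HasDerivAt.fun_sum fun k _ => (hP i k).mul (h k j)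
  have hunit : ∀ᶠ s in 𝓝 t, (W s)⁻¹ * W s = 1 := by
    filter_upwards [hdet] with s hs
    exact Matrix.nonsing_inv_mul _ (by rw [hs]; exact hc.isUnit)
  have hunit' : W t * (W t)⁻¹ = 1 :=
    Matrix.mul_nonsing_inv _ (by rw [hdet.self_of_nhds]; exact hc.isUnit)
  have hz : Matrix.of P' * W t + (W t)⁻¹ * W' t = 0 := by
    ext i j
    refine (hprod i j).unique ((hasDerivAt_const t ((1 : Matrix ι ι ℝ) i j)).congr_of_eventuallyEq ?_)
    filter_upwards [hunit] with s hs
    rw [hs]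
  have hP' : Matrix.of P' = -((W t)⁻¹ * W' t * (W t)⁻¹) := by
    have : (Matrix.of P' * W t + (W t)⁻¹ * W' t) * (W t)⁻¹ = 0 := by rw [hz, zero_mul]
    rw [add_mul, mul_assoc, hunit', mul_one] at this
    exact eq_neg_of_add_eq_zero_left this
  have := hP i j
  rwa [show P' i j = (Matrix.of P') i j from rfl, hP', Matrix.neg_apply] at this

/-- Differentiate tr(W⁻¹W') = 0, which holds on a whole neighbourhood. The right-hand side becomes
the good third order term of Pogorelov's argument. -/
theorem trace_inv_mul_second_deriv {W W' W'' : ℝ → Matrix ι ι ℝ} {t c : ℝ} (hc : c ≠ 0)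
    (h : ∀ᶠ s in 𝓝 t, ∀ i j, HasDerivAt (fun s => W s i j) (W' s i j) s)
    (h' : ∀ i j, HasDerivAt (fun s => W' s i j) (W'' t i j) t)
    (hdet : ∀ᶠ s in 𝓝 t, (W s).det = c) :
    ((W t)⁻¹ * W'' t).trace = ((W t)⁻¹ * W' t * ((W t)⁻¹ * W' t)).trace := by
  have h1 : HasDerivAt (fun s => ((W s)⁻¹ * W' s).trace)
      (-((W t)⁻¹ * W' t * (W t)⁻¹) * W' t + (W t)⁻¹ * W'' t).trace t := by
    simp only [Matrix.trace, Matrix.diag_apply, Matrix.mul_apply, Matrix.add_apply,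
      ← Finset.sum_add_distrib]
    refine HasDerivAt.fun_sum fun i _ => HasDerivAt.fun_sum fun k _ => ?_
    have := (hasDerivAt_matrix_inv hc h.self_of_nhds hdet i k).fun_mul (h' k i)
    simpa [Matrix.mul_apply] using this
  have h2 : HasDerivAt (fun s => ((W s)⁻¹ * W' s).trace) 0 t := by
    refine (hasDerivAt_const t (0 : ℝ)).congr_of_eventuallyEq ?_
    filter_upwards [h, hdet.eventually_nhds] with s hs hs'
    exact trace_inv_mul_deriv_eq_zero hs hs'
  have h3 := h1.unique h2
  rw [Matrix.trace_add, Matrix.neg_mul, Matrix.trace_neg] at h3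
  rw [← mul_assoc]
  linarith

end Det
end GJE

namespace GJE

/-! ### Algebra of the necessary conditions at a maximum point -/

section Pointwise

variable {n : ℕ} {V : Type*} [NormedAddCommGroup V] [NormedSpace ℝ V]

theorem abs_clm_le {D : V →L[ℝ] ℝ} {K : ℝ} (hD : ‖D‖ ≤ K) {x : V} {r : ℝ} (hx : ‖x‖ ≤ r) :
    |D x| ≤ K * r := by
  rw [← Real.norm_eq_abs]
  exact D.le_of_opNorm_le_of_le hD hx

theorem abs_clm₂_le {D : V →L[ℝ] V →L[ℝ] ℝ} {K : ℝ} (hD : ‖D‖ ≤ K) {x y : V} {r s : ℝ}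
    (hx : ‖x‖ ≤ r) (hy : ‖y‖ ≤ s) : |D x y| ≤ K * r * s :=
  abs_clm_le (D.le_of_opNorm_le_of_le hD hx) hy

set_option maxHeartbeats 1600000 in
/-- The differentiated equation at a point where `D²u - A` is diagonal: comparison of the second
derivatives of the largest eigenvalue with those of the trace term. Here `o` is the index of the
largest eigenvalue, `u₃` and `u₄` stand for third and fourth derivatives, `Da i j` and `D₂a i j`
for the first and second differentials of the coefficients at the one-jet, and `J k` for the
derivatives of the one-jet. -/
theorem sum_second_deriv_eigenvalue_ge {K N : ℝ} (hK : 1 ≤ K) (hN : 1 ≤ N)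
    (w F : Fin n → ℝ) (hw : ∀ i, 0 < w i) (o : Fin n) (ho : ∀ i, w i ≤ w o) (hwo : 1 ≤ w o)
    (hF : ∀ i, F i = (w i)⁻¹) (pb : Fin n → V) (ez : V) (hpb : ∀ i, ‖pb i‖ ≤ 1) (hez : ‖ez‖ ≤ 1)
    (S J : Fin n → V) (hS : ∀ i, ‖S i‖ ≤ N) (hJ : ∀ i, J i = S i + w i • pb i)
    (Da : Fin n → Fin n → V →L[ℝ] ℝ) (D₂a : Fin n → Fin n → V →L[ℝ] V →L[ℝ] ℝ)
    (hDa : ∀ i j, ‖Da i j‖ ≤ K) (hD₂a : ∀ i j, ‖D₂a i j‖ ≤ K)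
    (ha3 : ∀ i, i ≠ o → 0 ≤ D₂a i i (pb o) (pb o))
    (u₂ : Fin n → ℝ) (hu₂ : ∀ i, |u₂ i - w i| ≤ K)
    (u₃ : Fin n → Fin n → Fin n → ℝ) (hs1 : ∀ i j k, u₃ i j k = u₃ j i k)
    (hs2 : ∀ i j k, u₃ i j k = u₃ i k j) (u₄ d p q : Fin n → ℝ) (R : ℝ)
    (hd : ∀ i, d i = u₃ o o i - Da o o (J i))
    (hq : ∀ i, q i = u₄ i - (D₂a i i (J o) (J o) + Da i i (u₂ o • ez + ∑ l, u₃ l o o • pb l)))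
    (hp : ∀ i, p i = u₄ i - (D₂a o o (J i) (J i) + Da o o (u₂ i • ez + ∑ l, u₃ l i i • pb l)))
    (heq1 : ∀ k, ∑ i, F i * (u₃ i i k - Da i i (J k)) = 0)
    (heq2 : ∑ i, F i * q i = R) :
    R - 20 * n * K ^ 2 * N ^ 2 * (1 + ∑ i, F i) * w o ≤
      ∑ i, F i * (p i - ∑ k, Da i i (pb k) * d k) := by
  have hF0 : ∀ i, 0 < F i := fun i => by rw [hF]; exact inv_pos.2 (hw i)
  have hFw : ∀ i, F i * w i = 1 := fun i => by rw [hF]; exact inv_mul_cancel₀ (hw i).ne'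
  set T := ∑ i, F i with hT
  have hT0 : 0 ≤ T := Finset.sum_nonneg fun i _ => (hF0 i).le
  have hn : (1 : ℝ) ≤ n := by
    have : 0 < n := o.pos
    exact_mod_cast this
  have hJn : ∀ i, ‖J i‖ ≤ N + w i := fun i => by
    rw [hJ]
    refine (norm_add_le _ _).trans (add_le_add (hS i) ?_)
    rw [norm_smul, Real.norm_of_nonneg (hw i).le]
    exact mul_le_of_le_one_right (hw i).le (hpb i)
  have hNw : ∀ i, N + w i ≤ 2 * N * w o := fun i => by nlinarith [ho i]
  have hJn' : ∀ i, ‖J i‖ ≤ 2 * N * w o := fun i => (hJn i).trans (hNw i)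
  have hB : ∀ i j k, |Da i j (pb k)| ≤ K := fun i j k => by
    simpa using abs_clm_le (hDa i j) (hpb k)
  have hDJ : ∀ i j k, |Da i j (J k)| ≤ K * (2 * N * w o) := fun i j k =>
    abs_clm_le (hDa i j) (hJn' k)
  -- the remainder term for each index
  set r : Fin n → ℝ := fun i => D₂a i i (J o) (J o) + u₂ o * Da i i ez
    + (∑ l, Da i i (pb l) * Da o o (J l)) - D₂a o o (J i) (J i) - u₂ i * Da o o ez with hr
  -- The numbers `u₃ l o o` occur both in the twice differentiated equation and in the drift, and
  -- they cancel. Only `u₃ l i i` is left.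
  have hpt : ∀ i, p i - ∑ k, Da i i (pb k) * d k =
      q i + r i - ∑ l, u₃ l i i * Da o o (pb l) := by
    intro i
    have e1 : ∑ k, Da i i (pb k) * d k =
        (∑ l, u₃ l o o * Da i i (pb l)) - ∑ l, Da i i (pb l) * Da o o (J l) := by
      rw [← Finset.sum_sub_distrib]
      refine Finset.sum_congr rfl fun k _ => ?_
      rw [hd, show u₃ k o o = u₃ o o k by rw [hs1 k o o, hs2 o k o]]; ring
    rw [e1, hp, hq, hr]
    simp only [map_add, map_smul, map_sum, smul_eq_mul]
    ring
  -- Summed against F, the third derivatives that are left are expressed through first derivatives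
  -- of A by the once differentiated equation.
  have hsum3 : ∑ i, F i * ∑ l, u₃ l i i * Da o o (pb l) =
      ∑ l, (∑ i, F i * Da i i (J l)) * Da o o (pb l) := by
    simp_rw [Finset.mul_sum]
    rw [Finset.sum_comm]
    refine Finset.sum_congr rfl fun l _ => ?_
    have := heq1 l
    simp_rw [mul_sub, Finset.sum_sub_distrib] at this
    rw [← sub_eq_zero.1 this, Finset.sum_mul]
    refine Finset.sum_congr rfl fun i _ => ?_
    rw [show u₃ l i i = u₃ i i l by rw [hs1 l i i, hs2 i l i]]; ring
  have h3 : ∑ l, (∑ i, F i * Da i i (J l)) * Da o o (pb l) ≤ n * (K * (2 * N * w o) * T * K) := by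
    have : ∀ l ∈ Finset.univ, (∑ i, F i * Da i i (J l)) * Da o o (pb l) ≤
        K * (2 * N * w o) * T * K := by
      intro l _
      have e1 : |∑ i, F i * Da i i (J l)| ≤ K * (2 * N * w o) * T := by
        refine (Finset.abs_sum_le_sum_abs _ _).trans ?_
        rw [hT, Finset.mul_sum]
        refine Finset.sum_le_sum fun i _ => ?_
        rw [abs_mul, abs_of_pos (hF0 i), mul_comm]
        exact mul_le_mul_of_nonneg_right (hDJ i i l) (hF0 i).le
      refine (le_abs_self _).trans ?_
      rw [abs_mul]
      exact mul_le_mul e1 (hB o o l) (abs_nonneg _) (by positivity)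
    simpa using Finset.sum_le_card_nsmul _ _ _ this
  -- The term with `i = o` is kept apart because A3w says nothing about it; its size K w_o² drops to
  -- K w_o after multiplication by F_o = 1/w_o.
  have hr' : ∀ i, -(F i * (10 * n * K ^ 2 * N ^ 2 * w o) + 8 * K * N * w o)
      - (if i = o then K * w o else 0) ≤ F i * r i := by
    intro i
    have hSo := hS o
    have t1 : -(3 * K * N ^ 2 * w o) - (if i = o then K * w o ^ 2 else 0) ≤
        D₂a i i (J o) (J o) := by
      have e : D₂a i i (J o) (J o) = D₂a i i (S o) (S o) + w o * D₂a i i (S o) (pb o)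
          + w o * D₂a i i (pb o) (S o) + w o ^ 2 * D₂a i i (pb o) (pb o) := by
        rw [hJ]; simp only [map_add, map_smul, add_apply,
          smul_apply, smul_eq_mul]; ring
      have b1 := (abs_le.1 (abs_clm₂_le (hD₂a i i) hSo hSo)).1
      have b2 := (abs_le.1 (abs_clm₂_le (hD₂a i i) hSo (hpb o))).1
      have b3 := (abs_le.1 (abs_clm₂_le (hD₂a i i) (hpb o) hSo)).1
      have b4 : -(if i = o then K * w o ^ 2 else 0) ≤ w o ^ 2 * D₂a i i (pb o) (pb o) := by
        split_ifs with hi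
        · have := (abs_le.1 (abs_clm₂_le (hD₂a i i) (hpb o) (hpb o))).1
          nlinarith [sq_nonneg (w o)]
        · have := mul_nonneg (sq_nonneg (w o)) (ha3 i hi); linarith
      have b5 : -(K * N * w o) ≤ w o * D₂a i i (S o) (pb o) := by nlinarith
      have b6 : -(K * N * w o) ≤ w o * D₂a i i (pb o) (S o) := by nlinarith
      have b7 : K * N * N ≤ K * N ^ 2 * w o := by
        have : 0 ≤ K * N ^ 2 := by positivity
        nlinarith
      have b8 : K * N * w o ≤ K * N ^ 2 * w o := by
        have : 0 ≤ K * N * w o := by positivity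
        nlinarith
      rw [e]; linarith
    have hKe : ∀ i j, |Da i j ez| ≤ K := fun i j => by simpa using abs_clm_le (hDa i j) hez
    have t2 : -(2 * K ^ 2 * w o) ≤ u₂ o * Da i i ez := by
      have e1 : |u₂ o| ≤ 2 * K * w o := by
        have := abs_le.1 (hu₂ o)
        rw [abs_le]; constructor <;> nlinarith
      have : |u₂ o * Da i i ez| ≤ 2 * K * w o * K := by
        rw [abs_mul]; exact mul_le_mul e1 (hKe i i) (abs_nonneg _) (by positivity)
      have := (abs_le.1 this).1
      linarith
    have t3 : -(n * (2 * K ^ 2 * N * w o)) ≤ ∑ l, Da i i (pb l) * Da o o (J l) := by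
      have : ∀ l ∈ Finset.univ, -(2 * K ^ 2 * N * w o) ≤ Da i i (pb l) * Da o o (J l) := by
        intro l _
        have : |Da i i (pb l) * Da o o (J l)| ≤ K * (K * (2 * N * w o)) := by
          rw [abs_mul]; exact mul_le_mul (hB i i l) (hDJ o o l) (abs_nonneg _) (by positivity)
        have := (abs_le.1 this).1
        linarith
      have := Finset.card_nsmul_le_sum _ _ _ this
      simpa using this
    -- The vector `J i` can be as large as w_i, so this term is quadratic in w_i; F_i w_i = 1
    -- cancels one power.
    have t4 : F i * D₂a o o (J i) (J i) ≤ F i * (K * N ^ 2) + 3 * K * N * w o := by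
      have e1 := (abs_le.1 (abs_clm₂_le (hD₂a o o) (hJn i) (hJn i))).2
      have e2 := mul_le_mul_of_nonneg_left e1 (hF0 i).le
      have e3 : F i * (K * (N + w i) * (N + w i)) =
          F i * (K * N ^ 2) + (F i * w i) * (2 * K * N) + (F i * w i) * (K * w i) := by ring
      rw [e3, hFw] at e2
      have e4 : 2 * K * N ≤ 2 * K * N * w o := le_mul_of_one_le_right (by positivity) hwo
      have e5 : K * w i ≤ K * N * w o := by
        have := ho i
        have h1 : w i ≤ N * w o := by nlinarith
        nlinarith
      linarith
    have t5 : F i * (u₂ i * Da o o ez) ≤ F i * K ^ 2 + K := by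
      have e1 : u₂ i * Da o o ez ≤ (w i + K) * K := by
        refine (le_abs_self _).trans ?_
        rw [abs_mul]
        refine mul_le_mul ?_ (hKe o o) (abs_nonneg _) (by linarith [hw i])
        have := abs_le.1 (hu₂ i); rw [abs_le]; constructor <;> linarith [hw i]
      have e2 := mul_le_mul_of_nonneg_left e1 (hF0 i).le
      have e3 : F i * ((w i + K) * K) = F i * w i * K + F i * K ^ 2 := by ring
      rw [e3, hFw] at e2; linarith
    have t1' := mul_le_mul_of_nonneg_left t1 (hF0 i).le
    have t2' := mul_le_mul_of_nonneg_left t2 (hF0 i).le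
    have t3' := mul_le_mul_of_nonneg_left t3 (hF0 i).le
    have e6 : F i * (if i = o then K * w o ^ 2 else 0) = if i = o then K * w o else 0 := by
      split_ifs with hi
      · subst hi; have := hFw i; linear_combination (K * w i) * this
      · simp
    rw [mul_sub, e6] at t1'
    have e7 : F i * r i = F i * D₂a i i (J o) (J o) + F i * (u₂ o * Da i i ez)
      + F i * (∑ l, Da i i (pb l) * Da o o (J l)) - F i * D₂a o o (J i) (J i)
      - F i * (u₂ i * Da o o ez) := by rw [hr]; ring
    have hKN : 1 ≤ K ^ 2 * N ^ 2 := by nlinarith [mul_le_mul hK hN zero_le_one (by linarith)]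
    have c1 : K * N ^ 2 * w o ≤ n * K ^ 2 * N ^ 2 * w o := by
      have h1 : K ≤ n * K ^ 2 := by nlinarith
      have : 0 ≤ N ^ 2 * w o := by positivity
      nlinarith
    have c2 : K ^ 2 * w o ≤ n * K ^ 2 * N ^ 2 * w o := by
      have h1 : 1 ≤ n * N ^ 2 := by nlinarith
      have : 0 ≤ K ^ 2 * w o := by positivity
      nlinarith
    have c3 : n * (K ^ 2 * N * w o) ≤ n * K ^ 2 * N ^ 2 * w o := by
      have : 0 ≤ n * K ^ 2 * N * w o := by positivity
      nlinarith
    have c4 : K * N ^ 2 ≤ K * N ^ 2 * w o := le_mul_of_one_le_right (by positivity) hwo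
    have c5 : K ^ 2 ≤ K ^ 2 * w o := le_mul_of_one_le_right (by positivity) hwo
    have c6 : K ≤ K * N * w o := by
      have : 1 ≤ N * w o := by nlinarith
      nlinarith
    have hX : 3 * K * N ^ 2 * w o + 2 * K ^ 2 * w o + n * (2 * K ^ 2 * N * w o) + K * N ^ 2 + K ^ 2
        ≤ 10 * n * K ^ 2 * N ^ 2 * w o := by
      have : 0 ≤ n * K ^ 2 * N ^ 2 * w o := by positivity
      linarith only [c1, c2, c3, c4, c5, this]
    have hX' := mul_le_mul_of_nonneg_left hX (hF0 i).le
    have hpos : 0 ≤ K * N * w o := by positivity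
    rw [e7]
    linarith
  have hsr : -(T * (10 * n * K ^ 2 * N ^ 2 * w o) + n * (8 * K * N * w o)) - K * w o ≤
      ∑ i, F i * r i := by
    refine le_trans (le_of_eq ?_) (Finset.sum_le_sum fun i _ => hr' i)
    rw [Finset.sum_sub_distrib, Finset.sum_neg_distrib, Finset.sum_add_distrib, ← Finset.sum_mul]
    simp [hT]
  have hfin : ∑ i, F i * (p i - ∑ k, Da i i (pb k) * d k) =
      R + ∑ i, F i * r i - ∑ l, (∑ i, F i * Da i i (J l)) * Da o o (pb l) := by
    rw [← hsum3, ← heq2, ← Finset.sum_add_distrib, ← Finset.sum_sub_distrib]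
    refine Finset.sum_congr rfl fun i _ => ?_
    rw [hpt]; ring
  rw [hfin]
  have c1 : n * (K * (2 * N * w o) * T * K) ≤ 2 * (n * K ^ 2 * N ^ 2 * w o * T) := by
    have : 0 ≤ n * K ^ 2 * N * w o * T := by positivity
    nlinarith
  have c2 : n * (8 * K * N * w o) ≤ 8 * (n * K ^ 2 * N ^ 2 * w o) := by
    have h1 : K * N ≤ K ^ 2 * N ^ 2 := by nlinarith [mul_le_mul hK hN zero_le_one (by linarith)]
    have : 0 ≤ n * w o := by positivity
    nlinarith
  have c3 : K * w o ≤ n * K ^ 2 * N ^ 2 * w o := by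
    have h1 : K ≤ K ^ 2 * N ^ 2 := by
      have : 1 ≤ N ^ 2 := by nlinarith
      nlinarith
    have h2 : K ≤ n * (K ^ 2 * N ^ 2) := by nlinarith
    nlinarith
  have c4 : 0 ≤ n * K ^ 2 * N ^ 2 * w o := by positivity
  have c5 : 0 ≤ n * K ^ 2 * N ^ 2 * w o * T := by positivity
  linarith

/-- The contribution of the gradient term `|Du|² / 2`. -/
theorem sum_second_deriv_gradient_ge {K M : ℝ} (hM : 1 ≤ M)
    (w F : Fin n → ℝ) (hw : ∀ i, 0 < w i) (o : Fin n) (hF : ∀ i, F i = (w i)⁻¹)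
    (pb : Fin n → V) (S J : Fin n → V) (hS : ∀ i, ‖S i‖ ≤ M)
    (Da : Fin n → V →L[ℝ] ℝ) (hDa : ∀ i, ‖Da i‖ ≤ K)
    (u₁ : Fin n → ℝ) (hu₁ : ∀ i, |u₁ i| ≤ M)
    (u₂ : Fin n → Fin n → ℝ) (hu₂ : ∀ i, |u₂ i i - w i| ≤ K)
    (hJ : ∀ i, J i = S i + ∑ l, u₂ i l • pb l)
    (u₃ : Fin n → Fin n → ℝ) (heq1 : ∀ k, ∑ i, F i * (u₃ i k - Da i (J k)) = 0) :
    w o - 2 * n * K - n * M ^ 2 * K * ∑ i, F i ≤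
      ∑ i, F i * (∑ k, (u₂ k i ^ 2 + u₁ k * u₃ i k) -
        ∑ l, Da i (pb l) * ∑ k, u₁ k * u₂ k l) := by
  have hF0 : ∀ i, 0 < F i := fun i => by rw [hF]; exact inv_pos.2 (hw i)
  have hFw : ∀ i, F i * w i = 1 := fun i => by rw [hF]; exact inv_mul_cancel₀ (hw i).ne'
  -- The once differentiated equation removes `u₃`, and the drift cancels the part of `J k` that
  -- contains second derivatives of u. Only `S k` survives.
  have e1 : ∑ i, F i * (∑ k, (u₂ k i ^ 2 + u₁ k * u₃ i k) -
        ∑ l, Da i (pb l) * ∑ k, u₁ k * u₂ k l) =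
      ∑ i, F i * ∑ k, u₂ k i ^ 2 + ∑ i, F i * ∑ k, u₁ k * Da i (S k) := by
    have h1 : ∑ i, F i * ∑ k, u₁ k * (u₃ i k - Da i (J k)) = 0 := by
      simp_rw [Finset.mul_sum]
      rw [Finset.sum_comm]
      refine Finset.sum_eq_zero fun k _ => ?_
      rw [← mul_zero (u₁ k), ← heq1 k, Finset.mul_sum]
      exact Finset.sum_congr rfl fun i _ => by ring
    rw [← add_zero (_ + _), ← h1, ← Finset.sum_add_distrib, ← Finset.sum_add_distrib]
    refine Finset.sum_congr rfl fun i _ => ?_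
    rw [← mul_add, ← mul_add]
    congr 1
    have h2 : ∑ l, Da i (pb l) * ∑ k, u₁ k * u₂ k l = ∑ k, u₁ k * (Da i (J k) - Da i (S k)) := by
      simp_rw [Finset.mul_sum]
      rw [Finset.sum_comm]
      refine Finset.sum_congr rfl fun k _ => ?_
      rw [hJ, map_add, map_sum, add_sub_cancel_left, Finset.mul_sum]
      refine Finset.sum_congr rfl fun l _ => ?_
      rw [map_smul, smul_eq_mul]; ring
    rw [h2, ← Finset.sum_add_distrib, ← Finset.sum_add_distrib, ← Finset.sum_sub_distrib]
    exact Finset.sum_congr rfl fun k _ => by ring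
  -- As u_ii is within K of w_i, one has u_ii² ≥ w_i² - 2K w_i, and F_i w_i = 1.
  have h2 : ∑ i, (w i - 2 * K) ≤ ∑ i, F i * ∑ k, u₂ k i ^ 2 := by
    refine Finset.sum_le_sum fun i _ => ?_
    have h3 : u₂ i i ^ 2 ≤ ∑ k, u₂ k i ^ 2 :=
      Finset.single_le_sum (f := fun k => u₂ k i ^ 2) (fun k _ => sq_nonneg _) (Finset.mem_univ i)
    have h4 : w i * (w i - 2 * K) ≤ u₂ i i ^ 2 := by
      have := abs_le.1 (hu₂ i)
      nlinarith [hw i, sq_nonneg (u₂ i i - w i)]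
    calc w i - 2 * K = F i * (w i * (w i - 2 * K)) := by rw [← mul_assoc, hFw, one_mul]
      _ ≤ _ := mul_le_mul_of_nonneg_left (h4.trans h3) (hF0 i).le
  have h3 : w o ≤ ∑ i, w i := Finset.single_le_sum (fun i _ => (hw i).le) (Finset.mem_univ o)
  have h4 : ∑ i, F i * -(n * (M ^ 2 * K)) ≤ ∑ i, F i * ∑ k, u₁ k * Da i (S k) := by
    refine Finset.sum_le_sum fun i _ => mul_le_mul_of_nonneg_left ?_ (hF0 i).le
    have : ∀ k ∈ Finset.univ, -(M ^ 2 * K) ≤ u₁ k * Da i (S k) := by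
      intro k _
      have : |u₁ k * Da i (S k)| ≤ M * (K * M) := by
        rw [abs_mul]
        exact mul_le_mul (hu₁ k) (abs_clm_le (hDa i) (hS k)) (abs_nonneg _) (by linarith)
      have := (abs_le.1 this).1
      linarith
    simpa using Finset.card_nsmul_le_sum _ _ _ this
  rw [e1]
  rw [← Finset.sum_mul] at h4
  simp only [Finset.sum_sub_distrib, Finset.sum_const, Finset.card_univ, Fintype.card_fin,
    nsmul_eq_mul] at h2
  linarith

/-- The choice of a makes a²P²nw at most half of aw. Multiplying the rest by wv² gives a quadratic
inequality in x = w(-v), namely (a/2)x² ≤ 38P²x when x ≥ 1, with 38 = 2 + 12 + 24. -/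
theorem bound_of_quadratic_bound {P a w F v : ℝ} {n : ℕ} (hP : 1 ≤ P) (hn : (n : ℝ) ≤ P)
    (ha : a = 1 / (2 * P ^ 3)) (hw : 1 ≤ w) (hF : F = w⁻¹) (hv : v < 0) (hv1 : -1 ≤ v)
    (hkey : a * w ≤ P + a * P + 12 * P / (-v) + a ^ 2 * P ^ 2 * (n * w)
      + 24 * P ^ 2 * (F / v ^ 2)) : w * (-v) ≤ 1 + 4 * P ^ 3 * (40 * P ^ 2) := by
  have hFw : F * w = 1 := by rw [hF]; exact inv_mul_cancel₀ (by linarith)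
  have ha0 : 0 < a := by rw [ha]; positivity
  have hP3 : 1 ≤ P ^ 3 := one_le_pow₀ hP
  have ha1 : a ≤ 1 := by
    rw [ha, div_le_one (by positivity)]; linarith
  set m := -v with hm
  have hm0 : 0 < m := by linarith
  have hvm : v = -m := by linarith
  have hk2 : a ^ 2 * P ^ 2 * (n * w) ≤ a * w / 2 := by
    have h1 : a * P ^ 3 = 1 / 2 := by rw [ha]; field_simp
    have h2 : a ^ 2 * P ^ 2 * (n * w) ≤ a ^ 2 * P ^ 2 * (P * w) := by gcongr
    have h3 : a ^ 2 * P ^ 2 * (P * w) = a * w * (a * P ^ 3) := by ring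
    rw [h3, h1] at h2; linarith
  by_contra! hcon
  set x := w * m with hx
  have hx1 : 1 ≤ x := by
    have : 0 ≤ 4 * P ^ 3 * (40 * P ^ 2) := by positivity
    linarith
  have h1 : a / 2 * x ^ 2 ≤ 38 * P ^ 2 * x := by
    have e1 : a * w / 2 ≤ 2 * P + 12 * P / m + 24 * P ^ 2 * (F / v ^ 2) := by
      have : a * P ≤ P := by nlinarith
      linarith only [this, hkey, hk2]
    have e2 := mul_le_mul_of_nonneg_right e1 (show 0 ≤ w * m ^ 2 by positivity)
    have e3 : (2 * P + 12 * P / m + 24 * P ^ 2 * (F / v ^ 2)) * (w * m ^ 2) =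
        2 * P * (m * x) + 12 * P * x + 24 * P ^ 2 * (F * w) := by
      have hw0 : w ≠ 0 := by linarith only [hw]
      rw [hvm, hx]; field_simp
    rw [e3, hFw] at e2
    have e4 : m * x ≤ x := by
      have : m ≤ 1 := by linarith
      nlinarith
    have hP2 : P ≤ P ^ 2 := by nlinarith
    have e5 : P * (m * x) ≤ P ^ 2 * x := by
      have : 0 ≤ m * x := by positivity
      nlinarith
    have e6 : P * x ≤ P ^ 2 * x := by nlinarith
    have e7 : P ^ 2 ≤ P ^ 2 * x := le_mul_of_one_le_right (by positivity) hx1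
    have e8 : a * w / 2 * (w * m ^ 2) = a / 2 * x ^ 2 := by rw [hx]; ring
    rw [e8] at e2
    linarith only [e2, e5, e6, e7]
  have h2 : a / 2 * x ≤ 38 * P ^ 2 := by
    have : 0 < x := by linarith
    nlinarith
  have h3 : x ≤ 4 * P ^ 3 * (38 * P ^ 2) := by
    have e : 4 * P ^ 3 * (a / 2) = 1 := by rw [ha]; field_simp; norm_num
    calc x = 4 * P ^ 3 * (a / 2 * x) := by rw [← mul_assoc, e, one_mul]
      _ ≤ _ := mul_le_mul_of_nonneg_left h2 (by positivity)
  have : 0 ≤ P ^ 3 * P ^ 2 := by positivity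
  linarith only [h3, hcon, this]

set_option maxHeartbeats 1000000 in
/-- The algebraic conclusion of the interior second derivative estimate: the necessary conditions
at a maximum point bound the product of the largest eigenvalue `w o` and of `-v`. -/
theorem eigenvalue_mul_neg_le {P a b : ℝ} (hP : 1 ≤ P) (hn : (n : ℝ) ≤ P)
    (ha : a = 1 / (2 * P ^ 3)) (hb : b = 100 * P ^ 2)
    (w F : Fin n → ℝ) (hw : ∀ i, 0 < w i) (o : Fin n) (ho : ∀ i, w i ≤ w o) (hwo : 1 ≤ w o)
    (hF : ∀ i, F i = (w i)⁻¹)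
    (v : ℝ) (hv : v < 0) (hv1 : -1 ≤ v) (v₁ y s d c X Y Z Q : Fin n → ℝ) (R : ℝ)
    (hv₁ : ∀ i, |v₁ i| ≤ P) (hs : ∀ i, |s i| ≤ P * (1 + w i)) (hy : ∀ i, |b * y i| ≤ 1)
    (hc : ∀ i, |c i| ≤ P) (hQ : ∀ i, Q i ≤ 1 / 2)
    (crit : ∀ i, d i + 12 * (v₁ i / v) + a * s i + b * y i = 0)
    (hR : F o * d o ^ 2 + ∑ i ∈ Finset.univ.erase o, 2 * F i * (d i + c i) ^ 2 ≤ R)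
    (hX : R - P * (1 + ∑ i, F i) ≤ ∑ i, F i * X i)
    (hY : w o - P * (1 + ∑ i, F i) ≤ ∑ i, F i * Y i)
    (hZ : ∑ i, F i * Z i ≤ n + P * (-v) * ∑ i, F i + P * ∑ i, F i * |v₁ i|)
    (hmax : ∑ i, F i * (X i - d i ^ 2 + 12 * (Z i / v - v₁ i ^ 2 / v ^ 2) + a * Y i +
      b * (1 - Q i)) ≤ 0) :
    w o * (-v) ≤ 1 + 4 * P ^ 3 * (40 * P ^ 2) := by
  have hF0 : ∀ i, 0 < F i := fun i => by rw [hF]; exact inv_pos.2 (hw i)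
  have hFw : ∀ i, F i * w i = 1 := fun i => by rw [hF]; exact inv_mul_cancel₀ (hw i).ne'
  set T := ∑ i, F i with hT
  have hT0 : 0 ≤ T := Finset.sum_nonneg fun i _ => (hF0 i).le
  have ha0 : 0 < a := by rw [ha]; positivity
  have hP3 : 1 ≤ P ^ 3 := one_le_pow₀ hP
  have ha1 : a ≤ 1 := by
    rw [ha, div_le_one (by positivity)]; linarith
  set m := -v with hm
  have hm0 : 0 < m := by linarith
  have hvm : v = -m := by linarith
  -- splitting of the sum
  have hsplit : ∑ i, F i * (X i - d i ^ 2 + 12 * (Z i / v - v₁ i ^ 2 / v ^ 2) + a * Y i +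
      b * (1 - Q i)) = ∑ i, F i * X i - ∑ i, F i * (d i ^ 2 + 12 * (v₁ i ^ 2 / v ^ 2))
        - 12 / m * ∑ i, F i * Z i + a * ∑ i, F i * Y i + b * ∑ i, F i * (1 - Q i) := by
    simp only [Finset.mul_sum, ← Finset.sum_add_distrib, ← Finset.sum_sub_distrib]
    refine Finset.sum_congr rfl fun i _ => ?_
    rw [hvm]; field_simp; ring
  have hQ' : T / 2 ≤ ∑ i, F i * (1 - Q i) := by
    rw [hT, Finset.sum_div]
    refine Finset.sum_le_sum fun i _ => ?_
    nlinarith [hF0 i, hQ i]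
  have hZ' : 12 / m * ∑ i, F i * Z i ≤ 12 * P / m + 12 * P * T + 3 * P ^ 2 * T
      + 12 * ∑ i, F i * (v₁ i ^ 2 / v ^ 2) := by
    have h1 : 12 / m * ∑ i, F i * Z i ≤
        12 / m * (n + P * m * T + P * ∑ i, F i * |v₁ i|) :=
      mul_le_mul_of_nonneg_left hZ (by positivity)
    have h2 : 12 / m * (n + P * m * T + P * ∑ i, F i * |v₁ i|) =
        12 / m * n + 12 * P * T + ∑ i, F i * (12 * (P * (|v₁ i| / m))) := by
      have e1 : ∑ i, F i * (12 * (P * (|v₁ i| / m))) = 12 / m * (P * ∑ i, F i * |v₁ i|) := by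
        rw [Finset.mul_sum, Finset.mul_sum]
        exact Finset.sum_congr rfl fun i _ => by ring
      rw [e1, mul_add, mul_add]
      congr 2
      field_simp
    -- Young's inequality in the form 12Pt ≤ 3P² + 12t². Its square term doubles the 12 v_i²/v²
    -- produced by the logarithm, which is why 24 appears below.
    have h3 : ∑ i, F i * (12 * (P * (|v₁ i| / m))) ≤
        ∑ i, F i * (3 * P ^ 2 + 12 * (v₁ i ^ 2 / v ^ 2)) := by
      refine Finset.sum_le_sum fun i _ => mul_le_mul_of_nonneg_left ?_ (hF0 i).le
      have : v₁ i ^ 2 / v ^ 2 = (|v₁ i| / m) ^ 2 := by rw [div_pow, sq_abs, hvm, neg_sq]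
      rw [this]
      nlinarith [sq_nonneg (P - 2 * (|v₁ i| / m))]
    have h4 : ∑ i, F i * (3 * P ^ 2 + 12 * (v₁ i ^ 2 / v ^ 2)) =
        3 * P ^ 2 * T + 12 * ∑ i, F i * (v₁ i ^ 2 / v ^ 2) := by
      rw [hT, Finset.mul_sum, Finset.mul_sum, ← Finset.sum_add_distrib]
      exact Finset.sum_congr rfl fun i _ => by ring
    have h5 : 12 / m * n ≤ 12 * P / m := by
      rw [div_mul_eq_mul_div]; gcongr
    linarith
  have hcomb : ∑ i, F i * (d i ^ 2 + 12 * (v₁ i ^ 2 / v ^ 2)) +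
      12 * ∑ i, F i * (v₁ i ^ 2 / v ^ 2) = ∑ i, F i * (d i ^ 2 + 24 * (v₁ i ^ 2 / v ^ 2)) := by
    rw [Finset.mul_sum, ← Finset.sum_add_distrib]
    exact Finset.sum_congr rfl fun i _ => by ring
  -- the indices other than `o`
  have hne : ∀ i, F i * (d i ^ 2 + 24 * (v₁ i ^ 2 / v ^ 2)) ≤ 2 * F i * (d i + c i) ^ 2 +
      (F i * (7 * P ^ 2) + a ^ 2 * P ^ 2 * (F i + w i)) := by
    intro i
    -- The first order condition gives 24 v_i²/v² = (1/6)(d + as + by)², at most half the sum of the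
    -- squares. The exponent 12 is large enough that d² then carries the coefficient 3/2, below the
    -- 2 supplied by the third order term.
    have h1 : 24 * (v₁ i ^ 2 / v ^ 2) ≤ 1 / 2 * (d i ^ 2 + (a * s i) ^ 2 + (b * y i) ^ 2) := by
      have h2 : 12 * (v₁ i / v) = -(d i + a * s i + b * y i) := by linarith [crit i]
      have h3 : 24 * (v₁ i ^ 2 / v ^ 2) = 1 / 6 * (12 * (v₁ i / v)) ^ 2 := by
        rw [← div_pow]; ring
      rw [h3, h2]
      nlinarith [sq_nonneg (d i - a * s i), sq_nonneg (d i - b * y i),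
        sq_nonneg (a * s i - b * y i)]
    have h2 : (b * y i) ^ 2 ≤ 1 := by
      rw [← sq_abs]; exact pow_le_one₀ (abs_nonneg _) (hy i)
    have h3 : (c i) ^ 2 ≤ P ^ 2 := by
      rw [← sq_abs]; exact pow_le_pow_left₀ (abs_nonneg _) (hc i) 2
    have h4 : s i ^ 2 ≤ P ^ 2 * (2 * (1 + w i ^ 2)) := by
      rw [← sq_abs]
      refine (pow_le_pow_left₀ (abs_nonneg _) (hs i) 2).trans ?_
      rw [mul_pow]
      exact mul_le_mul_of_nonneg_left (by nlinarith [sq_nonneg (1 - w i)]) (sq_nonneg _)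
    have h5 : d i ^ 2 * (3 / 2) ≤ 2 * (d i + c i) ^ 2 + 6 * c i ^ 2 := by
      nlinarith [sq_nonneg (d i + 4 * c i)]
    have h6 : (a * s i) ^ 2 ≤ a ^ 2 * (P ^ 2 * (2 * (1 + w i ^ 2))) := by
      rw [mul_pow]; exact mul_le_mul_of_nonneg_left h4 (sq_nonneg _)
    have hP2 : 1 ≤ P ^ 2 := one_le_pow₀ hP
    have h7 : d i ^ 2 + 24 * (v₁ i ^ 2 / v ^ 2) ≤ 2 * (d i + c i) ^ 2 + 7 * P ^ 2 +
        a ^ 2 * P ^ 2 * (1 + w i ^ 2) := by linarith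
    have h8 := mul_le_mul_of_nonneg_left h7 (hF0 i).le
    have h9 : F i * (2 * (d i + c i) ^ 2 + 7 * P ^ 2 + a ^ 2 * P ^ 2 * (1 + w i ^ 2)) =
      2 * F i * (d i + c i) ^ 2 + (F i * (7 * P ^ 2) + a ^ 2 * P ^ 2 * (F i + (F i * w i) * w i)) :=
        by ring
    rw [h9, hFw, one_mul] at h8
    exact h8
  have hsum : ∑ i, F i * (d i ^ 2 + 24 * (v₁ i ^ 2 / v ^ 2)) ≤
      R + (7 * P ^ 2 * T + a ^ 2 * P ^ 2 * (T + n * w o)) + 24 * P ^ 2 * (F o / v ^ 2) := by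
    rw [← Finset.add_sum_erase _ _ (Finset.mem_univ o)]
    -- For the index `o` the third order term has coefficient 1 and just cancels d_o². The term 24
    -- v_o²/v² stays, but with the small weight F_o = 1/w_o.
    have h1 : F o * (d o ^ 2 + 24 * (v₁ o ^ 2 / v ^ 2)) ≤
        F o * d o ^ 2 + 24 * P ^ 2 * (F o / v ^ 2) := by
      have : v₁ o ^ 2 ≤ P ^ 2 := by
        rw [← sq_abs]; exact pow_le_pow_left₀ (abs_nonneg _) (hv₁ o) 2
      have h2 : v₁ o ^ 2 / v ^ 2 ≤ P ^ 2 / v ^ 2 := by gcongr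
      have h3 := mul_le_mul_of_nonneg_left h2 (hF0 o).le
      have h4 : F o * (P ^ 2 / v ^ 2) = P ^ 2 * (F o / v ^ 2) := by ring
      linarith
    have h2 : ∑ i ∈ Finset.univ.erase o, F i * (d i ^ 2 + 24 * (v₁ i ^ 2 / v ^ 2)) ≤
        ∑ i ∈ Finset.univ.erase o, 2 * F i * (d i + c i) ^ 2 +
        ∑ i, (F i * (7 * P ^ 2) + a ^ 2 * P ^ 2 * (F i + w i)) := by
      refine (Finset.sum_le_sum fun i _ => hne i).trans ?_
      rw [Finset.sum_add_distrib]
      refine add_le_add le_rfl ?_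
      refine Finset.sum_le_sum_of_subset_of_nonneg (Finset.erase_subset _ _) fun i _ _ => ?_
      have := hF0 i
      have := hw i
      positivity
    have h3 : ∑ i, (F i * (7 * P ^ 2) + a ^ 2 * P ^ 2 * (F i + w i)) ≤
        7 * P ^ 2 * T + a ^ 2 * P ^ 2 * (T + n * w o) := by
      rw [Finset.sum_add_distrib, ← Finset.sum_mul, ← Finset.mul_sum, Finset.sum_add_distrib]
      have : ∑ i, w i ≤ n * w o := by
        simpa using Finset.sum_le_card_nsmul Finset.univ _ _ fun i _ => ho i
      have h4 : a ^ 2 * P ^ 2 * (∑ i, F i + ∑ i, w i) ≤ a ^ 2 * P ^ 2 * (T + n * w o) := by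
        gcongr
      linarith only [this, h4]
    linarith only [h1, h2, h3, hR]
  -- conclusion
  have hkey : a * w o ≤ P + a * P + 12 * P / m + a ^ 2 * P ^ 2 * (n * w o)
      + 24 * P ^ 2 * (F o / v ^ 2) := by
    rw [hsplit] at hmax
    have h1 := mul_le_mul_of_nonneg_left hY ha0.le
    have h2 := mul_le_mul_of_nonneg_left hQ' (show 0 ≤ b by rw [hb]; positivity)
    -- All multiples of T = tr F are absorbed here: b = 100P² makes bT/2 = 50P²T larger than their
    -- total.
    have h3 : (P + 12 * P + 3 * P ^ 2 + 7 * P ^ 2 + a ^ 2 * P ^ 2 + a * P) * T ≤ b * (T / 2) := by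
      have h4 : a ^ 2 ≤ 1 := pow_le_one₀ ha0.le ha1
      have h5 : P ≤ P ^ 2 := by nlinarith
      have h6 : a * P ≤ P ^ 2 := by nlinarith
      have h7 : P + 12 * P + 3 * P ^ 2 + 7 * P ^ 2 + a ^ 2 * P ^ 2 + a * P ≤ 50 * P ^ 2 := by
        nlinarith [sq_nonneg P]
      rw [hb]
      have := mul_le_mul_of_nonneg_right h7 hT0
      linarith only [this]
    linarith only [hmax, h1, h2, h3, hX, hZ', hcomb, hsum]
  exact bound_of_quadratic_bound hP hn ha hwo (hF o) hv hv1 hkey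

end Pointwise
end GJE

namespace GJE

/-! ### One-jets and the augmented Hessian -/

section Jets

variable {n : ℕ}

theorem inner_gradient (u : Eu n → ℝ) (x v : Eu n) : inner ℝ v (∇ u x) = dirD v u x := by
  rw [real_inner_comm]
  simp [gradient, dirD]

theorem gradient_eq_sum (b : OrthonormalBasis (Fin n) ℝ (Eu n)) (u : Eu n → ℝ) :
    ∇ u = fun x => ∑ l, dirD (b l) u x • b l := by
  ext1 x
  rw [← b.sum_repr' (∇ u x)]
  simp only [inner_gradient]

theorem dirD_sum_smul (v : Eu n) {f : Fin n → Eu n → ℝ} {x : Eu n}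
    (hf : ∀ l, DifferentiableAt ℝ (f l) x) (e : Fin n → Eu n) :
    dirD v (fun x => ∑ l, f l x • e l) x = ∑ l, dirD v (f l) x • e l := by
  have : HasFDerivAt (fun x => ∑ l, f l x • e l)
      (∑ l, (fderiv ℝ (f l) x).smulRight (e l)) x :=
    HasFDerivAt.fun_sum fun l _ => (hf l).hasFDerivAt.smul_const (e l)
  simp [dirD, this.fderiv]

theorem contDiffAt_gradient {u : Eu n → ℝ} {x : Eu n} {k l : ℕ} (hu : ContDiffAt ℝ l u x)
    (h : k + 1 ≤ l) : ContDiffAt ℝ k (∇ u) x := by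
  have h1 : ContDiffAt ℝ k (fderiv ℝ u) x := hu.fderiv_right (by exact_mod_cast h)
  exact (InnerProductSpace.toDual ℝ (Eu n)).symm.contDiff.contDiffAt.comp x h1

theorem contDiffAt_jet {u : Eu n → ℝ} {x : Eu n} {k l : ℕ} (hu : ContDiffAt ℝ l u x)
    (h : k + 1 ≤ l) : ContDiffAt ℝ k (jet u) x :=
  contDiffAt_id.prodMk ((hu.of_le (by exact_mod_cast (by omega : k ≤ l))).prodMk
    (contDiffAt_gradient hu h))

/-- The gradient component is expanded in an arbitrary orthonormal basis, since the formula is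
needed in the eigenbasis of D²u - A. -/
theorem dirD_jet (b : OrthonormalBasis (Fin n) ℝ (Eu n)) {u : Eu n → ℝ} {x : Eu n}
    (hu : ContDiffAt ℝ 2 u x) (v : Eu n) :
    dirD v (jet u) x = (v, dirD v u x, ∑ l, dirD v (dirD (b l) u) x • b l) := by
  have h1 : DifferentiableAt ℝ u x := hu.differentiableAt (by norm_num)
  have h2 : DifferentiableAt ℝ (∇ u) x := (contDiffAt_gradient (k := 1) (l := 2)
    (by exact_mod_cast hu) le_rfl).differentiableAt (by norm_num)
  have h3 : HasFDerivAt (jet u) ((ContinuousLinearMap.id ℝ (Eu n)).prod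
      ((fderiv ℝ u x).prod (fderiv ℝ (∇ u) x))) x :=
    (hasFDerivAt_id x).prodMk (h1.hasFDerivAt.prodMk h2.hasFDerivAt)
  have h4 : dirD v (∇ u) x = ∑ l, dirD v (dirD (b l) u) x • b l := by
    rw [gradient_eq_sum b, dirD_sum_smul]
    exact fun l => (contDiffAt_dirD (k := 1) (l := 2) (by exact_mod_cast hu) le_rfl
      (b l)).differentiableAt (by norm_num)
  rw [← h4]
  simp [dirD, h3.fderiv]

theorem dirD_dirD_jet (b : OrthonormalBasis (Fin n) ℝ (Eu n)) {u : Eu n → ℝ} {x : Eu n}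
    (hu : ContDiffAt ℝ 3 u x) (v : Eu n) :
    dirD v (dirD v (jet u)) x =
      (0, dirD v (dirD v u) x, ∑ l, dirD v (dirD v (dirD (b l) u)) x • b l) := by
  have h0 : dirD v (jet u) =ᶠ[𝓝 x]
      fun y => (v, dirD v u y, ∑ l, dirD v (dirD (b l) u) y • b l) := by
    filter_upwards [hu.eventually (by simp)] with y hy
    exact dirD_jet b (hy.of_le (by norm_num)) v
  have hu' : ContDiffAt ℝ (3 : ℕ) u x := by exact_mod_cast hu
  have h1 : DifferentiableAt ℝ (dirD v u) x :=
    (contDiffAt_dirD (k := 1) hu' (by norm_num) v).differentiableAt (by norm_num)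
  have h2 : ∀ l, DifferentiableAt ℝ (dirD v (dirD (b l) u)) x := fun l =>
    (contDiffAt_dirD (k := 1) (contDiffAt_dirD (k := 2) hu' (by norm_num) (b l)) (by norm_num)
      v).differentiableAt (by norm_num)
  have h3 : DifferentiableAt ℝ (fun y => ∑ l, dirD v (dirD (b l) u) y • b l) x :=
    DifferentiableAt.fun_sum fun l _ => (h2 l).smul_const (b l)
  have h4 : HasFDerivAt (fun y => (v, dirD v u y, ∑ l, dirD v (dirD (b l) u) y • b l))
      ((0 : Eu n →L[ℝ] Eu n).prod ((fderiv ℝ (dirD v u) x).prod (fderiv ℝ _ x))) x :=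
    (hasFDerivAt_const v x).prodMk (h1.hasFDerivAt.prodMk h3.hasFDerivAt)
  rw [(dirD_congr h0 v).eq_of_nhds, ← dirD_sum_smul v h2]
  change fderiv ℝ _ x v = _
  rw [h4.fderiv]
  rfl

/-- The bounds on the coefficients `a ξ η = A_{ij} ξ_i η_j` that the second derivative estimate
uses. -/
structure CoefBounds (𝒰 : Set (Jet n)) (a : Eu n → Eu n → Jet n → ℝ) (K : ℝ) : Prop where
  isOpen : IsOpen 𝒰
  contDiff : ∀ ξ η, ContDiffOn ℝ 2 (a ξ η) 𝒰
  bilin : ∀ w, ∃ B : Eu n →ₗ[ℝ] Eu n →ₗ[ℝ] ℝ, ∀ ξ η, a ξ η w = B ξ η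
  symm : ∀ w ∈ 𝒰, ∀ ξ η, a ξ η w = a η ξ w
  bound : ∀ w ∈ 𝒰, ∀ ξ η, ‖ξ‖ ≤ 1 → ‖η‖ ≤ 1 → |a ξ η w| ≤ K
  bound₁ : ∀ w ∈ 𝒰, ∀ ξ η, ‖ξ‖ ≤ 1 → ‖η‖ ≤ 1 → ‖fderiv ℝ (a ξ η) w‖ ≤ K
  bound₂ : ∀ w ∈ 𝒰, ∀ ξ η, ‖ξ‖ ≤ 1 → ‖η‖ ≤ 1 → ‖fderiv ℝ (fderiv ℝ (a ξ η)) w‖ ≤ K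
  a3w : ∀ w ∈ 𝒰, ∀ ξ η : Eu n, ‖ξ‖ = 1 → inner ℝ ξ η = 0 →
    0 ≤ fderiv ℝ (fderiv ℝ (a ξ ξ)) w (0, 0, η) (0, 0, η)

/-- The bilinear form `D²u - A(·, u, Du)`. -/
noncomputable def augHess (a : Eu n → Eu n → Jet n → ℝ) (u : Eu n → ℝ) (ξ η x : Eu n) : ℝ :=
  dirD ξ (dirD η u) x - a ξ η (jet u x)

section

variable {𝒰 : Set (Jet n)} {a : Eu n → Eu n → Jet n → ℝ} {K : ℝ}

theorem CoefBounds.contDiffAt (ha : CoefBounds 𝒰 a K) {w : Jet n} (hw : w ∈ 𝒰) (ξ η : Eu n) :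
    ContDiffAt ℝ 2 (a ξ η) w :=
  (ha.contDiff ξ η).contDiffAt (ha.isOpen.mem_nhds hw)

theorem contDiffAt_augHess (ha : CoefBounds 𝒰 a K) {u : Eu n → ℝ} {x : Eu n}
    (hu : ContDiffAt ℝ 4 u x) (hx : jet u x ∈ 𝒰) (ξ η : Eu n) :
    ContDiffAt ℝ 2 (augHess a u ξ η) x := by
  have hu' : ContDiffAt ℝ (4 : ℕ) u x := by exact_mod_cast hu
  have h1 := contDiffAt_dirD (k := 2) (contDiffAt_dirD (k := 3) hu' (by norm_num) η)
    (by norm_num) ξ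
  have h2 := contDiffAt_jet (k := 2) hu' (by norm_num)
  exact ContDiffAt.sub (by exact_mod_cast h1)
    ((ha.contDiffAt hx ξ η).comp x (by exact_mod_cast h2))

theorem dirD_augHess (ha : CoefBounds 𝒰 a K) {u : Eu n → ℝ} {x : Eu n}
    (hu : ContDiffAt ℝ 3 u x) (hx : jet u x ∈ 𝒰) (ξ η v : Eu n) :
    dirD v (augHess a u ξ η) x =
      dirD v (dirD ξ (dirD η u)) x - fderiv ℝ (a ξ η) (jet u x) (dirD v (jet u) x) := by
  have hu' : ContDiffAt ℝ (3 : ℕ) u x := by exact_mod_cast hu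
  have h1 : DifferentiableAt ℝ (dirD ξ (dirD η u)) x := (contDiffAt_dirD (k := 1)
    (contDiffAt_dirD (k := 2) hu' (by norm_num) η) (by norm_num) ξ).differentiableAt (by norm_num)
  have h2 : DifferentiableAt ℝ (jet u) x :=
    (contDiffAt_jet (k := 2) hu' (by norm_num)).differentiableAt (by norm_num)
  have h3 : DifferentiableAt ℝ (a ξ η) (jet u x) :=
    (ha.contDiffAt hx ξ η).differentiableAt (by norm_num)
  rw [← dirD_comp h3 h2]
  have := fderiv_fun_sub h1 (h3.comp x h2)
  change fderiv ℝ (fun y => dirD ξ (dirD η u) y - (a ξ η ∘ jet u) y) x v = _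
  rw [this]; rfl

theorem dirD_dirD_augHess (ha : CoefBounds 𝒰 a K) {u : Eu n → ℝ} {x : Eu n}
    (hu : ContDiffAt ℝ 4 u x) (hx : jet u x ∈ 𝒰) (ξ η v : Eu n) :
    dirD v (dirD v (augHess a u ξ η)) x =
      dirD v (dirD v (dirD ξ (dirD η u))) x -
        (fderiv ℝ (fderiv ℝ (a ξ η)) (jet u x) (dirD v (jet u) x) (dirD v (jet u) x) +
          fderiv ℝ (a ξ η) (jet u x) (dirD v (dirD v (jet u)) x)) := by
  have hu' : ContDiffAt ℝ (4 : ℕ) u x := by exact_mod_cast hu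
  have hj : ContDiffAt ℝ (3 : ℕ) (jet u) x := contDiffAt_jet hu' (by norm_num)
  have hj2 : ContDiffAt ℝ 2 (jet u) x := hj.of_le (by norm_num)
  have hev : dirD v (augHess a u ξ η) =ᶠ[𝓝 x] fun y =>
      dirD v (dirD ξ (dirD η u)) y - dirD v (fun y => a ξ η (jet u y)) y := by
    filter_upwards [hu.eventually (by simp), hj.continuousAt.eventually (ha.isOpen.mem_nhds hx),
      hj.eventually (by simp)] with y h1 h2 h3
    rw [dirD_augHess ha (h1.of_le (by norm_num)) h2]
    rw [dirD_comp ((ha.contDiffAt h2 ξ η).differentiableAt (by norm_num))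
      (h3.differentiableAt (by norm_num))]
  have h1 : DifferentiableAt ℝ (dirD v (dirD ξ (dirD η u))) x := (contDiffAt_dirD (k := 1)
    (contDiffAt_dirD (k := 2) (contDiffAt_dirD (k := 3) hu' (by norm_num) η) (by norm_num) ξ)
      (by norm_num) v).differentiableAt (by norm_num)
  have h4 : ContDiffAt ℝ (2 : ℕ) (fun y => a ξ η (jet u y)) x :=
    (ha.contDiffAt hx ξ η).comp x hj2
  have h2 : DifferentiableAt ℝ (dirD v (fun y => a ξ η (jet u y))) x :=
    (contDiffAt_dirD (k := 1) h4 (by norm_num) v).differentiableAt (by norm_num)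
  rw [(dirD_congr hev v).eq_of_nhds, ← dirD_dirD_comp (ha.contDiffAt hx ξ η) hj2]
  have := fderiv_fun_sub h1 h2
  simp only [dirD] at this ⊢
  rw [this]; rfl

end

/-! ### Symmetry of third and fourth derivatives -/

theorem dirD₃_comm {u : Eu n → ℝ} {x : Eu n} (hu : ContDiffAt ℝ 3 u x) (e f g : Eu n) :
    dirD e (dirD f (dirD g u)) x = dirD f (dirD e (dirD g u)) x ∧
    dirD e (dirD f (dirD g u)) x = dirD e (dirD g (dirD f u)) x := by
  have hu' : ContDiffAt ℝ (3 : ℕ) u x := by exact_mod_cast hu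
  constructor
  · exact dirD_comm (by exact_mod_cast contDiffAt_dirD (k := 2) hu' (by norm_num) g) e f
  · refine (dirD_congr ?_ e).eq_of_nhds
    filter_upwards [hu.eventually (by simp)] with y hy
    exact dirD_comm (hy.of_le (by norm_num)) f g

/-- Derivatives are exchanged one adjacent pair at a time, using that the third order symmetries
hold in a neighbourhood. This identifies the fourth derivatives in L W_oo with those in the twice
differentiated equation. -/
theorem dirD₄_comm {u : Eu n → ℝ} {x : Eu n} (hu : ContDiffAt ℝ 4 u x) (e f : Eu n) :
    dirD e (dirD e (dirD f (dirD f u))) x = dirD f (dirD f (dirD e (dirD e u))) x := by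
  have hu' : ContDiffAt ℝ (4 : ℕ) u x := by exact_mod_cast hu
  have hev : ∀ᶠ y in 𝓝 x, ContDiffAt ℝ 3 u y := by
    filter_upwards [hu.eventually (by simp)] with y hy using hy.of_le (by norm_num)
  have h1 : ∀ e f : Eu n, dirD e (dirD f (dirD f u)) =ᶠ[𝓝 x] dirD f (dirD e (dirD f u)) :=
    fun e f => by filter_upwards [hev] with y hy using (dirD₃_comm hy e f f).1
  have h2 : dirD e (dirD e (dirD f u)) =ᶠ[𝓝 x] dirD e (dirD f (dirD e u)) := by
    filter_upwards [hev] with y hy using (dirD₃_comm hy e e f).2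
  have h3 : ContDiffAt ℝ 2 (dirD e (dirD f u)) x := by
    exact_mod_cast contDiffAt_dirD (k := 2) (contDiffAt_dirD (k := 3) hu' (by norm_num) f)
      (by norm_num) e
  rw [(dirD_congr (h1 e f) e).eq_of_nhds, dirD_comm h3, (dirD_congr h2 f).eq_of_nhds,
    (dirD_congr (h1 f e) f).eq_of_nhds]

end Jets
end GJE

namespace GJE

/-! ### Calculus rules for first and second directional derivatives -/

section DirectionalRules

variable {E : Type*} [NormedAddCommGroup E] [NormedSpace ℝ E] {f g : E → ℝ} {x : E}

theorem dirD_add (hf : DifferentiableAt ℝ f x) (hg : DifferentiableAt ℝ g x) (v : E) :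
    dirD v (fun y => f y + g y) x = dirD v f x + dirD v g x := by
  simp only [dirD]; rw [fderiv_fun_add hf hg]; rfl

theorem dirD_const_mul (hf : DifferentiableAt ℝ f x) (c : ℝ) (v : E) :
    dirD v (fun y => c * f y) x = c * dirD v f x := by
  simp only [dirD]; rw [fderiv_const_mul hf]; rfl

theorem dirD_mul (hf : DifferentiableAt ℝ f x) (hg : DifferentiableAt ℝ g x) (v : E) :
    dirD v (fun y => f y * g y) x = f x * dirD v g x + g x * dirD v f x := by
  simp only [dirD]; rw [fderiv_fun_mul hf hg]; rfl

theorem ContDiffAt.eventually_differentiableAt (hf : ContDiffAt ℝ 2 f x) :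
    ∀ᶠ y in 𝓝 x, DifferentiableAt ℝ f y := by
  filter_upwards [hf.eventually (by simp)] with y hy using hy.differentiableAt (by norm_num)

theorem differentiableAt_dirD (hf : ContDiffAt ℝ 2 f x) (v : E) :
    DifferentiableAt ℝ (dirD v f) x :=
  (contDiffAt_dirD (k := 1) (l := 2) (by exact_mod_cast hf) le_rfl v).differentiableAt
    (by norm_num)

theorem dirD₂_add (hf : ContDiffAt ℝ 2 f x) (hg : ContDiffAt ℝ 2 g x) (v : E) :
    dirD v (dirD v fun y => f y + g y) x = dirD v (dirD v f) x + dirD v (dirD v g) x := by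
  rw [← dirD_add (differentiableAt_dirD hf v) (differentiableAt_dirD hg v)]
  refine (dirD_congr ?_ v).eq_of_nhds
  filter_upwards [ContDiffAt.eventually_differentiableAt hf,
    ContDiffAt.eventually_differentiableAt hg] with y h1 h2 using dirD_add h1 h2 v

theorem dirD₂_const_mul (hf : ContDiffAt ℝ 2 f x) (c : ℝ) (v : E) :
    dirD v (dirD v fun y => c * f y) x = c * dirD v (dirD v f) x := by
  rw [← dirD_const_mul (differentiableAt_dirD hf v)]
  refine (dirD_congr ?_ v).eq_of_nhds
  filter_upwards [ContDiffAt.eventually_differentiableAt hf] with y h1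
    using dirD_const_mul h1 c v

theorem dirD₂_mul_self (hf : ContDiffAt ℝ 2 f x) (v : E) :
    dirD v (dirD v fun y => f y * f y) x = 2 * (dirD v f x ^ 2 + f x * dirD v (dirD v f) x) := by
  have h0 : dirD v (fun y => f y * f y) =ᶠ[𝓝 x] fun y => 2 * (f y * dirD v f y) := by
    filter_upwards [ContDiffAt.eventually_differentiableAt hf] with y h1
    rw [dirD_mul h1 h1]; ring
  have hd := hf.differentiableAt (n := 2) (by norm_num)
  rw [(dirD_congr h0 v).eq_of_nhds, dirD_const_mul (hd.fun_mul (differentiableAt_dirD hf v)),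
    dirD_mul hd (differentiableAt_dirD hf v)]
  ring

theorem dirD_log (hf : DifferentiableAt ℝ f x) (h0 : f x ≠ 0) (v : E) :
    dirD v (fun y => Real.log (f y)) x = dirD v f x / f x := by
  simp only [dirD]
  rw [fderiv.log hf h0]
  simp [div_eq_inv_mul]

theorem dirD₂_log (hf : ContDiffAt ℝ 2 f x) (h0 : f x ≠ 0) (v : E) :
    dirD v (dirD v fun y => Real.log (f y)) x =
      dirD v (dirD v f) x / f x - dirD v f x ^ 2 / f x ^ 2 := by
  have hev : dirD v (fun y => Real.log (f y)) =ᶠ[𝓝 x] fun y => dirD v f y * (f y)⁻¹ := by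
    filter_upwards [ContDiffAt.eventually_differentiableAt hf,
      hf.continuousAt.eventually_ne h0] with y h1 h2
    rw [dirD_log h1 h2, div_eq_mul_inv]
  have hd := hf.differentiableAt (n := 2) (by norm_num)
  have hinv : dirD v (fun y => (f y)⁻¹) x = -(dirD v f x / f x ^ 2) := by
    have := ((_root_.hasDerivAt_inv h0).comp_hasFDerivAt x hd.hasFDerivAt).fderiv
    simp only [dirD]
    rw [show (fun y => (f y)⁻¹) = Inv.inv ∘ f from rfl, this]
    simp [div_eq_inv_mul]
  rw [(dirD_congr hev v).eq_of_nhds, dirD_mul (differentiableAt_dirD hf v) (hd.fun_inv h0), hinv]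
  field_simp
  ring

theorem dirD₂_sum {ι : Type*} (s : Finset ι) {f : ι → E → ℝ}
    (hf : ∀ i ∈ s, ContDiffAt ℝ 2 (f i) x) (v : E) :
    dirD v (fun y => ∑ i ∈ s, f i y) x = ∑ i ∈ s, dirD v (f i) x ∧
    dirD v (dirD v fun y => ∑ i ∈ s, f i y) x = ∑ i ∈ s, dirD v (dirD v (f i)) x := by
  classical
  induction s using Finset.induction_on with
  | empty =>
    have h : dirD v (fun _ : E => (0 : ℝ)) = fun _ => 0 := by ext y; simp [dirD]
    simp [h]
  | insert i s hi ih =>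
    have hf' : ∀ j ∈ s, ContDiffAt ℝ 2 (f j) x := fun j hj => hf j (Finset.mem_insert_of_mem hj)
    have h1 := hf i (Finset.mem_insert_self i s)
    have h2 : ContDiffAt ℝ 2 (fun y => ∑ j ∈ s, f j y) x := ContDiffAt.sum hf'
    simp only [Finset.sum_insert hi]
    exact ⟨by rw [dirD_add (h1.differentiableAt (by norm_num)) (h2.differentiableAt (by norm_num)),
      (ih hf').1], by rw [dirD₂_add h1 h2, (ih hf').2]⟩

end DirectionalRules

/-! ### Taylor estimates for the coefficients and the use of A3w -/

section Taylor

variable {n : ℕ} {𝒰 : Set (Jet n)} {a : Eu n → Eu n → Jet n → ℝ} {K : ℝ}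

theorem norm_mk_zero_zero (q : Eu n) : ‖((0, 0, q) : Jet n)‖ = ‖q‖ := by
  simp [Prod.norm_def]

theorem CoefBounds.norm_sub_le (ha : CoefBounds 𝒰 a K) {w w' : Jet n}
    (h : segment ℝ w w' ⊆ 𝒰) {ξ η : Eu n} (hξ : ‖ξ‖ ≤ 1) (hη : ‖η‖ ≤ 1) :
    |a ξ η w - a ξ η w'| ≤ K * ‖w - w'‖ := by
  have := (convex_segment w w').norm_image_sub_le_of_norm_hasFDerivWithin_le (f := a ξ η)
    (f' := fderiv ℝ (a ξ η)) (C := K) (fun y hy =>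
      ((ha.contDiffAt (h hy) ξ η).differentiableAt (by norm_num)).hasFDerivAt.hasFDerivWithinAt)
    (fun y hy => ha.bound₁ y (h hy) ξ η hξ hη) (right_mem_segment ℝ w w') (left_mem_segment ℝ w w')
  simpa using this

theorem mem_segment_jet_grad {x : Eu n} {s : ℝ} {p p' : Eu n}
    (h : ∀ q ∈ segment ℝ p p', (x, s, q) ∈ 𝒰) :
    segment ℝ ((x, s, p) : Jet n) (x, s, p') ⊆ 𝒰 := by
  rintro _ ⟨α, β, hα, hβ, hαβ, rfl⟩
  have h1 := h (α • p + β • p') ⟨α, β, hα, hβ, hαβ, rfl⟩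
  have h2 : α • x + β • x = x := by rw [← add_smul, hαβ, one_smul]
  have h3 : α * s + β * s = s := by rw [← add_mul, hαβ, one_mul]
  simpa [h2, h3] using h1

theorem mem_segment_jet_val {x : Eu n} {s s' : ℝ} {p : Eu n}
    (h : ∀ r ∈ segment ℝ s s', (x, r, p) ∈ 𝒰) :
    segment ℝ ((x, s, p) : Jet n) (x, s', p) ⊆ 𝒰 := by
  rintro _ ⟨α, β, hα, hβ, hαβ, rfl⟩
  have h1 := h (α • s + β • s') ⟨α, β, hα, hβ, hαβ, rfl⟩
  have h2 : α • x + β • x = x := by rw [← add_smul, hαβ, one_smul]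
  have h3 : α • p + β • p = p := by rw [← add_smul, hαβ, one_smul]
  simpa [h2, h3] using h1

/-- The path runs through (x, s, p₀): the gradient is moved first and the value afterwards, along
the two segments that are assumed to stay in 𝒰. -/
theorem CoefBounds.abs_sub_le (ha : CoefBounds 𝒰 a K) {x : Eu n} {s s₀ : ℝ} {p p₀ : Eu n}
    (h1 : ∀ q ∈ segment ℝ p p₀, (x, s, q) ∈ 𝒰) (h2 : ∀ r ∈ segment ℝ s s₀, (x, r, p₀) ∈ 𝒰)
    {ξ η : Eu n} (hξ : ‖ξ‖ ≤ 1) (hη : ‖η‖ ≤ 1) :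
    |a ξ η (x, s, p) - a ξ η (x, s₀, p₀)| ≤ K * (|s - s₀| + ‖p - p₀‖) := by
  have e1 := ha.norm_sub_le (mem_segment_jet_grad h1) hξ hη
  have e2 := ha.norm_sub_le (mem_segment_jet_val h2) hξ hη
  have e3 : ‖((x, s, p) : Jet n) - (x, s, p₀)‖ = ‖p - p₀‖ := by simp [Prod.norm_def]
  have e4 : ‖((x, s, p₀) : Jet n) - (x, s₀, p₀)‖ = |s - s₀| := by simp [Prod.norm_def]
  rw [e3] at e1
  rw [e4] at e2
  have := abs_add_le (a ξ η (x, s, p) - a ξ η (x, s, p₀)) (a ξ η (x, s, p₀) - a ξ η (x, s₀, p₀))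
  rw [sub_add_sub_cancel] at this
  linarith

/-- Split q into its component along ξ and the rest. A3w makes the purely orthogonal term
nonnegative, and each of the other three terms carries a factor ⟨ξ, q⟩. -/
theorem CoefBounds.second_deriv_ge (ha : CoefBounds 𝒰 a K) {w : Jet n} (hw : w ∈ 𝒰) {ξ : Eu n}
    (hξ : ‖ξ‖ = 1) (q : Eu n) :
    -(3 * K * |inner ℝ ξ q| * ‖q‖) ≤
      fderiv ℝ (fderiv ℝ (a ξ ξ)) w (0, 0, q) (0, 0, q) := by
  set D := fderiv ℝ (fderiv ℝ (a ξ ξ)) w with hD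
  have hDK : ‖D‖ ≤ K := ha.bound₂ w hw ξ ξ hξ.le hξ.le
  set c := inner ℝ ξ q with hc
  set r := q - c • ξ with hr
  have hcq : |c| ≤ ‖q‖ := by simpa [hξ] using abs_real_inner_le_norm ξ q
  have horth : inner ℝ ξ r = 0 := by
    rw [hr, inner_sub_right, inner_smul_right, real_inner_self_eq_norm_sq, hξ, ← hc]; ring
  have hrq : ‖r‖ ≤ ‖q‖ := by
    have h1 : q = r + c • ξ := by rw [hr]; abel
    have h2 : ‖q‖ * ‖q‖ = ‖r‖ * ‖r‖ + ‖c • ξ‖ * ‖c • ξ‖ := by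
      conv_lhs => rw [h1]
      refine norm_add_sq_eq_norm_sq_add_norm_sq_real ?_
      rw [inner_smul_right, real_inner_comm, horth, mul_zero]
    nlinarith [norm_nonneg r, norm_nonneg q, mul_self_nonneg ‖c • ξ‖]
  have hsplit : ((0, 0, q) : Jet n) = (0, 0, r) + c • (0, 0, ξ) := by
    simp [hr]
  have hexp : D (0, 0, q) (0, 0, q) = D (0, 0, r) (0, 0, r) + c * D (0, 0, r) (0, 0, ξ)
      + c * (D (0, 0, ξ) (0, 0, r) + c * D (0, 0, ξ) (0, 0, ξ)) := by
    rw [hsplit]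
    simp only [map_add, map_smul, add_apply, smul_apply, smul_eq_mul]
    ring
  have nξ : ‖((0, 0, ξ) : Jet n)‖ ≤ 1 := by rw [norm_mk_zero_zero, hξ]
  have nr : ‖((0, 0, r) : Jet n)‖ ≤ ‖q‖ := by rwa [norm_mk_zero_zero]
  have b0 := ha.a3w w hw ξ r hξ horth
  have b1 := abs_clm₂_le hDK nr nξ
  have b2 := abs_clm₂_le hDK nξ nr
  have b3 := abs_clm₂_le hDK nξ nξ
  have hK : 0 ≤ K := (norm_nonneg D).trans hDK
  have c1 : |c * D (0, 0, r) (0, 0, ξ)| ≤ |c| * (K * ‖q‖) := by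
    rw [abs_mul]; exact mul_le_mul_of_nonneg_left (by simpa using b1) (abs_nonneg _)
  have c2 : |c * D (0, 0, ξ) (0, 0, r)| ≤ |c| * (K * ‖q‖) := by
    rw [abs_mul]; exact mul_le_mul_of_nonneg_left (by simpa using b2) (abs_nonneg _)
  have c3 : |c * (c * D (0, 0, ξ) (0, 0, ξ))| ≤ |c| * (‖q‖ * K) := by
    rw [abs_mul, abs_mul]
    exact mul_le_mul_of_nonneg_left (mul_le_mul hcq (by simpa using b3) (abs_nonneg _)
      (norm_nonneg _)) (abs_nonneg _)
  have c1' := (abs_le.1 c1).1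
  have c2' := (abs_le.1 c2).1
  have c3' := (abs_le.1 c3).1
  rw [hexp, mul_add]
  linarith

/-- The quadratic remainder of the expansion from p towards p₀ has a good sign up to a multiple of
|⟨ξ, p - p₀⟩|. The expansion is made at p, the gradient of u, so that its linear part is the drift
of the linearised operator. For ξ = b_i the error is proportional to |v_i|, which Young's inequality
can absorb. -/
theorem CoefBounds.sub_sub_le (ha : CoefBounds 𝒰 a K) {x : Eu n} {s s₀ : ℝ} {p p₀ : Eu n}
    (h1 : ∀ q ∈ segment ℝ p p₀, (x, s, q) ∈ 𝒰) (h2 : ∀ r ∈ segment ℝ s s₀, (x, r, p₀) ∈ 𝒰)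
    {ξ : Eu n} (hξ : ‖ξ‖ = 1) :
    a ξ ξ (x, s, p) - a ξ ξ (x, s₀, p₀) - fderiv ℝ (a ξ ξ) (x, s, p) (0, 0, p - p₀) ≤
      K * |s - s₀| + 3 * K * |inner ℝ ξ (p - p₀)| * ‖p - p₀‖ := by
  set q := p - p₀ with hq
  have e2 := ha.norm_sub_le (mem_segment_jet_val h2) hξ.le hξ.le
  have e4 : ‖((x, s, p₀) : Jet n) - (x, s₀, p₀)‖ = |s - s₀| := by simp [Prod.norm_def]
  rw [e4] at e2
  set v : Jet n := (0, 0, -q) with hv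
  set w : Jet n := (x, s, p) with hw
  have hseg : ∀ t ∈ Icc (0 : ℝ) 1, w + t • v ∈ 𝒰 := by
    intro t ht
    have : p + t • -q ∈ segment ℝ p p₀ := by
      refine ⟨1 - t, t, by linarith [ht.2], ht.1, by ring, ?_⟩
      rw [hq]; module
    have := h1 _ this
    simpa [hw, hv] using this
  have hT := taylor_lower_bound (f := fun t : ℝ => a ξ ξ (w + t • v))
    (f' := fun t : ℝ => dirD v (a ξ ξ) (w + t • v))
    (f'' := fun t : ℝ => dirD v (dirD v (a ξ ξ)) (w + t • v))
    (c := 3 * K * |inner ℝ ξ q| * ‖q‖) ?_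
    (fun t ht => hasDerivAt_line ((ha.contDiffAt (hseg t ht) ξ ξ).differentiableAt (by norm_num)))
    (fun t ht => hasDerivAt_line (differentiableAt_dirD (ha.contDiffAt (hseg t ht) ξ ξ) v))
    (fun t ht => by
      rw [dirD_dirD (ha.contDiffAt (hseg t ht) ξ ξ)]
      have := ha.second_deriv_ge (hseg t ht) hξ (-q)
      simpa using this)
  · have e5 : w + (1 : ℝ) • v = (x, s, p₀) := by simp [hw, hv, hq]
    have e6 : dirD v (a ξ ξ) w = -fderiv ℝ (a ξ ξ) w (0, 0, q) := by
      rw [← map_neg]; simp [dirD, hv]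
    simp only [e5, zero_smul, add_zero, e6] at hT
    have := (abs_le.1 e2).2
    linarith
  · have : 0 ≤ K := (norm_nonneg _).trans (ha.bound₁ w (by simpa using hseg 0 (by simp)) ξ ξ
      hξ.le hξ.le)
    positivity

end Taylor
end GJE

namespace GJE

/-! ### Derivatives of the test function and of the determinant -/

section MaxPoint

variable {n : ℕ} {𝒰 : Set (Jet n)} {a : Eu n → Eu n → Jet n → ℝ} {K : ℝ}

theorem dirD₂_norm_sq_gradient (b : OrthonormalBasis (Fin n) ℝ (Eu n)) {u : Eu n → ℝ} {x : Eu n}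
    (hu : ContDiffAt ℝ 3 u x) (v : Eu n) :
    ContDiffAt ℝ 2 (fun y => ‖∇ u y‖ ^ 2) x ∧
    dirD v (fun y => ‖∇ u y‖ ^ 2) x = 2 * ∑ l, dirD (b l) u x * dirD v (dirD (b l) u) x ∧
    dirD v (dirD v fun y => ‖∇ u y‖ ^ 2) x = 2 * ∑ l, (dirD v (dirD (b l) u) x ^ 2 +
      dirD (b l) u x * dirD v (dirD v (dirD (b l) u)) x) := by
  have hu' : ContDiffAt ℝ (3 : ℕ) u x := by exact_mod_cast hu
  have h1 : (fun y => ‖∇ u y‖ ^ 2) = fun y => ∑ l, dirD (b l) u y * dirD (b l) u y := by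
    ext y
    rw [← b.sum_sq_norm_inner_right (∇ u y)]
    refine Finset.sum_congr rfl fun l _ => ?_
    rw [inner_gradient, Real.norm_eq_abs, sq_abs, sq]
  have h2 : ∀ l, ContDiffAt ℝ 2 (dirD (b l) u) x := fun l => by
    exact_mod_cast contDiffAt_dirD (k := 2) hu' (by norm_num) (b l)
  have h3 : ∀ l ∈ Finset.univ, ContDiffAt ℝ 2 (fun y => dirD (b l) u y * dirD (b l) u y) x :=
    fun l _ => (h2 l).mul (h2 l)
  have h4 := dirD₂_sum Finset.univ h3 v
  rw [h1]
  refine ⟨ContDiffAt.sum h3, ?_, ?_⟩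
  · rw [h4.1, Finset.mul_sum]
    refine Finset.sum_congr rfl fun l _ => ?_
    have := (h2 l).differentiableAt (by norm_num)
    rw [dirD_mul this this]; ring
  · rw [h4.2, Finset.mul_sum]
    exact Finset.sum_congr rfl fun l _ => dirD₂_mul_self (h2 l) v

theorem dirD₂_norm_sq_sub (c x v : Eu n) :
    dirD v (fun y => ‖y - c‖ ^ 2) x = 2 * inner ℝ v (x - c) ∧
    dirD v (dirD v fun y => ‖y - c‖ ^ 2) x = 2 * ‖v‖ ^ 2 := by
  have h1 : ∀ y, HasFDerivAt (fun y : Eu n => ‖y - c‖ ^ 2) (2 • innerSL ℝ (y - c)) y := by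
    intro y
    have := ((hasFDerivAt_id (𝕜 := ℝ) y).sub_const c).norm_sq
    simpa using this
  have h2 : dirD v (fun y => ‖y - c‖ ^ 2) = fun y => 2 * inner ℝ v (y - c) := by
    ext y
    simp only [dirD, (h1 y).fderiv]
    simp [inner_sub_right, real_inner_comm]
  have h3 : HasFDerivAt (fun y : Eu n => 2 * inner ℝ v (y - c)) ((2 : ℝ) • innerSL ℝ v) x := by
    have := ((innerSL ℝ v).hasFDerivAt (x := x)).const_mul 2
    have h4 := this.sub_const (2 * inner ℝ v c)
    refine h4.congr_of_eventuallyEq (Eventually.of_forall fun y => ?_)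
    simp [inner_sub_right, mul_sub]
  refine ⟨by rw [h2], ?_⟩
  rw [h2]
  simp only [dirD, h3.fderiv]
  simp

/-- The first and second variations of `det (D²u - A) = const` at a point where the matrix is
diagonal. -/
theorem variations_of_det_eq_const (ha : CoefBounds 𝒰 a K) {u : Eu n → ℝ} {x₀ : Eu n} {f₀ : ℝ}
    (hf₀ : f₀ ≠ 0) (b : OrthonormalBasis (Fin n) ℝ (Eu n)) (hu : ContDiffAt ℝ 4 u x₀)
    (hj : jet u x₀ ∈ 𝒰)
    (hdet : ∀ᶠ x in 𝓝 x₀, (Matrix.of fun i j => augHess a u (b i) (b j) x).det = f₀)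
    (w : Fin n → ℝ) (hw : ∀ i, w i ≠ 0)
    (hdiag : ∀ i j, augHess a u (b i) (b j) x₀ = if i = j then w i else 0) (v : Eu n) :
    ∑ i, (w i)⁻¹ * dirD v (augHess a u (b i) (b i)) x₀ = 0 ∧
    ∑ i, (w i)⁻¹ * dirD v (dirD v (augHess a u (b i) (b i))) x₀ =
      ∑ i, ∑ j, (w i)⁻¹ * (w j)⁻¹ * (dirD v (augHess a u (b i) (b j)) x₀ *
        dirD v (augHess a u (b j) (b i)) x₀) := by
  set W : ℝ → Matrix (Fin n) (Fin n) ℝ :=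
    fun t => Matrix.of fun i j => augHess a u (b i) (b j) (x₀ + t • v) with hW
  set W' : ℝ → Matrix (Fin n) (Fin n) ℝ :=
    fun t => Matrix.of fun i j => dirD v (augHess a u (b i) (b j)) (x₀ + t • v) with hW'
  set W'' : ℝ → Matrix (Fin n) (Fin n) ℝ :=
    fun t => Matrix.of fun i j => dirD v (dirD v (augHess a u (b i) (b j))) (x₀ + t • v) with hW''
  have hc : Tendsto (fun t : ℝ => x₀ + t • v) (𝓝 0) (𝓝 x₀) := by
    have : Continuous fun t : ℝ => x₀ + t • v := by fun_prop
    simpa using this.tendsto 0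
  have hC := fun i j => contDiffAt_augHess ha hu hj (b i) (b j)
  have h1 : ∀ᶠ t in 𝓝 (0 : ℝ), ∀ i j, HasDerivAt (fun s => W s i j) (W' t i j) t := by
    have : ∀ᶠ y in 𝓝 x₀, ∀ i j, DifferentiableAt ℝ (augHess a u (b i) (b j)) y := by
      rw [eventually_all]; intro i; rw [eventually_all]; intro j
      exact ContDiffAt.eventually_differentiableAt (hC i j)
    filter_upwards [hc.eventually this] with t ht i j
    exact hasDerivAt_line (ht i j)
  have h2 : ∀ i j, HasDerivAt (fun s => W' s i j) (W'' 0 i j) 0 := fun i j =>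
    hasDerivAt_line (f := dirD v (augHess a u (b i) (b j))) (x := x₀) (t := 0)
      (by simpa using differentiableAt_dirD (hC i j) v)
  have h3 : ∀ᶠ t in 𝓝 (0 : ℝ), (W t).det = f₀ := hc.eventually hdet
  have hW0 : (W 0)⁻¹ = Matrix.diagonal fun i => (w i)⁻¹ := by
    have : W 0 = Matrix.diagonal w := by
      ext i j
      simp [hW, hdiag, Matrix.diagonal_apply]
    rw [this]
    refine Matrix.inv_eq_left_inv ?_
    rw [Matrix.diagonal_mul_diagonal]
    simp [hw]
  constructor
  · have := trace_inv_mul_deriv_eq_zero h1.self_of_nhds h3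
    rw [hW0] at this
    simpa [Matrix.trace, Matrix.diagonal_mul, hW'] using this
  · have := trace_inv_mul_second_deriv hf₀ h1 h2 h3
    rw [hW0] at this
    simp only [Matrix.trace, Matrix.diag_apply, Matrix.mul_apply, Matrix.diagonal_apply, ite_mul,
      zero_mul, Finset.sum_ite_eq, Finset.mem_univ, if_true, hW', hW'', Matrix.of_apply,
      zero_smul, add_zero] at this
    rw [this]
    exact Finset.sum_congr rfl fun i _ => Finset.sum_congr rfl fun j _ => by ring

/-- Only the row and the column of `o` are kept from a sum of nonnegative terms. Each off-diagonal
pair occurs twice, and this factor 2 is what beats the -d_i² coming from the logarithm. -/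
theorem two_mul_sum_erase_le {F : Fin n → ℝ} (hF : ∀ i, 0 ≤ F i) {e : Fin n → Fin n → ℝ}
    (he : ∀ i j, e i j = e j i) (o : Fin n) :
    F o * F o * e o o ^ 2 + ∑ i ∈ Finset.univ.erase o, 2 * (F i * F o * e i o ^ 2) ≤
      ∑ i, ∑ j, F i * F j * (e i j * e j i) := by
  have h0 : ∀ i j, 0 ≤ F i * F j * (e i j * e j i) := fun i j => by
    rw [he j i]; exact mul_nonneg (mul_nonneg (hF i) (hF j)) (mul_self_nonneg _)
  rw [← Finset.add_sum_erase _ _ (Finset.mem_univ o)]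
  rw [← Finset.add_sum_erase _ (fun j => F o * F j * (e o j * e j o)) (Finset.mem_univ o)]
  have h1 : ∑ i ∈ Finset.univ.erase o, F i * F o * (e i o * e o i) ≤
      ∑ i ∈ Finset.univ.erase o, ∑ j, F i * F j * (e i j * e j i) :=
    Finset.sum_le_sum fun i _ => Finset.single_le_sum (fun j _ => h0 i j) (Finset.mem_univ o)
  have h2 : ∑ i ∈ Finset.univ.erase o, 2 * (F i * F o * e i o ^ 2) =
      ∑ i ∈ Finset.univ.erase o, F o * F i * (e o i * e i o) +
        ∑ i ∈ Finset.univ.erase o, F i * F o * (e i o * e o i) := by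
    rw [← Finset.sum_add_distrib]
    refine Finset.sum_congr rfl fun i _ => ?_
    rw [he o i]; ring
  rw [h2, sq]
  linarith

end MaxPoint
end GJE

namespace GJE

/-! ### The estimate at a maximum of the test function -/

section MaxPoint

variable {n : ℕ} {𝒰 : Set (Jet n)} {a : Eu n → Eu n → Jet n → ℝ} {K : ℝ}

-- This translates the calculus at the maximum point into the arrays of `eigenvalue_mul_neg_le`. N
-- bounds the part of the derivative of the one-jet that carries no eigenvalue, and P dominates
-- every structural constant that occurs.
set_option maxHeartbeats 2000000 in
theorem eigenvalue_bound_at_max (ha : CoefBounds 𝒰 a K) {M N P : ℝ} (hK : 1 ≤ K) (hM : 1 ≤ M)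
    (hN : N = 1 + M + n * K) (hP : P = 20 * n * K ^ 2 * N ^ 2) {u u₀ : Eu n → ℝ}
    {x₀ xbar : Eu n} {f₀ : ℝ} (hf₀ : f₀ ≠ 0) (b : OrthonormalBasis (Fin n) ℝ (Eu n))
    (hu : ContDiffAt ℝ 4 u x₀) (hu₀ : ContDiffAt ℝ 2 u₀ x₀) (hj : jet u x₀ ∈ 𝒰)
    (hdet : ∀ᶠ x in 𝓝 x₀, (Matrix.of fun i j => augHess a u (b i) (b j) x).det = f₀)
    (w : Fin n → ℝ) (hw : ∀ i, 0 < w i)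
    (hdiag : ∀ i j, augHess a u (b i) (b j) x₀ = if i = j then w i else 0)
    (o : Fin n) (ho : ∀ i, w i ≤ w o) (hwo : 1 ≤ w o)
    (hu₀eq : ∀ ξ, dirD ξ (dirD ξ u₀) x₀ = a ξ ξ (jet u₀ x₀))
    (hj1 : ∀ q ∈ segment ℝ (∇ u x₀) (∇ u₀ x₀), (x₀, u x₀, q) ∈ 𝒰)
    (hj2 : ∀ r ∈ segment ℝ (u x₀) (u₀ x₀), (x₀, r, ∇ u₀ x₀) ∈ 𝒰)
    (hM1 : ‖∇ u x₀‖ ≤ M) (hM2 : ‖∇ u x₀ - ∇ u₀ x₀‖ ≤ M) (hv : u x₀ < u₀ x₀)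
    (hv1 : u₀ x₀ - u x₀ ≤ 1) (hx : 100 * P ^ 2 * ‖x₀ - xbar‖ ≤ 1)
    (hmax : IsLocalMax (fun x => Real.log (augHess a u (b o) (b o) x) +
      (12 * Real.log (u₀ x - u x) + (1 / (4 * P ^ 3) * ‖∇ u x‖ ^ 2 +
        50 * P ^ 2 * ‖x - xbar‖ ^ 2))) x₀) :
    w o * (u₀ x₀ - u x₀) ≤ 1 + 4 * P ^ 3 * (40 * P ^ 2) := by
  have hn : (1 : ℝ) ≤ n := by
    have : 0 < n := o.pos
    exact_mod_cast this
  have hnK : 1 ≤ n * K := by nlinarith only [hn, hK]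
  have hN1 : 1 ≤ N := by linarith only [hN, hM, hnK]
  have hMN : M ≤ N := by linarith only [hN, hM, hnK]
  have hKN : 1 ≤ K * N := by nlinarith only [hN1, hK]
  have hnKN : n * K * N ≤ n * K ^ 2 * N ^ 2 := by
    have : n * K ^ 2 * N ^ 2 = n * K * N * (K * N) := by ring
    rw [this]; exact le_mul_of_one_le_right (by positivity) hKN
  have hnKN0 : 0 ≤ n * K * N := by positivity
  have P1 : 20 * (n * K * N) ≤ P := by rw [hP]; linarith only [hnKN]
  have hNle : N ≤ n * K * N := le_mul_of_one_le_left (by linarith only [hN1]) hnK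
  have hKle : K ≤ n * K * N := by nlinarith only [hn, hK, hN1, hnK, hNle]
  have hnKle : n * K ≤ n * K * N := le_mul_of_one_le_right (by positivity) hN1
  have hnle : (n : ℝ) ≤ n * K * N := by
    have : (n : ℝ) ≤ n * K := le_mul_of_one_le_right (by positivity) hK
    linarith only [this, hnKle]
  have hKNle : K * N ≤ n * K * N := by
    rw [mul_assoc]; exact le_mul_of_one_le_left (by positivity) hn
  have hPpos : 1 ≤ P := by linarith only [P1, hNle, hN1]
  set F : Fin n → ℝ := fun i => (w i)⁻¹ with hF
  have hF0 : ∀ i, 0 < F i := fun i => inv_pos.2 (hw i)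
  have hwo0 : 0 < w o := hw o
  have hbn : ∀ i, ‖b i‖ = 1 := fun i => b.norm_eq_one i
  have hu' : ContDiffAt ℝ (4 : ℕ) u x₀ := by exact_mod_cast hu
  have hu3 : ContDiffAt ℝ 3 u x₀ := hu.of_le (by norm_num)
  have hu2 : ContDiffAt ℝ 2 u x₀ := hu.of_le (by norm_num)
  -- the arrays
  set pb : Fin n → Jet n := fun i => (0, 0, b i) with hpb
  set ez : Jet n := (0, 1, 0) with hez
  set J : Fin n → Jet n := fun k => dirD (b k) (jet u) x₀ with hJ
  set u1 : Fin n → ℝ := fun k => dirD (b k) u x₀ with hu1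
  set U2 : Fin n → Fin n → ℝ := fun i l => dirD (b i) (dirD (b l) u) x₀ with hU2
  set U3 : Fin n → Fin n → Fin n → ℝ := fun i j k => dirD (b k) (dirD (b i) (dirD (b j) u)) x₀
    with hU3
  set Da : Fin n → Fin n → Jet n →L[ℝ] ℝ := fun i j => fderiv ℝ (a (b i) (b j)) (jet u x₀) with hDa
  set D2 : Fin n → Fin n → Jet n →L[ℝ] Jet n →L[ℝ] ℝ :=
    fun i j => fderiv ℝ (fderiv ℝ (a (b i) (b j))) (jet u x₀) with hD2
  have hs1 : ∀ i j k, U3 i j k = U3 j i k := fun i j k => (dirD₃_comm hu3 (b k) (b i) (b j)).2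
  have hs2 : ∀ i j k, U3 i j k = U3 i k j := fun i j k =>
    ((dirD₃_comm hu3 (b k) (b i) (b j)).1.trans (dirD₃_comm hu3 (b i) (b k) (b j)).2).trans
      (dirD₃_comm hu3 (b i) (b j) (b k)).1
  have hU2s : ∀ i j, U2 i j = U2 j i := fun i j => dirD_comm hu2 (b i) (b j)
  have hU2a : ∀ i j, U2 i j = (if i = j then w i else 0) + a (b i) (b j) (jet u x₀) := by
    intro i j
    have := hdiag i j
    rw [augHess] at this
    simp only [hU2]; linarith only [this]
  have hU2d : ∀ i, |U2 i i - w i| ≤ K := fun i => by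
    rw [hU2a, if_pos rfl, add_sub_cancel_left]
    exact ha.bound _ hj _ _ (hbn i).le (hbn i).le
  have hDaK : ∀ i j, ‖Da i j‖ ≤ K := fun i j => ha.bound₁ _ hj _ _ (hbn i).le (hbn j).le
  have hD2K : ∀ i j, ‖D2 i j‖ ≤ K := fun i j => ha.bound₂ _ hj _ _ (hbn i).le (hbn j).le
  have hpb1 : ∀ i, ‖pb i‖ ≤ 1 := fun i => by simp only [hpb]; rw [norm_mk_zero_zero, hbn]
  have hez1 : ‖ez‖ ≤ 1 := by simp [hez, Prod.norm_def]
  have hu1M : ∀ k, |u1 k| ≤ M := fun k => by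
    simp only [hu1, ← inner_gradient]
    exact (abs_real_inner_le_norm _ _).trans (by rw [hbn, one_mul]; exact hM1)
  set R0 : Fin n → Jet n := fun k => (b k, u1 k, 0) with hR0
  have hR0n : ∀ k, ‖R0 k‖ ≤ M := fun k => by
    simp only [hR0, Prod.norm_def, hbn, norm_zero]
    exact max_le hM (max_le (hu1M k) (by linarith only [hM]))
  have hJR : ∀ k, J k = R0 k + ∑ l, U2 k l • pb l := by
    intro k
    simp only [hJ, dirD_jet b hu2, hR0, hpb, hU2, hu1]
    refine Prod.ext ?_ (Prod.ext ?_ ?_)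
    · simp [Prod.fst_sum]
    · simp [Prod.fst_sum, Prod.snd_sum]
    · simp [Prod.snd_sum]
  -- In this basis D²u is the diagonal matrix of the w_i plus A, so everything in the derivative of
  -- the one-jet except w_k times a unit vector is bounded.
  set S : Fin n → Jet n := fun k => R0 k + ∑ l, a (b k) (b l) (jet u x₀) • pb l with hS
  have hSn : ∀ k, ‖S k‖ ≤ N := fun k => by
    have : ‖∑ l, a (b k) (b l) (jet u x₀) • pb l‖ ≤ n * K := by
      refine (norm_sum_le _ _).trans ?_
      have h1 : ∀ l ∈ Finset.univ, ‖a (b k) (b l) (jet u x₀) • pb l‖ ≤ K := fun l _ => by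
        rw [norm_smul]
        exact (mul_le_of_le_one_right (norm_nonneg _) (hpb1 l)).trans
          (ha.bound _ hj _ _ (hbn k).le (hbn l).le)
      simpa using Finset.sum_le_card_nsmul _ _ _ h1
    refine (norm_add_le _ _).trans ?_
    have := hR0n k
    linarith
  have hJS : ∀ k, J k = S k + w k • pb k := by
    intro k
    rw [hJR]
    simp only [hS, hU2a, add_smul, Finset.sum_add_distrib, ite_smul, zero_smul, Finset.sum_ite_eq,
      Finset.mem_univ, if_true]
    abel
  have hJn : ∀ k, ‖J k‖ ≤ 2 * N * w o := fun k => by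
    rw [hJS]
    refine (norm_add_le _ _).trans ?_
    rw [norm_smul, Real.norm_of_nonneg (hw k).le]
    have h1 : w k * ‖pb k‖ ≤ w o :=
      (mul_le_of_le_one_right (hw k).le (hpb1 k)).trans (ho k)
    have h2 : N ≤ N * w o := le_mul_of_one_le_right (by linarith only [hN1]) hwo
    have h3 : w o ≤ N * w o := le_mul_of_one_le_left hwo0.le hN1
    linarith only [hSn k, h1, h2, h3]
  have hJJ : ∀ k, dirD (b k) (dirD (b k) (jet u)) x₀ = U2 k k • ez + ∑ l, U3 l k k • pb l := by
    intro k
    rw [dirD_dirD_jet b hu3]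
    have : ∀ l, dirD (b k) (dirD (b k) (dirD (b l) u)) x₀ = U3 l k k :=
      fun l => (dirD₃_comm hu3 (b k) (b k) (b l)).2
    simp only [this, hpb, hez, hU2]
    refine Prod.ext ?_ (Prod.ext ?_ ?_)
    · simp [Prod.fst_sum]
    · simp [Prod.fst_sum, Prod.snd_sum]
    · simp [Prod.snd_sum]
  have hW1 : ∀ i j k, dirD (b k) (augHess a u (b i) (b j)) x₀ = U3 i j k - Da i j (J k) :=
    fun i j k => dirD_augHess ha hu3 hj _ _ _
  set D : Fin n → ℝ := fun k => dirD (b k) (augHess a u (b o) (b o)) x₀ with hD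
  set p : Fin n → ℝ := fun i => dirD (b i) (dirD (b i) (augHess a u (b o) (b o))) x₀ with hp
  set q : Fin n → ℝ := fun i => dirD (b o) (dirD (b o) (augHess a u (b i) (b i))) x₀ with hq
  set u4 : Fin n → ℝ := fun i => dirD (b i) (dirD (b i) (dirD (b o) (dirD (b o) u))) x₀ with hu4
  set e : Fin n → Fin n → ℝ := fun i j => dirD (b o) (augHess a u (b i) (b j)) x₀ with he
  have hvar := variations_of_det_eq_const ha hf₀ b hu hj hdet w (fun i => (hw i).ne') hdiag
  have heq1 : ∀ k, ∑ i, F i * (U3 i i k - Da i i (J k)) = 0 := fun k => by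
    simpa only [hW1] using (hvar (b k)).1
  set R := ∑ i, ∑ j, F i * F j * (e i j * e j i) with hR
  have heq2 : ∑ i, F i * q i = R := (hvar (b o)).2
  have hLX := sum_second_deriv_eigenvalue_ge hK hN1 w F hw o ho hwo (fun _ => rfl) pb ez hpb1 hez1
    S J hSn hJS Da D2 hDaK hD2K
    (fun i hi => ha.a3w _ hj _ _ (hbn i) (b.orthonormal.2 hi))
    (fun i => U2 i i) hU2d U3 hs1 hs2 u4 D p q R (fun i => hW1 o o i)
    (fun i => by
      simp only [hq, hu4]
      rw [dirD_dirD_augHess ha hu hj, hJJ, dirD₄_comm hu])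
    (fun i => by
      simp only [hp, hu4]
      rw [dirD_dirD_augHess ha hu hj, hJJ])
    heq1 heq2
  have hLY := sum_second_deriv_gradient_ge hM w F hw o (fun _ => rfl) pb R0 J hR0n
    (fun i => Da i i) (fun i => hDaK i i) u1 hu1M U2 hU2d hJR (fun i k => U3 i i k) heq1
  -- the function `u - u₀`
  set v := u x₀ - u₀ x₀ with hvdef
  set v1 : Fin n → ℝ := fun i => dirD (b i) u x₀ - dirD (b i) u₀ x₀ with hv1def
  set v2 : Fin n → ℝ := fun i => dirD (b i) (dirD (b i) u) x₀ - dirD (b i) (dirD (b i) u₀) x₀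
    with hv2def
  have hv1i : ∀ i, v1 i = inner ℝ (b i) (∇ u x₀ - ∇ u₀ x₀) := fun i => by
    rw [inner_sub_right, inner_gradient, inner_gradient]
  have hv1M : ∀ i, |v1 i| ≤ M := fun i => by
    rw [hv1i]
    exact (abs_real_inner_le_norm _ _).trans (by rw [hbn, one_mul]; exact hM2)
  have hπ : ((0, 0, ∇ u x₀ - ∇ u₀ x₀) : Jet n) = ∑ k, v1 k • pb k := by
    refine Prod.ext ?_ (Prod.ext ?_ ?_)
    · simp [Prod.fst_sum, hpb]
    · simp [Prod.fst_sum, Prod.snd_sum, hpb]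
    · simp only [Prod.snd_sum, hpb, Prod.smul_snd, hv1i]
      exact (b.sum_repr' _).symm
  set Z : Fin n → ℝ := fun i => v2 i - ∑ k, Da i i (pb k) * v1 k with hZdef
  -- Here v_ii is w_i plus the difference of A at the jets of u and u₀; the drift subtracts the
  -- linear part of that difference, and the one-sided Taylor estimate bounds the rest.
  have hZi : ∀ i, F i * Z i ≤ 1 + F i * (K * (-v)) + 3 * K * M * (F i * |v1 i|) := by
    intro i
    have h1 := ha.sub_sub_le hj1 hj2 (hbn i)
    have h2 : fderiv ℝ (a (b i) (b i)) (x₀, u x₀, ∇ u x₀) (0, 0, ∇ u x₀ - ∇ u₀ x₀) =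
        ∑ k, Da i i (pb k) * v1 k := by
      rw [hπ, map_sum]
      refine Finset.sum_congr rfl fun k _ => ?_
      rw [map_smul, smul_eq_mul, mul_comm]; rfl
    have h3 : |u x₀ - u₀ x₀| = -v := abs_of_neg (by linarith only [hv])
    rw [h2, ← hv1i, h3] at h1
    have h4 : v2 i = w i + (a (b i) (b i) (x₀, u x₀, ∇ u x₀)
        - a (b i) (b i) (x₀, u₀ x₀, ∇ u₀ x₀)) := by
      have := hU2a i i
      rw [if_pos rfl] at this
      simp only [hv2def, hu₀eq]
      simp only [hU2, jet] at this ⊢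
      rw [this]; ring
    have h5 : Z i ≤ w i + (K * (-v) + 3 * K * |v1 i| * M) := by
      have : 3 * K * |v1 i| * ‖∇ u x₀ - ∇ u₀ x₀‖ ≤ 3 * K * |v1 i| * M := by gcongr
      simp only [hZdef]; linarith only [h1, h4, this]
    have h6 := mul_le_mul_of_nonneg_left h5 (hF0 i).le
    have h7 : F i * w i = 1 := inv_mul_cancel₀ (hw i).ne'
    have h8 : F i * (w i + (K * (-v) + 3 * K * |v1 i| * M)) =
      F i * w i + F i * (K * (-v)) + 3 * K * M * (F i * |v1 i|) := by ring
    rw [h8, h7] at h6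
    exact h6
  have hT0 : 0 ≤ ∑ i, F i := Finset.sum_nonneg fun i _ => (hF0 i).le
  have hLZ : ∑ i, F i * Z i ≤ n + P * (-v) * ∑ i, F i + P * ∑ i, F i * |v1 i| := by
    have h1 := Finset.sum_le_sum fun i (_ : i ∈ Finset.univ) => hZi i
    rw [Finset.sum_add_distrib, Finset.sum_add_distrib, ← Finset.sum_mul, ← Finset.mul_sum] at h1
    simp only [Finset.sum_const, Finset.card_univ, Fintype.card_fin, nsmul_eq_mul, mul_one] at h1
    have h2 : (∑ i, F i) * (K * (-v)) ≤ P * (-v) * ∑ i, F i := by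
      have : K * (-v) * ∑ i, F i ≤ P * (-v) * ∑ i, F i := by
        refine mul_le_mul_of_nonneg_right ?_ hT0
        refine mul_le_mul_of_nonneg_right ?_ (by linarith only [hv])
        linarith only [P1, hKle, hnKN0]
      linarith only [this]
    have h3 : 3 * K * M * ∑ i, F i * |v1 i| ≤ P * ∑ i, F i * |v1 i| := by
      refine mul_le_mul_of_nonneg_right ?_
        (Finset.sum_nonneg fun i _ => mul_nonneg (hF0 i).le (abs_nonneg _))
      have : K * M ≤ K * N := mul_le_mul_of_nonneg_left hMN (by linarith only [hK])
      linarith only [this, hKNle, P1, hnKN0]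
    linarith only [h1, h2, h3]
  -- derivatives of the test function
  set fW : Eu n → ℝ := augHess a u (b o) (b o) with hfW
  have hfWo : fW x₀ = w o := by rw [hfW, hdiag, if_pos rfl]
  have hfWC : ContDiffAt ℝ 2 fW x₀ := contDiffAt_augHess ha hu hj _ _
  set fm : Eu n → ℝ := fun x => u₀ x - u x with hfm
  have hfmv : fm x₀ = -v := by simp only [hfm, hvdef]; ring
  have hfm0 : fm x₀ ≠ 0 := by rw [hfmv]; exact (by linarith only [hv] : 0 < -v).ne'
  have hfmC : ContDiffAt ℝ 2 fm x₀ := hu₀.sub hu2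
  have hfm' : fm = fun x => u₀ x + (-1) * u x := by ext x; simp only [hfm]; ring
  have hfm1 : ∀ i, dirD (b i) fm x₀ = -v1 i := by
    intro i
    have d1 := hu2.differentiableAt (n := 2) (by norm_num)
    rw [hfm', dirD_add (hu₀.differentiableAt (by norm_num)) (d1.const_mul _), dirD_const_mul d1]
    simp only [hv1def]; ring
  have hfm2 : ∀ i, dirD (b i) (dirD (b i) fm) x₀ = -v2 i := by
    intro i
    rw [hfm', dirD₂_add hu₀ (contDiffAt_const.mul hu2), dirD₂_const_mul hu2]
    simp only [hv2def]; ring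
  have c1 : ContDiffAt ℝ 2 (fun x => Real.log (fW x)) x₀ :=
    hfWC.log (by rw [hfWo]; exact hwo0.ne')
  have c2 : ContDiffAt ℝ 2 (fun x => Real.log (fm x)) x₀ := hfmC.log hfm0
  -- Only the regularity statement is used, so the direction 0 is a dummy.
  have c3 := (dirD₂_norm_sq_gradient b hu3 0).1
  have c4 : ContDiffAt ℝ 2 (fun x : Eu n => ‖x - xbar‖ ^ 2) x₀ :=
    (contDiffAt_id.sub contDiffAt_const).norm_sq ℝ
  have c2' : ContDiffAt ℝ 2 (fun x => 12 * Real.log (fm x)) x₀ := contDiffAt_const.mul c2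
  have c3' : ContDiffAt ℝ 2 (fun x => 1 / (4 * P ^ 3) * ‖∇ u x‖ ^ 2) x₀ := contDiffAt_const.mul c3
  have c4' : ContDiffAt ℝ 2 (fun x : Eu n => 50 * P ^ 2 * ‖x - xbar‖ ^ 2) x₀ :=
    contDiffAt_const.mul c4
  have c34 := c3'.add c4'
  have c234 := c2'.add c34
  have call := c1.add c234
  have da : ∀ {f : Eu n → ℝ}, ContDiffAt ℝ 2 f x₀ → DifferentiableAt ℝ f x₀ :=
    fun h => h.differentiableAt (by norm_num)
  have hH := fun i => dirD_dirD_nonpos_of_isLocalMax hmax call (b i)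
  set s : Fin n → ℝ := fun i => ∑ k, u1 k * U2 k i with hs
  set y : Fin n → ℝ := fun i => inner ℝ (b i) (x₀ - xbar) with hy
  set d : Fin n → ℝ := fun i => D i / w o with hd
  have hP0 : P ≠ 0 := (by linarith only [hPpos] : 0 < P).ne'
  have hcrit : ∀ i, d i + 12 * (v1 i / v) + 1 / (2 * P ^ 3) * s i + 100 * P ^ 2 * y i = 0 := by
    intro i
    have h1 := (hH i).1
    rw [dirD_add (da c1) (da c234), dirD_add (da c2') (da c34), dirD_add (da c3') (da c4'),
      dirD_const_mul (da c2), dirD_const_mul (da c3), dirD_const_mul (da c4),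
      dirD_log (da hfWC) (by rw [hfWo]; exact hwo0.ne'), dirD_log (da hfmC) hfm0,
      (dirD₂_norm_sq_gradient b hu3 (b i)).2.1, (dirD₂_norm_sq_sub xbar x₀ (b i)).1, hfm1, hfmv,
      hfWo, neg_div_neg_eq] at h1
    have h2 : ∑ l, dirD (b l) u x₀ * dirD (b i) (dirD (b l) u) x₀ = s i := by
      simp only [hs]
      exact Finset.sum_congr rfl fun l _ => by rw [hU2s]
    rw [h2] at h1
    rw [← h1]
    simp only [hd, hD, hy]
    field_simp
    ring
  set Y : Fin n → ℝ := fun i => ∑ k, (U2 k i ^ 2 + u1 k * U3 i i k) - ∑ l, Da i i (pb l) * s l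
    with hY
  set Q : Fin n → ℝ := fun i => ∑ k, Da i i (pb k) * y k with hQ
  set X : Fin n → ℝ := fun i => (p i - ∑ k, Da i i (pb k) * D k) / w o with hX
  -- The first order conditions, weighted by the drift coefficients, add up to zero. Subtracting
  -- this combination from the second order condition turns each second derivative into a summand of
  -- the linearised operator.
  have hmax2 : ∀ i, X i - d i ^ 2 + 12 * (Z i / v - v1 i ^ 2 / v ^ 2) + 1 / (2 * P ^ 3) * Y i +
      100 * P ^ 2 * (1 - Q i) ≤ 0 := by
    intro i
    have h1 := (hH i).2
    rw [dirD₂_add c1 c234, dirD₂_add c2' c34, dirD₂_add c3' c4',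
      dirD₂_const_mul c2, dirD₂_const_mul c3, dirD₂_const_mul c4,
      dirD₂_log hfWC (by rw [hfWo]; exact hwo0.ne'), dirD₂_log hfmC hfm0,
      (dirD₂_norm_sq_gradient b hu3 (b i)).2.2, (dirD₂_norm_sq_sub xbar x₀ (b i)).2, hfm1, hfm2,
      hfmv, hfWo, neg_div_neg_eq, neg_sq, neg_sq, hbn] at h1
    have h2 : ∑ l, (dirD (b i) (dirD (b l) u) x₀ ^ 2 +
        dirD (b l) u x₀ * dirD (b i) (dirD (b i) (dirD (b l) u)) x₀) =
        Y i + ∑ l, Da i i (pb l) * s l := by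
      simp only [hY, sub_add_cancel]
      refine Finset.sum_congr rfl fun l _ => ?_
      have e1 : dirD (b i) (dirD (b l) u) x₀ = U2 l i := hU2s i l
      have e2 : dirD (b i) (dirD (b i) (dirD (b l) u)) x₀ = U3 i i l := by
        rw [hs2 i i l]
      rw [e1, e2]
    rw [h2] at h1
    have h3 : ∑ k, Da i i (pb k) * (d k + 12 * (v1 k / v) + 1 / (2 * P ^ 3) * s k
        + 100 * P ^ 2 * y k) = 0 := Finset.sum_eq_zero fun k _ => by rw [hcrit, mul_zero]
    have h4 : ∑ k, Da i i (pb k) * (d k + 12 * (v1 k / v) + 1 / (2 * P ^ 3) * s k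
        + 100 * P ^ 2 * y k) = (∑ k, Da i i (pb k) * D k) / w o
        + 12 * ((∑ k, Da i i (pb k) * v1 k) / v) + 1 / (2 * P ^ 3) * ∑ k, Da i i (pb k) * s k
        + 100 * P ^ 2 * Q i := by
      simp only [hQ, Finset.sum_div, Finset.mul_sum, ← Finset.sum_add_distrib]
      refine Finset.sum_congr rfl fun k _ => ?_
      simp only [hd]; ring
    rw [h3] at h4
    have h5 : X i = p i / w o - (∑ k, Da i i (pb k) * D k) / w o := by
      simp only [hX]; rw [sub_div]
    have h6 : Z i / v = v2 i / v - (∑ k, Da i i (pb k) * v1 k) / v := by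
      simp only [hZdef]; rw [sub_div]
    have h7 : d i ^ 2 = D i ^ 2 / w o ^ 2 := by simp only [hd]; rw [div_pow]
    have h8 : 1 / (4 * P ^ 3) * (2 * (Y i + ∑ l, Da i i (pb l) * s l)) =
        1 / (2 * P ^ 3) * Y i + 1 / (2 * P ^ 3) * ∑ l, Da i i (pb l) * s l := by
      field_simp; ring
    rw [h8] at h1
    rw [h5, h6, h7]
    simp only [hp, hD] at *
    linarith only [h1, h4]
  -- The derivative of W_io along b_o and that of W_oo along b_i contain the same third derivative
  -- of u, so their difference only involves first derivatives of A.
  set c : Fin n → ℝ := fun i => e i o / w o - d i with hc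
  have hRw : F o * d o ^ 2 + ∑ i ∈ Finset.univ.erase o, 2 * F i * (d i + c i) ^ 2 ≤ R / w o := by
    have hes : ∀ i j, e i j = e j i := by
      intro i j
      refine (dirD_congr ?_ (b o)).eq_of_nhds
      filter_upwards [hu2.eventually (by simp),
        (contDiffAt_jet (k := 3) hu' (by norm_num)).continuousAt.eventually
          (ha.isOpen.mem_nhds hj)] with z hz1 hz2
      rw [augHess, augHess, dirD_comm hz1, ha.symm _ hz2]
    have h1 := two_mul_sum_erase_le (fun i => (hF0 i).le) hes o
    rw [le_div_iff₀ hwo0]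
    refine le_trans (le_of_eq ?_) h1
    have hFo : F o = (w o)⁻¹ := rfl
    rw [add_mul, Finset.sum_mul]
    congr 1
    · have : e o o = D o := rfl
      rw [this, hFo]; simp only [hd]; field_simp
    · refine Finset.sum_congr rfl fun i _ => ?_
      simp only [hc, add_sub_cancel]
      rw [hFo]; field_simp
  have hcP : ∀ i, |c i| ≤ P := by
    intro i
    have h1 : c i = (Da o o (J i) - Da i o (J o)) / w o := by
      have e1 : e i o = U3 i o o - Da i o (J o) := hW1 i o o
      have e2 : D i = U3 o o i - Da o o (J i) := hW1 o o i
      have e3 : U3 i o o = U3 o o i := by rw [hs1, hs2]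
      simp only [hc, hd]; rw [e1, e2, e3]; ring
    rw [h1, abs_div, abs_of_pos hwo0, div_le_iff₀ hwo0]
    have h2 := abs_sub (Da o o (J i)) (Da i o (J o))
    have h3 := abs_clm_le (hDaK o o) (hJn i)
    have h4 := abs_clm_le (hDaK i o) (hJn o)
    have h5 : K * (2 * N * w o) + K * (2 * N * w o) ≤ P * w o := by
      have : 4 * (K * N) ≤ P := by linarith only [P1, hKNle, hnKN0]
      have := mul_le_mul_of_nonneg_right this hwo0.le
      linarith only [this]
    linarith only [h2, h3, h4, h5]
  have hyx : ∀ i, |y i| ≤ ‖x₀ - xbar‖ := fun i => by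
    simp only [hy]
    exact (abs_real_inner_le_norm _ _).trans (by rw [hbn, one_mul])
  have hby : ∀ i, |100 * P ^ 2 * y i| ≤ 1 := fun i => by
    rw [abs_mul, abs_of_nonneg (by positivity)]
    exact (mul_le_mul_of_nonneg_left (hyx i) (by positivity)).trans hx
  have hQ2 : ∀ i, Q i ≤ 1 / 2 := by
    intro i
    have h1 : ∀ k ∈ Finset.univ, Da i i (pb k) * y k ≤ K * ‖x₀ - xbar‖ := fun k _ => by
      refine (le_abs_self _).trans ?_
      rw [abs_mul]
      exact mul_le_mul (by simpa using abs_clm_le (hDaK i i) (hpb1 k)) (hyx k) (abs_nonneg _)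
        (by linarith only [hK])
    have h2 : Q i ≤ n * (K * ‖x₀ - xbar‖) := by
      simpa [hQ] using Finset.sum_le_card_nsmul _ _ _ h1
    have h3 : 2 * (n * K) ≤ 100 * P ^ 2 := by
      have : P ≤ P ^ 2 := by nlinarith only [hPpos]
      linarith only [this, P1, hnKle, hPpos, hnKN0]
    have h4 := mul_le_mul_of_nonneg_right h3 (norm_nonneg (x₀ - xbar))
    linarith only [h2, h4, hx]
  have hsP : ∀ i, |s i| ≤ P * (1 + w i) := by
    intro i
    have h1 : s i = u1 i * w i + ∑ k, u1 k * a (b k) (b i) (jet u x₀) := by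
      simp only [hs, hU2a, mul_add, Finset.sum_add_distrib, mul_ite, mul_zero, Finset.sum_ite_eq',
        Finset.mem_univ, if_true]
    have h2 : |∑ k, u1 k * a (b k) (b i) (jet u x₀)| ≤ n * (M * K) := by
      refine (Finset.abs_sum_le_sum_abs _ _).trans ?_
      have : ∀ k ∈ Finset.univ, |u1 k * a (b k) (b i) (jet u x₀)| ≤ M * K := fun k _ => by
        rw [abs_mul]
        exact mul_le_mul (hu1M k) (ha.bound _ hj _ _ (hbn k).le (hbn i).le) (abs_nonneg _)
          (by linarith only [hM])
      simpa using Finset.sum_le_card_nsmul _ _ _ this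
    have h3 : |u1 i * w i| ≤ M * w i := by
      rw [abs_mul, abs_of_pos (hw i)]
      exact mul_le_mul_of_nonneg_right (hu1M i) (hw i).le
    have h4 := abs_add_le (u1 i * w i) (∑ k, u1 k * a (b k) (b i) (jet u x₀))
    rw [h1]
    have h5 : M * w i ≤ P * w i :=
      mul_le_mul_of_nonneg_right (by linarith only [hMN, hNle, P1, hnKN0]) (hw i).le
    have h6 : n * (M * K) ≤ P := by
      have : n * K * M ≤ n * K * N := mul_le_mul_of_nonneg_left hMN (by positivity)
      linarith only [this, P1, hnKN0]
    linarith only [h2, h3, h4, h5, h6]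
  have hres := eigenvalue_mul_neg_le hPpos (by linarith only [hnle, P1, hnKN0]) rfl rfl w F hw o ho
    hwo (fun _ => rfl) v (by linarith only [hv]) (by linarith only [hv1, hvdef])
    v1 y s d c X Y Z Q (R / w o) (fun i => (hv1M i).trans (by linarith only [hMN, hNle, P1, hnKN0]))
    hsP hby hcP hQ2 hcrit hRw ?_ ?_ hLZ ?_
  · have : -v = u₀ x₀ - u x₀ := by rw [hvdef]; ring
    rwa [this] at hres
  · have h1 : ∑ i, F i * X i = (∑ i, F i * (p i - ∑ k, Da i i (pb k) * D k)) / w o := by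
      rw [Finset.sum_div]
      exact Finset.sum_congr rfl fun i _ => by simp only [hX]; ring
    rw [h1, le_div_iff₀ hwo0, sub_mul, div_mul_cancel₀ _ hwo0.ne']
    refine le_trans (le_of_eq ?_) hLX
    rw [hP]
  · refine le_trans ?_ hLY
    have h1 : 2 * n * K ≤ P := by linarith only [hnKle, P1, hnKN0]
    have h2 : n * M ^ 2 * K ≤ P := by
      have e1 : n * K * M ^ 2 ≤ n * K * N ^ 2 :=
        mul_le_mul_of_nonneg_left (pow_le_pow_left₀ (by linarith only [hM]) hMN 2) (by positivity)
      have e2 : n * K * N ^ 2 ≤ n * K ^ 2 * N ^ 2 := by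
        have : n * K ^ 2 * N ^ 2 = n * K * N ^ 2 * K := by ring
        rw [this]; exact le_mul_of_one_le_right (by positivity) hK
      have e3 : 0 ≤ n * K ^ 2 * N ^ 2 := by positivity
      rw [hP]; linarith only [e1, e2, e3]
    have h3 := mul_le_mul_of_nonneg_right h2 hT0
    linarith only [h1, h3]
  · exact Finset.sum_nonpos fun i _ => mul_nonpos_of_nonneg_of_nonpos (hF0 i).le (hmax2 i)

end MaxPoint
end GJE

namespace GJE

/-! ### Bilinear forms in orthonormal bases -/

section Basis

variable {n : ℕ} {𝒰 : Set (Jet n)} {a : Eu n → Eu n → Jet n → ℝ} {K : ℝ}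

theorem augHess_bilin (ha : CoefBounds 𝒰 a K) {u : Eu n → ℝ} {x : Eu n}
    (hu : ContDiffAt ℝ 2 u x) :
    ∃ B : Eu n →ₗ[ℝ] Eu n →ₗ[ℝ] ℝ, ∀ ξ η, augHess a u ξ η x = B ξ η := by
  obtain ⟨B, hB⟩ := ha.bilin (jet u x)
  refine ⟨(ContinuousLinearMap.coeLM ℝ).comp (fderiv ℝ (fderiv ℝ u) x).toLinearMap - B,
    fun ξ η => ?_⟩
  rw [augHess, dirD_dirD hu, hB]
  simp

theorem bilin_expand (B : Eu n →ₗ[ℝ] Eu n →ₗ[ℝ] ℝ) (b : OrthonormalBasis (Fin n) ℝ (Eu n))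
    (ξ η : Eu n) :
    B ξ η = ∑ i, ∑ j, inner ℝ (b i) ξ * inner ℝ (b j) η * B (b i) (b j) := by
  conv_lhs => rw [← b.sum_repr' ξ, ← b.sum_repr' η]
  simp only [map_sum, LinearMap.sum_apply, map_smul, LinearMap.smul_apply, smul_eq_mul]
  simp only [Finset.mul_sum]
  rw [Finset.sum_comm]
  exact Finset.sum_congr rfl fun i _ => Finset.sum_congr rfl fun j _ => by ring

/-- The change of basis is orthogonal. This lets the equation, stated in the standard basis, be
differentiated in the eigenbasis at the maximum point. -/
theorem det_bilin_eq (B : Eu n →ₗ[ℝ] Eu n →ₗ[ℝ] ℝ) (b c : OrthonormalBasis (Fin n) ℝ (Eu n)) :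
    (Matrix.of fun i j => B (b i) (b j)).det = (Matrix.of fun i j => B (c i) (c j)).det := by
  set Q : Matrix (Fin n) (Fin n) ℝ := Matrix.of fun i k => inner ℝ (c k) (b i) with hQ
  have h1 : (Matrix.of fun i j => B (b i) (b j)) =
      Q * (Matrix.of fun i j => B (c i) (c j)) * Q.transpose := by
    ext i j
    rw [Matrix.of_apply, bilin_expand B c, Matrix.mul_apply]
    simp only [Matrix.mul_apply, Matrix.of_apply, Matrix.transpose_apply, hQ, Finset.sum_mul]
    rw [Finset.sum_comm]
    exact Finset.sum_congr rfl fun k _ => Finset.sum_congr rfl fun l _ => by ring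
  have h2 : Q * Q.transpose = 1 := by
    ext i j
    simp only [Matrix.mul_apply, Matrix.transpose_apply, hQ, Matrix.of_apply]
    rw [Matrix.one_apply, ← orthonormal_iff_ite.1 b.orthonormal i j,
      ← c.sum_inner_mul_inner (b i) (b j)]
    exact Finset.sum_congr rfl fun k _ => by rw [real_inner_comm (b i)]
  have h3 : Q.det * Q.det = 1 := by
    have := congrArg Matrix.det h2
    rwa [Matrix.det_mul, Matrix.det_transpose, Matrix.det_one] at this
  rw [h1, Matrix.det_mul, Matrix.det_mul, Matrix.det_transpose]
  linear_combination (Matrix.of fun i j => B (c i) (c j)).det * h3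

theorem exists_diagonal_basis (B : Eu n →ₗ[ℝ] Eu n →ₗ[ℝ] ℝ) (hB : ∀ ξ η, B ξ η = B η ξ) :
    ∃ (b : OrthonormalBasis (Fin n) ℝ (Eu n)) (w : Fin n → ℝ),
      ∀ i j, B (b i) (b j) = if i = j then w i else 0 := by
  set c := EuclideanSpace.basisFun (Fin n) ℝ with hc
  set H : Matrix (Fin n) (Fin n) ℝ := Matrix.of fun i j => B (c i) (c j) with hH
  have hherm : H.IsHermitian := by
    ext i j
    simp [hH, hB (c i)]
  refine ⟨hherm.eigenvectorBasis, hherm.eigenvalues, fun i j => ?_⟩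
  set b := hherm.eigenvectorBasis
  have h1 := hherm.mulVec_eigenvectorBasis j
  have h2 : B (b i) (b j) = hherm.eigenvalues j * inner ℝ (b i) (b j) := by
    rw [bilin_expand B c, ← c.sum_inner_mul_inner (b i) (b j), Finset.mul_sum]
    refine Finset.sum_congr rfl fun k _ => ?_
    have h3 := congrFun h1 k
    simp only [Matrix.mulVec, dotProduct, hH, Matrix.of_apply, Pi.smul_apply, smul_eq_mul] at h3
    have h4 : ∀ (y : Eu n) l, inner ℝ (c l) y = y l := fun y l => by
      simp [hc, EuclideanSpace.inner_single_left]
    have h6 : inner ℝ (b i) (c k) = b i k := by rw [real_inner_comm, h4]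
    rw [h6, h4]
    have h5 : ∑ l, b i k * inner ℝ (c l) (b j) * B (c k) (c l) =
        b i k * ∑ l, B (c k) (c l) * b j l := by
      rw [Finset.mul_sum]
      exact Finset.sum_congr rfl fun l _ => by rw [h4]; ring
    simp only [h4] at h5 ⊢
    rw [h5, h3]; ring
  rw [h2, orthonormal_iff_ite.1 b.orthonormal i j]
  split_ifs with h
  · subst h; simp
  · simp

theorem le_of_diagonal (B : Eu n →ₗ[ℝ] Eu n →ₗ[ℝ] ℝ) (b : OrthonormalBasis (Fin n) ℝ (Eu n))
    (w : Fin n → ℝ) (h : ∀ i j, B (b i) (b j) = if i = j then w i else 0) (o : Fin n)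
    (ho : ∀ i, w i ≤ w o) {ξ : Eu n} (hξ : ‖ξ‖ = 1) : B ξ ξ ≤ w o := by
  rw [bilin_expand B b]
  simp only [h, mul_ite, mul_zero, Finset.sum_ite_eq, Finset.mem_univ, if_true]
  calc ∑ i, inner ℝ (b i) ξ * inner ℝ (b i) ξ * w i
      ≤ ∑ i, ‖inner ℝ (b i) ξ‖ ^ 2 * w o := by
        refine Finset.sum_le_sum fun i _ => ?_
        rw [Real.norm_eq_abs, sq_abs, sq]
        exact mul_le_mul_of_nonneg_left (ho i) (mul_self_nonneg _)
    _ = w o := by rw [← Finset.sum_mul, b.sum_sq_norm_inner_right, hξ]; ring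

end Basis

/-! ### The weighted interior estimate on a small domain -/

section Interior

variable {n : ℕ} {𝒰 : Set (Jet n)} {a : Eu n → Eu n → Jet n → ℝ} {K : ℝ}

/-- Joint continuity in the point and the direction is needed because the maximum is taken over both
at once. -/
theorem continuousOn_augHess (ha : CoefBounds 𝒰 a K) {Ω : Set (Eu n)} (hΩ : IsOpen Ω)
    {u : Eu n → ℝ} (hu : ContDiffOn ℝ 4 u Ω) (hj : ∀ x ∈ Ω, jet u x ∈ 𝒰) :
    ContinuousOn (fun z : Eu n × Eu n => augHess a u z.2 z.2 z.1) (Ω ×ˢ univ) := by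
  set c := EuclideanSpace.basisFun (Fin n) ℝ
  have h1 : ∀ z ∈ Ω ×ˢ (univ : Set (Eu n)), augHess a u z.2 z.2 z.1 =
      ∑ i, ∑ j, inner ℝ (c i) z.2 * inner ℝ (c j) z.2 * augHess a u (c i) (c j) z.1 := by
    rintro ⟨x, ξ⟩ ⟨hx, -⟩
    have hux := hu.contDiffAt (hΩ.mem_nhds hx)
    obtain ⟨B, hB⟩ := augHess_bilin ha (hux.of_le (by norm_num))
    simp only [hB]
    exact bilin_expand B c ξ ξ
  refine ContinuousOn.congr ?_ h1
  refine continuousOn_finsetSum _ fun i _ => continuousOn_finsetSum _ fun j _ => ?_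
  have h2 : ContinuousOn (augHess a u (c i) (c j)) Ω := fun x hx =>
    (contDiffAt_augHess ha (hu.contDiffAt (hΩ.mem_nhds hx)) (hj x hx) _ _).continuousAt
      |>.continuousWithinAt
  have h3 : ContinuousOn (fun z : Eu n × Eu n => augHess a u (c i) (c j) z.1) (Ω ×ˢ univ) :=
    h2.comp continuousOn_fst fun z hz => hz.1
  have h4 : Continuous fun z : Eu n × Eu n => inner ℝ (c i) z.2 * inner ℝ (c j) z.2 := by fun_prop
  exact h4.continuousOn.mul h3

set_option maxHeartbeats 800000 in
/-- The interior second derivative estimate in a domain of small diameter. -/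
theorem augHess_mul_pow_le (ha : CoefBounds 𝒰 a K) {M N P : ℝ} (hK : 1 ≤ K) (hM : 1 ≤ M)
    (hN : N = 1 + M + n * K) (hP : P = 20 * n * K ^ 2 * N ^ 2) {Ω : Set (Eu n)} (hΩ : IsOpen Ω)
    {u u₀ : Eu n → ℝ} {xbar : Eu n} {f₀ : ℝ} (hf₀ : 0 < f₀)
    (hu : ContDiffOn ℝ 4 u Ω) (hu₀ : ContDiffOn ℝ 2 u₀ Ω) (hj : ∀ x ∈ Ω, jet u x ∈ 𝒰)
    (hpos : ∀ x ∈ Ω, ∀ ξ, 0 ≤ augHess a u ξ ξ x)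
    (hdet : ∀ x ∈ Ω, (Matrix.of fun i j => augHess a u (EuclideanSpace.basisFun (Fin n) ℝ i)
      (EuclideanSpace.basisFun (Fin n) ℝ j) x).det = f₀)
    (hu₀eq : ∀ x ∈ Ω, ∀ ξ, dirD ξ (dirD ξ u₀) x = a ξ ξ (jet u₀ x))
    (hj1 : ∀ x ∈ Ω, ∀ q ∈ segment ℝ (∇ u x) (∇ u₀ x), (x, u x, q) ∈ 𝒰)
    (hj2 : ∀ x ∈ Ω, ∀ r ∈ segment ℝ (u x) (u₀ x), (x, r, ∇ u₀ x) ∈ 𝒰)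
    (hM1 : ∀ x ∈ Ω, ‖∇ u x‖ ≤ M) (hM2 : ∀ x ∈ Ω, ‖∇ u x - ∇ u₀ x‖ ≤ M)
    (hv : ∀ x ∈ Ω, u x < u₀ x) (hv1 : ∀ x ∈ Ω, u₀ x - u x ≤ 1)
    (hx : ∀ x ∈ Ω, 100 * P ^ 2 * ‖x - xbar‖ ≤ 1)
    (hcomp : ∀ δ > 0, IsCompact {x ∈ Ω | δ ≤ u₀ x - u x})
    (hbdd : ∃ R, ∀ x ∈ Ω, ∀ ξ : Eu n, ‖ξ‖ = 1 → augHess a u ξ ξ x ≤ R)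
    {x₁ ξ₁ : Eu n} (hx₁ : x₁ ∈ Ω) (hξ₁ : ‖ξ₁‖ = 1) :
    augHess a u ξ₁ ξ₁ x₁ * (u₀ x₁ - u x₁) ^ 12 ≤
      (1 + 4 * P ^ 3 * (40 * P ^ 2)) * Real.exp 2 := by
  have hne : Nonempty (Fin n) := by
    rcases n with _ | n
    · exfalso
      have : ξ₁ = 0 := Subsingleton.elim _ _
      simp [this] at hξ₁
    · exact ⟨0⟩
  have hn : (1 : ℝ) ≤ n := by
    have : 0 < n := hne.some.pos
    exact_mod_cast this
  have hnK : 1 ≤ n * K := by nlinarith only [hn, hK]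
  have hN1 : 1 ≤ N := by linarith only [hN, hM, hnK]
  have hMP : M ≤ P := by
    have h1 : N ≤ N ^ 2 := by nlinarith only [hN1]
    have h2 : 1 ≤ n * K ^ 2 := by nlinarith only [hnK, hK]
    have h3 : N ^ 2 ≤ n * K ^ 2 * N ^ 2 := le_mul_of_one_le_left (by positivity) h2
    rw [hP]; linarith only [h1, h3, hN, hnK, hN1]
  have hP1 : 1 ≤ P := hM.trans hMP
  set E : Eu n → ℝ := fun x => 1 / (4 * P ^ 3) * ‖∇ u x‖ ^ 2 + 50 * P ^ 2 * ‖x - xbar‖ ^ 2 with hE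
  have hE0 : ∀ x, 0 ≤ E x := fun x => by positivity
  have hE2 : ∀ x ∈ Ω, E x ≤ 2 := by
    intro x hxΩ
    have h1 : 1 / (4 * P ^ 3) * ‖∇ u x‖ ^ 2 ≤ 1 := by
      rw [one_div, inv_mul_le_iff₀ (by positivity)]
      have e1 : ‖∇ u x‖ ^ 2 ≤ P ^ 2 :=
        pow_le_pow_left₀ (norm_nonneg _) ((hM1 x hxΩ).trans hMP) 2
      have e2 : P ^ 2 ≤ P ^ 3 := pow_le_pow_right₀ hP1 (by norm_num)
      have e3 : 0 ≤ P ^ 3 := by positivity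
      linarith only [e1, e2, e3]
    have h2 : 50 * P ^ 2 * ‖x - xbar‖ ^ 2 ≤ 1 := by
      have e1 := hx x hxΩ
      have e2 : ‖x - xbar‖ ≤ 1 := by
        have : 1 ≤ 100 * P ^ 2 := by nlinarith only [hP1]
        nlinarith only [e1, this, norm_nonneg (x - xbar)]
      have e3 : 100 * P ^ 2 * ‖x - xbar‖ * ‖x - xbar‖ ≤ 1 * 1 :=
        mul_le_mul e1 e2 (norm_nonneg _) zero_le_one
      linarith only [e3]
    simp only [hE]; linarith only [h1, h2]
  set C := (1 + 4 * P ^ 3 * (40 * P ^ 2)) * Real.exp 2 with hC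
  have hCe : Real.exp 2 ≤ C := le_mul_of_one_le_left (Real.exp_pos _).le
    (by have : 0 ≤ P ^ 3 * P ^ 2 := by positivity
        linarith only [this])
  by_contra! hcon
  -- This is the exponential of the test function, which also makes sense where W_ξξ vanishes.
  set G : Eu n × Eu n → ℝ := fun z =>
    augHess a u z.2 z.2 z.1 * (u₀ z.1 - u z.1) ^ 12 * Real.exp (E z.1) with hG
  have hG1 : C < G (x₁, ξ₁) := by
    refine hcon.trans_le (le_mul_of_one_le_right ?_ (Real.one_le_exp (hE0 _)))
    exact mul_nonneg (hpos x₁ hx₁ ξ₁) (pow_nonneg (by linarith [hv x₁ hx₁]) _)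
  obtain ⟨R, hR⟩ := hbdd
  set R' := max R 0 with hR'
  -- Where u₀ - u < δ, the product of W_ξξ and the weight is at most R'δ ≤ 1, so G cannot exceed C
  -- there. A larger value must be attained on the compact set where u₀ - u ≥ δ.
  set δ := 1 / (R' + 1) with hδ
  have hR'0 : 0 ≤ R' := le_max_right _ _
  have hδ0 : 0 < δ := by positivity
  have hsmall : ∀ x ∈ Ω, ∀ ξ : Eu n, ‖ξ‖ = 1 → u₀ x - u x < δ → G (x, ξ) ≤ C := by
    intro x hxΩ ξ hξ hxδ
    have m0 : 0 < u₀ x - u x := by linarith [hv x hxΩ]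
    have h1 : (u₀ x - u x) ^ 12 ≤ δ :=
      (pow_le_of_le_one m0.le (hv1 x hxΩ) (by norm_num)).trans hxδ.le
    have h2 : augHess a u ξ ξ x * (u₀ x - u x) ^ 12 ≤ R' * δ :=
      mul_le_mul ((hR x hxΩ ξ hξ).trans (le_max_left _ _)) h1 (pow_nonneg m0.le _) hR'0
    have h3 : R' * δ ≤ 1 := by
      rw [hδ, mul_one_div, div_le_one (by positivity)]; linarith
    have h4 : G (x, ξ) ≤ 1 * Real.exp 2 :=
      mul_le_mul (h2.trans h3) (Real.exp_le_exp.2 (hE2 x hxΩ)) (Real.exp_pos _).le zero_le_one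
    linarith
  set Kδ := {x ∈ Ω | δ ≤ u₀ x - u x} with hKδ
  have hcompact : IsCompact (Kδ ×ˢ Metric.sphere (0 : Eu n) 1) :=
    (hcomp δ hδ0).prod (isCompact_sphere _ _)
  have hmem1 : (x₁, ξ₁) ∈ Kδ ×ˢ Metric.sphere (0 : Eu n) 1 := by
    refine ⟨⟨hx₁, ?_⟩, by simpa using hξ₁⟩
    by_contra! h
    exact absurd (hsmall x₁ hx₁ ξ₁ hξ₁ h) (not_le.2 hG1)
  have hu4 : ∀ x ∈ Ω, ContDiffAt ℝ 4 u x := fun x hxΩ => hu.contDiffAt (hΩ.mem_nhds hxΩ)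
  have hcont : ContinuousOn G (Ω ×ˢ univ) := by
    have c1 := continuousOn_augHess ha hΩ hu hj
    have c2 : ContinuousOn (fun x => (u₀ x - u x) ^ 12) Ω :=
      (hu₀.continuousOn.sub hu.continuousOn).pow 12
    have c3 : ContinuousOn (∇ u) Ω := fun x hxΩ =>
      (contDiffAt_gradient (k := 3) (l := 4) (by exact_mod_cast hu4 x hxΩ)
        le_rfl).continuousAt.continuousWithinAt
    have c4 : ContinuousOn (fun x => Real.exp (E x)) Ω := by
      refine Real.continuous_exp.comp_continuousOn ?_
      refine (continuousOn_const.mul (c3.norm.pow 2)).add ?_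
      exact Continuous.continuousOn (by fun_prop)
    have hfst : MapsTo Prod.fst (Ω ×ˢ (univ : Set (Eu n))) Ω := fun z hz => hz.1
    exact (c1.mul (c2.comp continuousOn_fst hfst)).mul (c4.comp continuousOn_fst hfst)
  obtain ⟨⟨x₀, ξ₀⟩, ⟨⟨hx₀, -⟩, hξ₀⟩, hmax⟩ := hcompact.exists_isMaxOn ⟨_, hmem1⟩
    (hcont.mono fun z hz => ⟨hz.1.1, trivial⟩)
  have hξ₀1 : ‖ξ₀‖ = 1 := by simpa using hξ₀
  have hG0 : C < G (x₀, ξ₀) := hG1.trans_le (hmax hmem1)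
  have hGmax : ∀ x ∈ Ω, ∀ ξ : Eu n, ‖ξ‖ = 1 → G (x, ξ) ≤ G (x₀, ξ₀) := by
    intro x hxΩ ξ hξ
    by_cases h : δ ≤ u₀ x - u x
    · exact hmax (show (x, ξ) ∈ Kδ ×ˢ Metric.sphere (0 : Eu n) 1 from
        ⟨⟨hxΩ, h⟩, by simpa using hξ⟩)
    · exact (hsmall x hxΩ ξ hξ (not_le.1 h)).trans hG0.le
  have hu2 : ∀ x ∈ Ω, ContDiffAt ℝ 2 u x := fun x hxΩ => (hu4 x hxΩ).of_le (by norm_num)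
  obtain ⟨B, hB⟩ := augHess_bilin ha (hu2 x₀ hx₀)
  obtain ⟨b, w, hbw⟩ := exists_diagonal_basis B fun ξ η => by
    rw [← hB, ← hB, augHess, augHess, dirD_comm (hu2 x₀ hx₀), ha.symm _ (hj x₀ hx₀)]
  have hdetb : ∀ x ∈ Ω, (Matrix.of fun i j => augHess a u (b i) (b j) x).det = f₀ := by
    intro x hxΩ
    obtain ⟨B', hB'⟩ := augHess_bilin ha (hu2 x hxΩ)
    rw [← hdet x hxΩ]
    simp only [hB']
    exact det_bilin_eq B' _ _
  have hdiag : ∀ i j, augHess a u (b i) (b j) x₀ = if i = j then w i else 0 := fun i j => by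
    rw [hB, hbw]
  have hw0 : ∀ i, 0 ≤ w i := fun i => by
    have := hpos x₀ hx₀ (b i)
    rwa [hdiag, if_pos rfl] at this
  have hprod : ∏ i, w i = f₀ := by
    rw [← hdetb x₀ hx₀, ← Matrix.det_diagonal]
    congr 1
    ext i j
    simp [hdiag, Matrix.diagonal_apply]
  have hw : ∀ i, 0 < w i := fun i => lt_of_le_of_ne (hw0 i) fun h => by
    have := Finset.prod_eq_zero (Finset.mem_univ i) h.symm
    rw [hprod] at this
    exact hf₀.ne' this
  obtain ⟨o, -, ho'⟩ := Finset.exists_max_image Finset.univ w Finset.univ_nonempty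
  have ho : ∀ i, w i ≤ w o := fun i => ho' i (Finset.mem_univ i)
  have m0 : 0 < u₀ x₀ - u x₀ := by linarith [hv x₀ hx₀]
  -- Replacing ξ₀ by the top eigenvector `b o` does not lower G. With this direction frozen, x₀ is a
  -- local maximum of a function of x alone.
  have hGo : G (x₀, ξ₀) ≤ G (x₀, b o) := by
    have : augHess a u ξ₀ ξ₀ x₀ ≤ augHess a u (b o) (b o) x₀ := by
      rw [hdiag, if_pos rfl, hB]; exact le_of_diagonal B b w hbw o ho hξ₀1
    simp only [hG]
    gcongr
  have hGw : G (x₀, b o) = w o * (u₀ x₀ - u x₀) ^ 12 * Real.exp (E x₀) := by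
    simp only [hG, hdiag, if_true]
  have hm1 := hv1 x₀ hx₀
  have hexp : Real.exp (E x₀) ≤ Real.exp 2 := Real.exp_le_exp.2 (hE2 x₀ hx₀)
  -- One factor u₀ - u suffices for the eigenvalue bound; the other eleven are at most 1.
  have hfinal : ∀ c, w o * (u₀ x₀ - u x₀) ≤ c → G (x₀, b o) ≤ c * Real.exp 2 := by
    intro c hc
    rw [hGw]
    have h1 : w o * (u₀ x₀ - u x₀) ^ 12 ≤ c := by
      have : w o * (u₀ x₀ - u x₀) ^ 12 = w o * (u₀ x₀ - u x₀) * (u₀ x₀ - u x₀) ^ 11 := by ring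
      rw [this]
      exact (mul_le_of_le_one_right (mul_nonneg (hw0 o) m0.le) (pow_le_one₀ m0.le hm1)).trans hc
    exact mul_le_mul h1 hexp (Real.exp_pos _).le
      ((mul_nonneg (hw0 o) m0.le).trans hc)
  by_cases hwo : 1 ≤ w o
  · have hlm : IsLocalMax (fun x => Real.log (augHess a u (b o) (b o) x) +
        (12 * Real.log (u₀ x - u x) + (1 / (4 * P ^ 3) * ‖∇ u x‖ ^ 2 +
        50 * P ^ 2 * ‖x - xbar‖ ^ 2))) x₀ := by
      have hcW := (contDiffAt_augHess ha (hu4 x₀ hx₀) (hj x₀ hx₀) (b o) (b o)).continuousAt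
      have hWx₀ : 0 < augHess a u (b o) (b o) x₀ := by rw [hdiag, if_pos rfl]; exact hw o
      filter_upwards [hΩ.mem_nhds hx₀, hcW.eventually (lt_mem_nhds hWx₀)] with x hxΩ hxW
      have hmx : 0 < u₀ x - u x := by linarith [hv x hxΩ]
      have h1 : G (x, b o) ≤ G (x₀, b o) := (hGmax x hxΩ (b o) (b.norm_eq_one o)).trans hGo
      have h2 : ∀ y, 0 < augHess a u (b o) (b o) y → 0 < u₀ y - u y →
          Real.log (G (y, b o)) = Real.log (augHess a u (b o) (b o) y) +
          (12 * Real.log (u₀ y - u y) + E y) := by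
        intro y h3 h4
        simp only [hG]
        rw [Real.log_mul (by positivity) (Real.exp_pos _).ne', Real.log_mul h3.ne' (by positivity),
          Real.log_pow, Real.log_exp]
        push_cast; ring
      have hpG : 0 < G (x, b o) := by simp only [hG]; positivity
      have h3 := Real.log_le_log hpG h1
      rw [h2 x hxW hmx, h2 x₀ hWx₀ m0] at h3
      exact h3
    have h1 := eigenvalue_bound_at_max ha hK hM hN hP hf₀.ne' b (hu4 x₀ hx₀)
      (hu₀.contDiffAt (hΩ.mem_nhds hx₀)) (hj x₀ hx₀)
      (by filter_upwards [hΩ.mem_nhds hx₀] with x hxΩ using hdetb x hxΩ)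
      w hw hdiag o ho hwo (hu₀eq x₀ hx₀) (hj1 x₀ hx₀) (hj2 x₀ hx₀) (hM1 x₀ hx₀) (hM2 x₀ hx₀)
      (hv x₀ hx₀) hm1 (hx x₀ hx₀) hlm
    exact absurd (hfinal _ h1) (not_le.2 (hG0.trans_le hGo))
  · have h1 := hfinal 1 (by nlinarith [hw o, not_le.1 hwo])
    rw [one_mul] at h1
    exact absurd (h1.trans hCe) (not_le.2 (hG0.trans_le hGo))

end Interior
end GJE

namespace GJE

/-! ### Derivatives of restrictions to affine slices -/

section Slices

variable {E E' F : Type*} [NormedAddCommGroup E] [NormedSpace ℝ E]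
  [NormedAddCommGroup E'] [NormedSpace ℝ E'] [NormedAddCommGroup F] [NormedSpace ℝ F]

theorem hasFDerivAt_slice {f : E' → F} {j : E → E'} {ι : E →L[ℝ] E'}
    (hj : ∀ x, HasFDerivAt j ι x) {x : E} (hf : DifferentiableAt ℝ f (j x)) :
    HasFDerivAt (fun y => f (j y)) ((fderiv ℝ f (j x)).comp ι) x :=
  hf.hasFDerivAt.comp x (hj x)

theorem dirD_slice {f : E' → F} {j : E → E'} {ι : E →L[ℝ] E'}
    (hj : ∀ x, HasFDerivAt j ι x) {x : E} (hf : DifferentiableAt ℝ f (j x)) (v : E) :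
    dirD v (fun y => f (j y)) x = dirD (ι v) f (j x) := by
  simp only [dirD, (hasFDerivAt_slice hj hf).fderiv]; rfl

theorem dirD₂_slice {f : E' → F} {j : E → E'} {ι : E →L[ℝ] E'}
    (hj : ∀ x, HasFDerivAt j ι x) {x : E} (hf : ContDiffAt ℝ 2 f (j x)) (v w : E) :
    dirD v (dirD w fun y => f (j y)) x = dirD (ι v) (dirD (ι w) f) (j x) := by
  have h1 : dirD w (fun y => f (j y)) =ᶠ[𝓝 x] fun y => dirD (ι w) f (j y) := by
    filter_upwards [(hj x).continuousAt.eventually (hf.eventually (by simp))] with y hy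
    exact dirD_slice hj (hy.differentiableAt (by norm_num)) w
  rw [(dirD_congr h1 v).eq_of_nhds, dirD_slice hj]
  exact (contDiffAt_dirD (k := 1) (l := 2) (by exact_mod_cast hf) le_rfl _).differentiableAt
    (by norm_num)

theorem iteratedFDeriv_two_eq_dirD {f : E → F} {x : E} (hf : ContDiffAt ℝ 2 f x) (v w : E) :
    iteratedFDeriv ℝ 2 f x ![v, w] = dirD v (dirD w f) x := by
  rw [iteratedFDeriv_two_apply, dirD_dirD hf]; simp

theorem ContDiffAt.slice {f : E' → F} {j : E → E'} {k : WithTop ℕ∞} {x : E}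
    (hf : ContDiffAt ℝ k f (j x)) (hj : ContDiff ℝ k j) : ContDiffAt ℝ k (fun y => f (j y)) x :=
  ContDiffAt.comp x hf hj.contDiffAt

end Slices

/-! ### Partial derivatives of g as directional derivatives -/

section Partial

variable {n : ℕ}

/-- The inclusion of the `x`-directions. -/
def inX (n : ℕ) : Eu n →L[ℝ] XYZ n := ContinuousLinearMap.inl ℝ (Eu n) (Eu n × ℝ)

/-- The inclusion of the `y`-directions. -/
def inY (n : ℕ) : Eu n →L[ℝ] XYZ n :=
  (ContinuousLinearMap.inr ℝ (Eu n) (Eu n × ℝ)).comp (ContinuousLinearMap.inl ℝ (Eu n) ℝ)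

/-- The inclusion of the `z`-direction. -/
def inZ (n : ℕ) : ℝ →L[ℝ] XYZ n :=
  (ContinuousLinearMap.inr ℝ (Eu n) (Eu n × ℝ)).comp (ContinuousLinearMap.inr ℝ (Eu n) ℝ)

theorem inY_apply (v : Eu n) : inY n v = (0, v, 0) := rfl
theorem inZ_apply (t : ℝ) : inZ n t = (0, 0, t) := rfl

theorem hasFDerivAt_mkX (r : Eu n × ℝ) (x : Eu n) :
    HasFDerivAt (fun x : Eu n => ((x, r) : XYZ n)) (inX n) x :=
  (hasFDerivAt_id x).prodMk (hasFDerivAt_const r x)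

theorem hasFDerivAt_mkY (x : Eu n) (z : ℝ) (y : Eu n) :
    HasFDerivAt (fun y : Eu n => ((x, y, z) : XYZ n)) (inY n) y := by
  have h : inY n = (0 : Eu n →L[ℝ] Eu n).prod
      ((ContinuousLinearMap.id ℝ (Eu n)).prod (0 : Eu n →L[ℝ] ℝ)) := rfl
  rw [h]
  exact (hasFDerivAt_const x y).prodMk ((hasFDerivAt_id y).prodMk (hasFDerivAt_const z y))

theorem hasFDerivAt_mkZ (x y : Eu n) (z : ℝ) :
    HasFDerivAt (fun z : ℝ => ((x, y, z) : XYZ n)) (inZ n) z := by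
  have h : inZ n = (0 : ℝ →L[ℝ] Eu n).prod
      ((0 : ℝ →L[ℝ] Eu n).prod (ContinuousLinearMap.id ℝ ℝ)) := rfl
  rw [h]
  exact (hasFDerivAt_const x z).prodMk ((hasFDerivAt_const y z).prodMk (hasFDerivAt_id z))

variable {g : XYZ n → ℝ} {q : XYZ n}

theorem inner_gX (hg : DifferentiableAt ℝ g q) (v : Eu n) :
    inner ℝ v (gX g q) = dirD (inX n v) g q := by
  rw [gX, inner_gradient]
  exact dirD_slice (f := g) (j := fun x => (x, q.2)) (hasFDerivAt_mkX q.2) (by exact hg) v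

theorem inner_gY (hg : DifferentiableAt ℝ g q) (v : Eu n) :
    inner ℝ v (gY g q) = dirD (inY n v) g q := by
  rw [gY, inner_gradient]
  exact dirD_slice (f := g) (j := fun y => (q.1, y, q.2.2)) (hasFDerivAt_mkY q.1 q.2.2)
    (by exact hg) v

theorem gZ_eq (hg : DifferentiableAt ℝ g q) : gZ g q = dirD (inZ n 1) g q := by
  rw [gZ, ← fderiv_apply_one_eq_deriv]
  exact dirD_slice (f := g) (j := fun z => (q.1, q.2.1, z)) (hasFDerivAt_mkZ q.1 q.2.1)
    (by exact hg) 1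

theorem hasDerivAt_gZ (hg : DifferentiableAt ℝ g q) :
    HasDerivAt (fun z => g (q.1, q.2.1, z)) (gZ g q) q.2.2 := by
  have h := hasFDerivAt_slice (f := g) (j := fun z => (q.1, q.2.1, z))
    (hasFDerivAt_mkZ q.1 q.2.1) (x := q.2.2) (by exact hg)
  rw [gZ]
  exact h.differentiableAt.hasDerivAt

theorem apply_eq_inner (v : Eu n) (i : Fin n) :
    v i = inner ℝ (EuclideanSpace.single i (1 : ℝ)) v := by
  simp [EuclideanSpace.inner_single_left]

theorem gX_apply (hg : DifferentiableAt ℝ g q) (i : Fin n) :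
    gX g q i = dirD (inX n (EuclideanSpace.single i 1)) g q := by
  rw [apply_eq_inner, inner_gX hg]

theorem gY_apply (hg : DifferentiableAt ℝ g q) (i : Fin n) :
    gY g q i = dirD (inY n (EuclideanSpace.single i 1)) g q := by
  rw [apply_eq_inner, inner_gY hg]

theorem gXX_apply (hg : ContDiffAt ℝ 2 g q) (v w : Eu n) :
    gXX g q ![v, w] = dirD (inX n v) (dirD (inX n w) g) q := by
  rw [gXX, iteratedFDeriv_two_eq_dirD]
  · exact dirD₂_slice (f := g) (j := fun x => (x, q.2)) (hasFDerivAt_mkX q.2) (by exact hg) v w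
  · exact ContDiffAt.slice (f := g) (j := fun x => (x, q.2)) (by exact hg) (by fun_prop)

/-- As a pullback of the full Hessian, g_xx is seen to be differentiable in all the variables (x, y,
z) jointly. -/
theorem gXX_eq (hg : ContDiffAt ℝ 2 g q) :
    gXX g q = (iteratedFDeriv ℝ 2 g q).compContinuousLinearMap fun _ => inX n := by
  ext m
  have h : m = ![m 0, m 1] := by ext i; fin_cases i <;> rfl
  rw [h, gXX_apply hg, ContinuousMultilinearMap.compContinuousLinearMap_apply,
    ← iteratedFDeriv_two_eq_dirD hg]
  congr 1
  funext i; fin_cases i <;> rfl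

theorem matE_apply (hg : ContDiffAt ℝ 2 g q) (i j : Fin n) :
    matE g q i j =
      dirD (inY n (EuclideanSpace.single j 1)) (dirD (inX n (EuclideanSpace.single i 1)) g) q
      - (gZ g q)⁻¹ * dirD (inZ n 1) (dirD (inX n (EuclideanSpace.single i 1)) g) q
        * dirD (inY n (EuclideanSpace.single j 1)) g q := by
  have hev : ∀ᶠ p in 𝓝 q, gX g p i = dirD (inX n (EuclideanSpace.single i 1)) g p := by
    filter_upwards [hg.eventually (by simp)] with p hp
    exact gX_apply (hp.differentiableAt (by norm_num)) i
  have hd : DifferentiableAt ℝ (dirD (inX n (EuclideanSpace.single i 1)) g) q :=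
    differentiableAt_dirD hg _
  have hy := hasFDerivAt_mkY q.1 q.2.2 q.2.1
  have hz := hasFDerivAt_mkZ q.1 q.2.1 q.2.2
  simp only [matE, Matrix.of_apply]
  congr 1
  · have h1 : (fun y => gX g (q.1, y, q.2.2) i) =ᶠ[𝓝 q.2.1] fun y =>
        dirD (inX n (EuclideanSpace.single i 1)) g (q.1, y, q.2.2) := hy.continuousAt.eventually hev
    rw [h1.fderiv_eq]
    exact dirD_slice (j := fun y => (q.1, y, q.2.2)) (hasFDerivAt_mkY q.1 q.2.2) (by exact hd) _
  · have h1 : (fun z => gX g (q.1, q.2.1, z) i) =ᶠ[𝓝 q.2.2] fun z =>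
        dirD (inX n (EuclideanSpace.single i 1)) g (q.1, q.2.1, z) := hz.continuousAt.eventually hev
    rw [h1.deriv_eq, gY_apply (hg.differentiableAt (by norm_num)), ← fderiv_apply_one_eq_deriv]
    have := dirD_slice (j := fun z => (q.1, q.2.1, z)) (x := q.2.2) (hasFDerivAt_mkZ q.1 q.2.1)
      (by exact hd) 1
    rw [← this]; rfl

theorem contDiffAt_gX {k l : ℕ} (hg : ContDiffAt ℝ l g q) (h : k + 1 ≤ l) :
    ContDiffAt ℝ k (gX g) q := by
  rw [contDiffAt_euclidean]
  intro i
  refine (contDiffAt_dirD hg h (inX n (EuclideanSpace.single i 1))).congr_of_eventuallyEq ?_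
  filter_upwards [hg.eventually (by simp)] with p hp
  exact gX_apply (hp.differentiableAt (by exact_mod_cast (by omega : l ≠ 0))) i

theorem contDiffAt_gY {k l : ℕ} (hg : ContDiffAt ℝ l g q) (h : k + 1 ≤ l) :
    ContDiffAt ℝ k (gY g) q := by
  rw [contDiffAt_euclidean]
  intro i
  refine (contDiffAt_dirD hg h (inY n (EuclideanSpace.single i 1))).congr_of_eventuallyEq ?_
  filter_upwards [hg.eventually (by simp)] with p hp
  exact gY_apply (hp.differentiableAt (by exact_mod_cast (by omega : l ≠ 0))) i

theorem contDiffAt_gZ {k l : ℕ} (hg : ContDiffAt ℝ l g q) (h : k + 1 ≤ l) :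
    ContDiffAt ℝ k (gZ g) q := by
  refine (contDiffAt_dirD hg h (inZ n 1)).congr_of_eventuallyEq ?_
  filter_upwards [hg.eventually (by simp)] with p hp
  exact gZ_eq (hp.differentiableAt (by exact_mod_cast (by omega : l ≠ 0)))

theorem contDiffAt_gXX (hg : ContDiffAt ℝ 4 g q) : ContDiffAt ℝ 2 (gXX g) q := by
  have h1 : ContDiffAt ℝ 2 (iteratedFDeriv ℝ 2 g) q := hg.iteratedFDeriv_right (by norm_num)
  have h2 := (ContinuousMultilinearMap.compContinuousLinearMapL (𝕜 := ℝ) (F := ℝ)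
    (fun _ : Fin 2 => inX n)).contDiff.contDiffAt.comp q h1
  refine h2.congr_of_eventuallyEq ?_
  filter_upwards [hg.eventually (by simp)] with p hp
  exact gXX_eq (hp.of_le (by norm_num))

theorem continuousAt_matE (hg : ContDiffAt ℝ 4 g q) (hz : gZ g q ≠ 0) :
    ContinuousAt (matE g) q := by
  have hg' : ContDiffAt ℝ (4 : ℕ) g q := by exact_mod_cast hg
  have hd : ∀ v, ContDiffAt ℝ (3 : ℕ) (dirD v g) q := fun v => contDiffAt_dirD hg' (by norm_num) v
  have hdd : ∀ v w, ContinuousAt (dirD v (dirD w g)) q := fun v w =>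
    (contDiffAt_dirD (k := 2) (hd w) (by norm_num) v).continuousAt
  refine continuousAt_pi.2 fun i => continuousAt_pi.2 fun j => ?_
  have h1 : ContinuousAt (fun p => dirD (inY n (EuclideanSpace.single j 1))
      (dirD (inX n (EuclideanSpace.single i 1)) g) p
      - (gZ g p)⁻¹ * dirD (inZ n 1) (dirD (inX n (EuclideanSpace.single i 1)) g) p
        * dirD (inY n (EuclideanSpace.single j 1)) g p) q :=
    (hdd _ _).sub ((((contDiffAt_gZ (k := 3) hg' (by norm_num)).continuousAt.inv₀ hz).mul
      (hdd _ _)).mul (hd _).continuousAt)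
  refine h1.congr ?_
  filter_upwards [hg.eventually (by simp)] with p hp
  exact (matE_apply (hp.of_le (by norm_num)) i j).symm

end Partial
end GJE

namespace GJE

/-! ### Openness of 𝒰 and regularity of A -/

section Generating

variable {n : ℕ} {U V : Set (Eu n)} {I : Eu n → Eu n → Set ℝ} {J : Set ℝ} {g : XYZ n → ℝ}

theorem IsGenerating.contDiffAt (hG : IsGenerating U V I J g) {q : XYZ n} (hq : q ∈ Gam U V I) :
    ContDiffAt ℝ 4 g q := by
  exact_mod_cast hG.smooth.1.contDiffAt (hG.domΓ.1.mem_nhds hq)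

theorem IsGenerating.contDiffAt_two (hG : IsGenerating U V I J g) {q : XYZ n}
    (hq : q ∈ Gam U V I) : ContDiffAt ℝ 2 g q := (hG.contDiffAt hq).of_le (by norm_num)

theorem IsGenerating.differentiableAt (hG : IsGenerating U V I J g) {q : XYZ n}
    (hq : q ∈ Gam U V I) : DifferentiableAt ℝ g q := (hG.contDiffAt hq).differentiableAt (by simp)

/-- Inside Γ the derivative is continuous, so its extension to the closure is the derivative itself.
-/
theorem IsGenerating.gZ_neg (hG : IsGenerating U V I J g) {q : XYZ n} (hq : q ∈ Gam U V I) :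
    gZ g q < 0 := by
  have h1 := hG.A2_gz q (subset_closure hq)
  have h2 : ContinuousAt (gZ g) q := (contDiffAt_gZ (k := 3) (l := 4)
    (by exact_mod_cast hG.contDiffAt hq) le_rfl).continuousAt
  rwa [extendFrom_eq (subset_closure hq) h2.continuousWithinAt] at h1

theorem IsGenerating.det_matE_ne_zero (hG : IsGenerating U V I J g) {q : XYZ n}
    (hq : q ∈ Gam U V I) : (matE g q).det ≠ 0 := by
  have h1 := hG.A2_E q (subset_closure hq)
  have h2 := continuousAt_matE (hG.contDiffAt hq) (hG.gZ_neg hq).ne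
  rwa [extendFrom_eq (subset_closure hq) h2.continuousWithinAt] at h1

/-- The map `(x, y, z) ↦ (x, g, g_x)`. -/
noncomputable def jetMap (g : XYZ n → ℝ) (q : XYZ n) : Jet n := (q.1, g q, gX g q)

theorem dirD_sum_dir {E F : Type*} [NormedAddCommGroup E] [NormedSpace ℝ E]
    [NormedAddCommGroup F] [NormedSpace ℝ F] (f : E → F) (x : E) {ι : Type*} (s : Finset ι)
    (c : ι → ℝ) (e : ι → E) : dirD (∑ i ∈ s, c i • e i) f x = ∑ i ∈ s, c i • dirD (e i) f x := by
  simp [dirD]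

theorem inY_eq_sum (η : Eu n) : inY n η = ∑ j, η j • inY n (EuclideanSpace.single j 1) := by
  conv_lhs => rw [← (EuclideanSpace.basisFun (Fin n) ℝ).sum_repr η]
  simp only [map_sum, map_smul, EuclideanSpace.basisFun_repr, EuclideanSpace.basisFun_apply]

theorem IsGenerating.contDiffAt_jetMap (hG : IsGenerating U V I J g) {q : XYZ n}
    (hq : q ∈ Gam U V I) : ContDiffAt ℝ 3 (jetMap g) q := by
  have h := hG.contDiffAt hq
  exact contDiffAt_fst.prodMk ((h.of_le (by norm_num)).prodMk
    (by exact_mod_cast contDiffAt_gX (k := 3) (l := 4) (by exact_mod_cast h) le_rfl))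

/-- A vector (ξ, η, ζ) of the kernel has ξ = 0. Since g_z ≠ 0, the derivative of g expresses ζ
through η, and substitution into the derivative of g_x leaves Eη = 0. This is the role of det E ≠ 0.
-/
theorem IsGenerating.fderiv_jetMap_injective (hG : IsGenerating U V I J g) {q : XYZ n}
    (hq : q ∈ Gam U V I) : Function.Injective (fderiv ℝ (jetMap g) q) := by
  have hg2 := hG.contDiffAt_two hq
  have hg := hG.differentiableAt hq
  have hgX : DifferentiableAt ℝ (gX g) q := (contDiffAt_gX (k := 3) (l := 4)
    (by exact_mod_cast hG.contDiffAt hq) le_rfl).differentiableAt (by norm_num)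
  have hD : HasFDerivAt (jetMap g) ((ContinuousLinearMap.fst ℝ (Eu n) (Eu n × ℝ)).prod
      ((fderiv ℝ g q).prod (fderiv ℝ (gX g) q))) q :=
    hasFDerivAt_fst.prodMk (hg.hasFDerivAt.prodMk hgX.hasFDerivAt)
  rw [hD.fderiv]
  refine (injective_iff_map_eq_zero _).2 ?_
  rintro ⟨ξ, η, ζ⟩ hv
  simp only [ContinuousLinearMap.prod_apply, Prod.mk_eq_zero, ContinuousLinearMap.coe_fst'] at hv
  obtain ⟨rfl, h2, h3⟩ := hv
  have hz := (hG.gZ_neg hq).ne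
  have hsplit : ((0, η, ζ) : XYZ n) = inY n η + ζ • inZ n 1 := by
    simp [inY_apply, inZ_apply]
  have hζ : ζ = -((gZ g q)⁻¹ * dirD (inY n η) g q) := by
    rw [hsplit, map_add, map_smul, smul_eq_mul] at h2
    have h4 : fderiv ℝ g q (inZ n 1) = gZ g q := (gZ_eq hg).symm
    rw [h4] at h2
    change dirD (inY n η) g q + _ = 0 at h2
    field_simp
    linarith
  have hE : (matE g q).mulVec η = 0 := by
    funext i
    have h4 : dirD ((0, η, ζ) : XYZ n) (dirD (inX n (EuclideanSpace.single i 1)) g) q = 0 := by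
      have h5 : (fun p => gX g p i) =ᶠ[𝓝 q] dirD (inX n (EuclideanSpace.single i 1)) g := by
        filter_upwards [hg2.eventually (by simp)] with p hp
        exact gX_apply (hp.differentiableAt (by norm_num)) i
      rw [← (dirD_congr h5 _).eq_of_nhds]
      have h6 : HasFDerivAt (fun p => gX g p i)
          ((EuclideanSpace.proj (𝕜 := ℝ) i : Eu n →L[ℝ] ℝ).comp (fderiv ℝ (gX g) q)) q :=
        (EuclideanSpace.proj (𝕜 := ℝ) i : Eu n →L[ℝ] ℝ).hasFDerivAt.comp q
          hgX.hasFDerivAt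
      rw [dirD, h6.fderiv, ContinuousLinearMap.comp_apply, h3, map_zero]
    set f := dirD (inX n (EuclideanSpace.single i (1 : ℝ))) g with hf
    rw [hsplit] at h4
    have h5 : dirD (inY n η + ζ • inZ n 1) f q = dirD (inY n η) f q + ζ * dirD (inZ n 1) f q := by
      simp [dirD]
    rw [h5, hζ] at h4
    have h6 : ∀ f : XYZ n → ℝ, dirD (inY n η) f q =
        ∑ j, η j * dirD (inY n (EuclideanSpace.single j 1)) f q := fun f => by
      rw [inY_eq_sum, dirD_sum_dir]; rfl
    rw [h6 f, h6 g] at h4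
    simp only [Matrix.mulVec, dotProduct, matE_apply hg2, Pi.zero_apply]
    rw [← h4, Finset.mul_sum, ← Finset.sum_neg_distrib, Finset.sum_mul, ← Finset.sum_add_distrib]
    exact Finset.sum_congr rfl fun j _ => by ring
  have hη : η = 0 := by
    have := Matrix.eq_zero_of_mulVec_eq_zero (hG.det_matE_ne_zero hq) hE
    ext i; exact congrFun this i
  subst hη
  have : dirD (inY n (0 : Eu n)) g q = 0 := by simp [dirD]
  rw [this] at hζ
  simp [hζ]

theorem SolvesYZ.mem (hG : IsGenerating U V I J g) {q : XYZ n} (hq : q ∈ Gam U V I) :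
    YZ (Gam U V I) g (jetMap g q) = q.2 := by
  have hs : SolvesYZ (Gam U V I) g (jetMap g q) q.2 := ⟨hq, rfl, rfl⟩
  obtain ⟨r, hr, hun⟩ := hG.A1 (jetMap g q) ⟨q, hq, rfl⟩
  have h1 : SolvesYZ (Gam U V I) g (jetMap g q) (YZ (Gam U V I) g (jetMap g q)) :=
    Classical.epsilon_spec (p := SolvesYZ (Gam U V I) g (jetMap g q)) ⟨_, hs⟩
  rw [hun _ h1, hun _ hs]

theorem matA_jetMap (hG : IsGenerating U V I J g) {q : XYZ n} (hq : q ∈ Gam U V I) :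
    matA (Gam U V I) g (jetMap g q) = gXX g q := by
  rw [matA, SolvesYZ.mem hG hq]; rfl

/-- Both spaces have the same dimension, so the injective differential is invertible and the inverse
function theorem applies. -/
theorem IsGenerating.local_inverse (hG : IsGenerating U V I J g) {q : XYZ n}
    (hq : q ∈ Gam U V I) : ∃ ψ : Jet n → XYZ n, ContDiffAt ℝ 3 ψ (jetMap g q) ∧
      ψ (jetMap g q) = q ∧ ∀ᶠ w in 𝓝 (jetMap g q), ψ w ∈ Gam U V I ∧ jetMap g (ψ w) = w := by
  have hC := hG.contDiffAt_jetMap hq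
  set e : XYZ n ≃ₗ[ℝ] Jet n := LinearEquiv.ofInjectiveOfFinrankEq
    (fderiv ℝ (jetMap g) q).toLinearMap (hG.fderiv_jetMap_injective hq)
    (by simp [Module.finrank_prod, add_comm]) with he
  have hD : HasFDerivAt (jetMap g) ((e.toContinuousLinearEquiv : XYZ n ≃L[ℝ] Jet n) :
      XYZ n →L[ℝ] Jet n) q := by
    have h1 : ((e.toContinuousLinearEquiv : XYZ n ≃L[ℝ] Jet n) : XYZ n →L[ℝ] Jet n) =
        fderiv ℝ (jetMap g) q := by
      exact ContinuousLinearMap.ext fun v => rfl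
    rw [h1]
    exact (hC.differentiableAt (by norm_num)).hasFDerivAt
  refine ⟨hC.localInverse hD (by norm_num), hC.to_localInverse hD (by norm_num),
    hC.localInverse_apply_image hD (by norm_num), ?_⟩
  have h1 := (hC.hasStrictFDerivAt' hD (by norm_num)).eventually_right_inverse
  have h2 := (hC.to_localInverse hD (by norm_num)).continuousAt
  have h3 : Gam U V I ∈ 𝓝 (hC.localInverse hD (by norm_num) (jetMap g q)) := by
    rw [hC.localInverse_apply_image hD (by norm_num)]
    exact hG.domΓ.1.mem_nhds hq
  filter_upwards [h1, h2.eventually h3] with w hw1 hw2 using ⟨hw2, hw1⟩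

theorem IsGenerating.isOpen_jetSet (hG : IsGenerating U V I J g) :
    IsOpen (jetSet (Gam U V I) g) := by
  rw [isOpen_iff_mem_nhds]
  rintro _ ⟨q, hq, rfl⟩
  obtain ⟨ψ, -, -, h⟩ := hG.local_inverse hq
  filter_upwards [h] with w hw using ⟨ψ w, hw.1, hw.2⟩

/-- Locally A is g_xx composed with a smooth inverse of the jet map; A1 guarantees that the chosen
pair (Y, Z) agrees with that inverse. Two of the four derivatives of g are left. -/
theorem IsGenerating.contDiffAt_matA (hG : IsGenerating U V I J g) {w : Jet n}
    (hw : w ∈ jetSet (Gam U V I) g) : ContDiffAt ℝ 2 (matA (Gam U V I) g) w := by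
  obtain ⟨q, hq, rfl⟩ := hw
  obtain ⟨ψ, h1, h2, h3⟩ := hG.local_inverse hq
  have h4 : ContDiffAt ℝ 2 (gXX g) (ψ (jetMap g q)) := by
    rw [h2]; exact contDiffAt_gXX (hG.contDiffAt hq)
  refine (h4.comp _ (h1.of_le (by norm_num))).congr_of_eventuallyEq ?_
  filter_upwards [h3] with w hw
  rw [Function.comp, ← matA_jetMap hG hw.1, hw.2]

theorem norm_apply_vec_le (ξ η : Eu n) (hξ : ‖ξ‖ ≤ 1) (hη : ‖η‖ ≤ 1) :
    ‖ContinuousMultilinearMap.apply ℝ (fun _ : Fin 2 => Eu n) ℝ ![ξ, η]‖ ≤ 1 := by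
  refine ContinuousLinearMap.opNorm_le_bound _ zero_le_one fun f => ?_
  refine (f.le_opNorm _).trans ?_
  rw [mul_comm]
  refine mul_le_mul_of_nonneg_right ?_ (norm_nonneg _)
  simp only [Fin.prod_univ_two, Matrix.cons_val_zero, Matrix.cons_val_one]
  exact mul_le_one₀ hξ (norm_nonneg _) hη

/-- The scalar coefficients `A_{ij} ξ_i η_j`. -/
noncomputable def coefA (Γ : Set (XYZ n)) (g : XYZ n → ℝ) (ξ η : Eu n) (w : Jet n) : ℝ := matA Γ g w ![ξ, η]

theorem norm_iteratedFDeriv_le_of_ckNorm_le {X Y : Type*} [NormedAddCommGroup X]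
    [NormedSpace ℝ X] [NormedAddCommGroup Y] [NormedSpace ℝ Y] {k : ℕ} {S : Set X} {f : X → Y}
    {K : ℝ} (h : ckNorm k S f ≤ ENNReal.ofReal K) {j : ℕ} (hj : j ≤ k) {x : X} (hx : x ∈ S) :
    ‖iteratedFDeriv ℝ j f x‖ ≤ max K 0 := by
  have h1 : ‖iteratedFDeriv ℝ j f x‖ₑ ≤ ckNorm k S f :=
    (le_iSup₂ (f := fun x (_ : x ∈ S) => ‖iteratedFDeriv ℝ j f x‖ₑ) x hx).trans
      (Finset.single_le_sum (f := fun j => ⨆ x ∈ S, ‖iteratedFDeriv ℝ j f x‖ₑ)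
        (fun _ _ => zero_le) (Finset.mem_range.2 (Nat.lt_succ_of_le hj)))
  have h2 := h1.trans h
  rw [← ofReal_norm, ENNReal.ofReal_le_ofReal_iff'] at h2
  rcases h2 with h2 | h2
  · exact h2.trans (le_max_left _ _)
  · exact h2.trans (le_max_right _ _)

/-- Evaluating the tensor A at two vectors of norm at most 1 is a linear map of norm at most 1, so
the scalar coefficients inherit the bounds of A. The maximum with 0 is there because
`ENNReal.ofReal` truncates a negative K. -/
theorem IsGenerating.coefBounds (hG : IsGenerating U V I J g) (h3 : A3w (Gam U V I) g) {K : ℝ}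
    (hK : ckNorm 2 (jetSet (Gam U V I) g) (matA (Gam U V I) g) ≤ ENNReal.ofReal K) :
    CoefBounds (jetSet (Gam U V I) g) (coefA (Gam U V I) g) (max K 0) := by
  set 𝒰 := jetSet (Gam U V I) g with h𝒰
  set A := matA (Gam U V I) g with hA
  have hcomp : ∀ ξ η, coefA (Gam U V I) g ξ η =
      ContinuousMultilinearMap.apply ℝ (fun _ : Fin 2 => Eu n) ℝ ![ξ, η] ∘ A := fun ξ η => rfl
  have hnorm : ∀ w ∈ 𝒰, ∀ ξ η : Eu n, ‖ξ‖ ≤ 1 → ‖η‖ ≤ 1 → ∀ j ≤ 2,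
      ‖iteratedFDeriv ℝ j (coefA (Gam U V I) g ξ η) w‖ ≤ max K 0 := by
    intro w hw ξ η hξ hη j hj
    rw [hcomp]
    refine (ContinuousLinearMap.norm_iteratedFDeriv_comp_left _ (hG.contDiffAt_matA hw)
      (by exact_mod_cast hj)).trans ?_
    have h1 := norm_iteratedFDeriv_le_of_ckNorm_le hK hj hw
    exact (mul_le_of_le_one_left (norm_nonneg _) (norm_apply_vec_le ξ η hξ hη)).trans h1
  have hcd : ∀ w ∈ 𝒰, ∀ ξ η, ContDiffAt ℝ 2 (coefA (Gam U V I) g ξ η) w := fun w hw ξ η =>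
    (ContinuousMultilinearMap.apply ℝ (fun _ : Fin 2 => Eu n) ℝ ![ξ, η]).contDiff.contDiffAt.comp
      w (hG.contDiffAt_matA hw)
  refine ⟨hG.isOpen_jetSet, fun ξ η w hw => (hcd w hw ξ η).contDiffWithinAt, fun w => ?_, ?_, ?_,
    ?_, ?_, ?_⟩
  · have u0 : ∀ a b c : Eu n, Function.update ![a, b] 0 c = ![c, b] := fun a b c => by
      funext i; fin_cases i <;> rfl
    have u1 : ∀ a b c : Eu n, Function.update ![a, b] 1 c = ![a, c] := fun a b c => by
      funext i; fin_cases i <;> rfl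
    refine ⟨LinearMap.mk₂ ℝ (fun ξ η => A w ![ξ, η]) ?_ ?_ ?_ ?_, fun ξ η => rfl⟩
    · intro a b c
      have := (A w).map_update_add ![a, c] 0 a b
      rwa [u0, u0, u0] at this
    · intro r a b
      have := (A w).map_update_smul ![a, b] 0 r a
      rwa [u0, u0] at this
    · intro a b c
      have := (A w).map_update_add ![a, b] 1 b c
      rwa [u1, u1, u1] at this
    · intro r a b
      have := (A w).map_update_smul ![a, b] 1 r b
      rwa [u1, u1] at this
  · rintro _ ⟨q, hq, rfl⟩ ξ η
    have h1 : matA (Gam U V I) g (q.1, g q, gX g q) = gXX g q := matA_jetMap hG hq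
    have hg := hG.contDiffAt_two hq
    simp only [coefA, h1]
    rw [gXX_apply hg, gXX_apply hg, dirD_comm hg]
  · intro w hw ξ η hξ hη
    have := hnorm w hw ξ η hξ hη 0 (by norm_num)
    rwa [norm_iteratedFDeriv_zero, Real.norm_eq_abs] at this
  · intro w hw ξ η hξ hη
    have := hnorm w hw ξ η hξ hη 1 (by norm_num)
    rwa [norm_iteratedFDeriv_one] at this
  · intro w hw ξ η hξ hη
    have := hnorm w hw ξ η hξ hη 2 (by norm_num)
    rwa [← norm_iteratedFDeriv_fderiv, norm_iteratedFDeriv_one] at this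
  · intro w hw ξ η hξ hξη
    rcases eq_or_ne η 0 with rfl | hη
    · have : ((0, 0, 0) : Jet n) = 0 := rfl
      rw [this]; simp
    -- A3w is stated for unit vectors; homogeneity extends it to all η orthogonal to ξ.
    set r := ‖η‖ with hr
    have hr0 : r ≠ 0 := norm_ne_zero_iff.2 hη
    set e := r⁻¹ • η with he
    have he1 : ‖e‖ = 1 := by rw [he, norm_smul, norm_inv, norm_norm, ← hr, inv_mul_cancel₀ hr0]
    have hηe : η = r • e := by rw [he, smul_inv_smul₀ hr0]
    have h1 := h3 w hw ξ e hξ he1 (by rw [he, inner_smul_right, hξη, mul_zero])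
    set ι : Eu n →L[ℝ] Jet n := (ContinuousLinearMap.inr ℝ (Eu n) (ℝ × Eu n)).comp
      (ContinuousLinearMap.inr ℝ ℝ (Eu n)) with hι
    have hj : ∀ p, HasFDerivAt (fun p : Eu n => ((w.1, w.2.1, p) : Jet n)) ι p := by
      intro p
      have h : ι = (0 : Eu n →L[ℝ] Eu n).prod
        ((0 : Eu n →L[ℝ] ℝ).prod (ContinuousLinearMap.id ℝ (Eu n))) := rfl
      rw [h]
      exact (hasFDerivAt_const w.1 p).prodMk
        ((hasFDerivAt_const w.2.1 p).prodMk (hasFDerivAt_id p))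
    have hA2 : ContDiffAt ℝ 2 A w := hG.contDiffAt_matA hw
    rw [iteratedFDeriv_two_eq_dirD (ContDiffAt.slice (f := A)
      (j := fun p : Eu n => ((w.1, w.2.1, p) : Jet n)) (by exact hA2) (by fun_prop)),
      dirD₂_slice (f := A) (j := fun p : Eu n => ((w.1, w.2.1, p) : Jet n)) hj (by exact hA2)] at h1
    have hιe : ι e = (0, 0, e) := rfl
    have h2 : dirD (ι e) (dirD (ι e) (coefA (Gam U V I) g ξ ξ)) w =
        (dirD (ι e) (dirD (ι e) A) w) ![ξ, ξ] := by
      set L := ContinuousMultilinearMap.apply ℝ (fun _ : Fin 2 => Eu n) ℝ ![ξ, ξ] with hL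
      have h4 : dirD (ι e) (coefA (Gam U V I) g ξ ξ) =ᶠ[𝓝 w] fun y => L (dirD (ι e) A y) := by
        filter_upwards [hA2.eventually (by simp)] with y hy
        have := L.hasFDerivAt.comp y (hy.differentiableAt (by norm_num)).hasFDerivAt
        simp only [dirD, hcomp, ← hL, this.fderiv]; rfl
      have h5 : DifferentiableAt ℝ (dirD (ι e) A) w := (contDiffAt_dirD (k := 1) (l := 2)
        (by exact_mod_cast hA2) le_rfl _).differentiableAt (by norm_num)
      have h6 := L.hasFDerivAt.comp w h5.hasFDerivAt
      rw [(dirD_congr h4 _).eq_of_nhds]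
      change fderiv ℝ (L ∘ dirD (ι e) A) w (ι e) = _
      rw [h6.fderiv]; rfl
    have h7 : 0 ≤ fderiv ℝ (fderiv ℝ (coefA (Gam U V I) g ξ ξ)) w (0, 0, e) (0, 0, e) := by
      rw [← hιe, ← dirD_dirD (hcd w hw ξ ξ), h2]; exact h1
    have h8 : ((0, 0, η) : Jet n) = r • (0, 0, e) := by rw [hηe]; simp
    rw [h8]
    simp only [map_smul, smul_apply, smul_eq_mul]
    rw [← mul_assoc]
    exact mul_nonneg (mul_self_nonneg r) h7

end Generating
end GJE

namespace GJE

/-! ### Comparison of u with the functions g(·, y, z) -/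

section Comparison

variable {n : ℕ} {U V : Set (Eu n)} {I : Eu n → Eu n → Set ℝ} {J : Set ℝ} {g : XYZ n → ℝ}

theorem IsGenerating.mem_of_le_of_le (hG : IsGenerating U V I J g) {x y : Eu n} {z₁ z z₂ : ℝ}
    (h₁ : (x, y, z₁) ∈ Gam U V I) (h₂ : (x, y, z₂) ∈ Gam U V I) (hz₁ : z₁ ≤ z) (hz₂ : z ≤ z₂) :
    (x, y, z) ∈ Gam U V I :=
  ⟨h₁.1, h₁.2.1, (hG.intI x h₁.1 y h₁.2.1).2.1.out h₁.2.2 h₂.2.2 ⟨hz₁, hz₂⟩⟩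

/-- The mean value inequality in z; the whole segment stays in Γ because I_{x,y} is an interval. It
yields both the height bound Λh and the depth λ(1 - τ)h. -/
theorem IsGenerating.sub_bounds (hG : IsGenerating U V I J g) {lam Lam : ℝ}
    (hB : StructureBounds (Gam U V I) g lam Lam) {x y : Eu n} {z₁ z₂ : ℝ}
    (h₁ : (x, y, z₁) ∈ Gam U V I) (h₂ : (x, y, z₂) ∈ Gam U V I) (hz : z₁ ≤ z₂) :
    lam * (z₂ - z₁) ≤ g (x, y, z₁) - g (x, y, z₂) ∧
      g (x, y, z₁) - g (x, y, z₂) ≤ Lam * (z₂ - z₁) := by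
  have hd : ∀ t ∈ Icc z₁ z₂, HasDerivAt (fun t => -g (x, y, t)) (-gZ g (x, y, t)) t :=
    fun t ht => (hasDerivAt_gZ (hG.differentiableAt (hG.mem_of_le_of_le h₁ h₂ ht.1 ht.2))).neg
  have hc : ContinuousOn (fun t => -g (x, y, t)) (Icc z₁ z₂) :=
    fun t ht => (hd t ht).continuousAt.continuousWithinAt
  have hdi : DifferentiableOn ℝ (fun t => -g (x, y, t)) (interior (Icc z₁ z₂)) :=
    fun t ht => (hd t (interior_subset ht)).differentiableAt.differentiableWithinAt
  have hb : ∀ t ∈ interior (Icc z₁ z₂), lam ≤ deriv (fun t => -g (x, y, t)) t ∧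
      deriv (fun t => -g (x, y, t)) t ≤ Lam := by
    intro t ht
    have ht' := interior_subset ht
    rw [(hd t ht').deriv]
    have := hB _ (hG.mem_of_le_of_le h₁ h₂ ht'.1 ht'.2)
    exact ⟨this.1, this.2.1⟩
  have e1 := (convex_Icc z₁ z₂).mul_sub_le_image_sub_of_le_deriv hc hdi (fun t ht => (hb t ht).1)
    z₁ (left_mem_Icc.2 hz) z₂ (right_mem_Icc.2 hz) hz
  have e2 := (convex_Icc z₁ z₂).image_sub_le_mul_sub_of_deriv_le hc hdi (fun t ht => (hb t ht).2)
    z₁ (left_mem_Icc.2 hz) z₂ (right_mem_Icc.2 hz) hz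
  constructor <;> linarith

theorem jet_section (x y : Eu n) (ζ : ℝ) :
    jet (fun x => g (x, y, ζ)) x = jetMap g (x, y, ζ) := rfl

theorem IsGenerating.contDiffAt_section (hG : IsGenerating U V I J g) {x y : Eu n} {ζ : ℝ}
    (h : (x, y, ζ) ∈ Gam U V I) : ContDiffAt ℝ 4 (fun x => g (x, y, ζ)) x :=
  ContDiffAt.slice (f := g) (j := fun x => (x, y, ζ)) (hG.contDiffAt h) (by fun_prop)

theorem IsGenerating.dirD₂_section (hG : IsGenerating U V I J g) {x y : Eu n} {ζ : ℝ}
    (h : (x, y, ζ) ∈ Gam U V I) (ξ η : Eu n) :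
    dirD ξ (dirD η fun x => g (x, y, ζ)) x =
      coefA (Gam U V I) g ξ η (jet (fun x => g (x, y, ζ)) x) := by
  rw [← iteratedFDeriv_two_eq_dirD ((hG.contDiffAt_section h).of_le (by norm_num)), coefA,
    jet_section, matA_jetMap hG h]
  rfl

theorem jet_eq_of_dirD_eq {u w : Eu n → ℝ} {x : Eu n} (h : ∀ ξ, dirD ξ u x = dirD ξ w x)
    (h0 : u x = w x) : jet u x = jet w x := by
  have : ∇ u x = ∇ w x := ext_inner_left ℝ fun ξ => by rw [inner_gradient, inner_gradient, h]
  rw [jet, jet, h0, this]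

/-- At a contact point the one-jets coincide, so A takes the same value for both functions. The
Hessian of g(·, y, ζ) equals that value, and the augmented Hessian is just the difference of the two
Hessians. -/
theorem augHess_nonpos_of_touch_above (hG : IsGenerating U V I J g) {u : Eu n → ℝ} {x y : Eu n}
    {ζ : ℝ} (hu : ContDiffAt ℝ 2 u x) (h : (x, y, ζ) ∈ Gam U V I) (h0 : u x = g (x, y, ζ))
    (hmax : ∀ᶠ x' in 𝓝 x, u x' ≤ g (x', y, ζ)) (ξ : Eu n) :
    augHess (coefA (Gam U V I) g) u ξ ξ x ≤ 0 := by
  set w : Eu n → ℝ := fun x => g (x, y, ζ) with hw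
  have hw2 : ContDiffAt ℝ 2 w x := (hG.contDiffAt_section h).of_le (by norm_num)
  have hm : IsLocalMax (fun x => u x + (-1) * w x) x := by
    filter_upwards [hmax] with x' hx'
    rw [h0]
    change _ ≤ w x + (-1) * w x
    change u x' ≤ w x' at hx'
    linarith
  have hw2' : ContDiffAt ℝ 2 (fun x => (-1) * w x) x := contDiffAt_const.mul hw2
  have key := dirD_dirD_nonpos_of_isLocalMax hm (hu.add hw2')
  have hd : ∀ ξ, dirD ξ u x = dirD ξ w x := by
    intro ξ
    have := (key ξ).1
    rw [dirD_add (hu.differentiableAt (by norm_num)) (hw2'.differentiableAt (by norm_num)),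
      dirD_const_mul (hw2.differentiableAt (by norm_num))] at this
    linarith
  have h2 := (key ξ).2
  rw [dirD₂_add hu hw2', dirD₂_const_mul hw2, hG.dirD₂_section h] at h2
  rw [augHess, jet_eq_of_dirD_eq hd h0]
  linarith

theorem augHess_nonneg_of_touch_below (hG : IsGenerating U V I J g) {u : Eu n → ℝ} {x y : Eu n}
    {ζ : ℝ} (hu : ContDiffAt ℝ 2 u x) (h : (x, y, ζ) ∈ Gam U V I) (h0 : u x = g (x, y, ζ))
    (hmin : ∀ᶠ x' in 𝓝 x, g (x', y, ζ) ≤ u x') (ξ : Eu n) :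
    0 ≤ augHess (coefA (Gam U V I) g) u ξ ξ x := by
  set w : Eu n → ℝ := fun x => g (x, y, ζ) with hw
  have hw2 : ContDiffAt ℝ 2 w x := (hG.contDiffAt_section h).of_le (by norm_num)
  have hm : IsLocalMax (fun x => w x + (-1) * u x) x := by
    filter_upwards [hmin] with x' hx'
    rw [h0]
    change _ ≤ w x + (-1) * w x
    change w x' ≤ u x' at hx'
    linarith
  have hu2' : ContDiffAt ℝ 2 (fun x => (-1) * u x) x := contDiffAt_const.mul hu
  have key := dirD_dirD_nonpos_of_isLocalMax hm (hw2.add hu2')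
  have hd : ∀ ξ, dirD ξ u x = dirD ξ w x := by
    intro ξ
    have := (key ξ).1
    rw [dirD_add (hw2.differentiableAt (by norm_num)) (hu2'.differentiableAt (by norm_num)),
      dirD_const_mul (hu.differentiableAt (by norm_num))] at this
    linarith
  have h2 := (key ξ).2
  rw [dirD₂_add hw2 hu2', dirD₂_const_mul hu, hG.dirD₂_section h] at h2
  rw [augHess, jet_eq_of_dirD_eq hd h0]
  linarith

theorem GConvex.augHess_nonneg (hG : IsGenerating U V I J g) {Ω : Set (Eu n)} {u : Eu n → ℝ}
    (hΩ : IsOpen Ω) (hc : GConvex (Gam U V I) J g Ω u) {x : Eu n} (hx : x ∈ Ω)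
    (hu : ContDiffAt ℝ 2 u x) (ξ : Eu n) : 0 ≤ augHess (coefA (Gam U V I) g) u ξ ξ x := by
  obtain ⟨y, z, h1, h2, h3, -⟩ := hc.2 x hx
  refine augHess_nonneg_of_touch_below hG hu (h1 x hx) h2 ?_ ξ
  filter_upwards [hΩ.mem_nhds hx] with x' hx'
  rcases eq_or_ne x' x with rfl | hne
  · exact h2.ge
  · exact h3 x' hx' hne

theorem matW_apply {Γ : Set (XYZ n)} {u : Eu n → ℝ} {x : Eu n} (hu : ContDiffAt ℝ 2 u x) :
    matW Γ g u x = Matrix.of fun i j => augHess (coefA Γ g) u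
      (EuclideanSpace.basisFun (Fin n) ℝ i) (EuclideanSpace.basisFun (Fin n) ℝ j) x := by
  ext i j
  simp only [matW, Matrix.of_apply, augHess, coefA, EuclideanSpace.basisFun_apply]
  rw [← iteratedFDeriv_two_eq_dirD hu]
  rfl

theorem augHess_symm {𝒰 : Set (Jet n)} {a : Eu n → Eu n → Jet n → ℝ} {K : ℝ}
    (ha : CoefBounds 𝒰 a K) {u : Eu n → ℝ} {x : Eu n} (hu : ContDiffAt ℝ 2 u x)
    (hx : jet u x ∈ 𝒰) (ξ η : Eu n) : augHess a u ξ η x = augHess a u η ξ x := by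
  rw [augHess, augHess, dirD_comm hu, ha.symm _ hx]

/-- By polarisation a symmetric form that vanishes on the diagonal vanishes, and the zero matrix of
positive size has determinant 0. -/
theorem det_augHess_eq_zero {𝒰 : Set (Jet n)} {a : Eu n → Eu n → Jet n → ℝ} {K : ℝ}
    (ha : CoefBounds 𝒰 a K) (hn : 0 < n) {u : Eu n → ℝ} {x : Eu n} (hu : ContDiffAt ℝ 2 u x)
    (hx : jet u x ∈ 𝒰) (h0 : ∀ ξ, augHess a u ξ ξ x = 0) :
    (Matrix.of fun i j => augHess a u (EuclideanSpace.basisFun (Fin n) ℝ i)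
      (EuclideanSpace.basisFun (Fin n) ℝ j) x).det = 0 := by
  obtain ⟨B, hB⟩ := augHess_bilin ha hu
  have h1 : ∀ ξ η, augHess a u ξ η x = 0 := by
    intro ξ η
    have e1 := h0 (ξ + η)
    have e2 := h0 ξ
    have e3 := h0 η
    have e4 := augHess_symm ha hu hx ξ η
    rw [hB] at *
    rw [hB] at e4
    simp only [map_add, LinearMap.add_apply] at e1
    linarith
  have : Nonempty (Fin n) := ⟨⟨0, hn⟩⟩
  have h2 : (Matrix.of fun i j => augHess a u (EuclideanSpace.basisFun (Fin n) ℝ i)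
      (EuclideanSpace.basisFun (Fin n) ℝ j) x) = 0 := by
    ext i j; simp [h1]
  rw [h2]; exact Matrix.det_zero

/-- The zero boundary values keep the superlevel set away from the frontier. -/
theorem isCompact_superlevel {E : Type*} [NormedAddCommGroup E] [NormedSpace ℝ E] [ProperSpace E]
    {Ω : Set E} (hΩ : IsOpen Ω) (hb : Bornology.IsBounded Ω) {w : E → ℝ}
    (hw : ContinuousOn w (closure Ω)) (h0 : ∀ x ∈ frontier Ω, w x = 0) {δ : ℝ} (hδ : 0 < δ) :
    IsCompact {x ∈ Ω | δ ≤ w x} := by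
  have h1 : {x ∈ Ω | δ ≤ w x} = closure Ω ∩ w ⁻¹' Ici δ := by
    ext x
    constructor
    · rintro ⟨hx, h⟩; exact ⟨subset_closure hx, h⟩
    · rintro ⟨hx, h⟩
      refine ⟨?_, h⟩
      by_contra hx'
      have := h0 x ⟨hx, by rwa [hΩ.interior_eq]⟩
      rw [mem_preimage, this, mem_Ici] at h
      linarith
  rw [h1]
  exact hb.isCompact_closure.of_isClosed_subset
    (hw.preimage_isClosed_of_isClosed isClosed_closure isClosed_Ici) inter_subset_left

theorem IsGenerating.continuousOn_section (hG : IsGenerating U V I J g) {Ω : Set (Eu n)}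
    {y : Eu n} {ζ : ℝ} (h : ∀ x ∈ Ω, (x, y, ζ) ∈ Gam U V I) :
    ContinuousOn (fun x => g (x, y, ζ)) (closure Ω) := by
  refine hG.smooth.2.1.comp (f := fun x => (x, y, ζ)) (by fun_prop) ?_
  exact MapsTo.closure (fun x hx => h x hx) (by fun_prop)

theorem IsGenerating.isBounded_of_section (hG : IsGenerating U V I J g) {Ω : Set (Eu n)}
    {y : Eu n} {ζ : ℝ} (h : ∀ x ∈ Ω, (x, y, ζ) ∈ Gam U V I) : Bornology.IsBounded Ω := by
  refine (hG.bddΓ.image_fst).subset fun x hx => ⟨_, h x hx, rfl⟩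

/-- A `g`-convex solution lies below the function `g(·, y, ζ)` that has the same boundary
values. -/
theorem GConvex.lt_section (hG : IsGenerating U V I J g) {lam Lam : ℝ} (hlam : 0 < lam)
    (hB : StructureBounds (Gam U V I) g lam Lam) {K : ℝ}
    (ha : CoefBounds (jetSet (Gam U V I) g) (coefA (Gam U V I) g) K) (hn : 0 < n)
    {Ω : Set (Eu n)} {u : Eu n → ℝ} (hΩ : IsOpen Ω) (hΩU : Ω ⊆ U)
    (hu : ContDiffOn ℝ 4 u Ω) (hc : GConvex (Gam U V I) J g Ω u) {f₀ : ℝ} (hf₀ : 0 < f₀)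
    (hsol : SolvesMATE (Gam U V I) g Ω u f₀) {y : Eu n} {ζ : ℝ}
    (hΓ : ∀ x ∈ Ω, (x, y, ζ) ∈ Gam U V I) (hbd : ∀ x ∈ frontier Ω, u x = g (x, y, ζ))
    {x : Eu n} (hx : x ∈ Ω) : u x < g (x, y, ζ) := by
  have hu2 : ∀ x ∈ Ω, ContDiffAt ℝ 2 u x := fun x hx =>
    (hu.contDiffAt (hΩ.mem_nhds hx)).of_le (by norm_num)
  -- The number `s x` selects the member of the family z ↦ g(·, y, z) that passes through (x, u x).
  -- It exists because the g-supports force u to take values in J.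
  have hJ : ∀ x ∈ Ω, ∃ s, (x, y, s) ∈ Gam U V I ∧ g (x, y, s) = u x := by
    intro x hx
    obtain ⟨y', z', -, h2, -, h4⟩ := hc.2 x hx
    have h5 : u x ∈ J := by rw [h2]; exact h4 x (subset_closure hx)
    obtain ⟨s, hs, hsu⟩ := hG.rangeJ x (hΩU hx) y (hΓ x hx).2.1 h5
    exact ⟨s, ⟨hΩU hx, (hΓ x hx).2.1, hs⟩, hsu⟩
  choose! s hsΓ hsu using hJ
  by_contra! hlt
  have hmono : ∀ {x : Eu n} {z₁ z₂ : ℝ}, (x, y, z₁) ∈ Gam U V I → (x, y, z₂) ∈ Gam U V I →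
      z₁ ≤ z₂ → lam * (z₂ - z₁) ≤ g (x, y, z₁) - g (x, y, z₂) := fun h1 h2 h =>
    (hG.sub_bounds hB h1 h2 h).1
  have hsle : ∀ x ∈ Ω, ∀ z, (x, y, z) ∈ Gam U V I → u x ≤ g (x, y, z) → z ≤ s x := by
    intro x hx z hz h
    by_contra! hlt
    have := hmono (hsΓ x hx) hz hlt.le
    rw [hsu x hx] at this
    nlinarith
  have hsge : ∀ x ∈ Ω, ∀ z, (x, y, z) ∈ Gam U V I → g (x, y, z) ≤ u x → s x ≤ z := by
    intro x hx z hz h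
    by_contra! hlt
    have := hmono hz (hsΓ x hx) hlt.le
    rw [hsu x hx] at this
    nlinarith
  have hsx : s x ≤ ζ := hsge x hx ζ (hΓ x hx) hlt
  have hlsc : LowerSemicontinuousOn s Ω := by
    intro x hx t ht
    obtain ⟨t', ht1, ht2, ht3⟩ : ∃ t', t < t' ∧ t' < s x ∧ (x, y, t') ∈ Gam U V I := by
      have h1 : ∀ᶠ t' in 𝓝[<] (s x), (x, y, t') ∈ Gam U V I := by
        have hct : Continuous fun t' : ℝ => ((x, y, t') : XYZ n) := by fun_prop
        exact (hct.continuousAt.eventually (hG.domΓ.1.mem_nhds (hsΓ x hx))).filter_mono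
          nhdsWithin_le_nhds
      obtain ⟨t', h⟩ := (h1.and (Ioo_mem_nhdsLT ht)).exists
      exact ⟨t', h.2.1, h.2.2, h.1⟩
    have hlt' : u x < g (x, y, t') := by
      have := hmono ht3 (hsΓ x hx) ht2.le
      rw [hsu x hx] at this
      nlinarith
    have hgc : ContinuousAt (fun x => g (x, y, t')) x := (hG.contDiffAt_section ht3).continuousAt
    have hΓx : ∀ᶠ x' in 𝓝 x, (x', y, t') ∈ Gam U V I := by
      have hct : Continuous fun x' : Eu n => ((x', y, t') : XYZ n) := by fun_prop
      exact hct.continuousAt.eventually (hG.domΓ.1.mem_nhds ht3)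
    refine nhdsWithin_le_nhds ?_
    filter_upwards [(hu2 x hx).continuousAt.eventually_lt hgc hlt', hΓx, hΩ.mem_nhds hx]
      with x' h1 h2 h3
    exact ht1.trans_le (hsle x' h3 t' h2 h1.le)
  -- If s < ζ somewhere, the relevant sublevel set of s lies in a compact set where u - g(·, y, ζ) ≥
  -- δ, and lower semicontinuity gives a minimum. Otherwise the given point x is already a minimum.
  obtain ⟨x₁, hx₁, hmin, hs₁⟩ : ∃ x₁ ∈ Ω, (∀ x' ∈ Ω, s x₁ ≤ s x') ∧ s x₁ ≤ ζ := by
    by_cases hex : ∃ x' ∈ Ω, s x' < ζ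
    · obtain ⟨x₂, hx₂, hs₂⟩ := hex
      set δ := lam * (ζ - s x₂) with hδ
      have hδ0 : 0 < δ := mul_pos hlam (by linarith)
      have hD : ∀ x' ∈ Ω, s x' ≤ s x₂ → δ ≤ u x' - g (x', y, ζ) := by
        intro x' hx' h
        have := hmono (hsΓ x' hx') (hΓ x' hx') (h.trans hs₂.le)
        rw [hsu x' hx'] at this
        nlinarith
      have hcomp : IsCompact {x' ∈ Ω | δ ≤ u x' - g (x', y, ζ)} :=
        isCompact_superlevel hΩ (hG.isBounded_of_section hΓ)
          (w := fun x => u x - g (x, y, ζ)) (hc.1.sub (hG.continuousOn_section hΓ))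
          (fun x' hx' => by simp [hbd x' hx']) hδ0
      obtain ⟨x₁, hx₁, hm⟩ := LowerSemicontinuousOn.exists_isMinOn
        (s := {x' ∈ Ω | δ ≤ u x' - g (x', y, ζ)}) ⟨x₂, hx₂, hD x₂ hx₂ le_rfl⟩ hcomp
        (hlsc.mono fun x hx => hx.1)
      have h12 : s x₁ ≤ s x₂ := hm ⟨hx₂, hD x₂ hx₂ le_rfl⟩
      refine ⟨x₁, hx₁.1, fun x' hx' => ?_, h12.trans hs₂.le⟩
      rcases le_total (s x') (s x₂) with h | h
      · exact hm ⟨hx', hD x' hx' h⟩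
      · exact h12.trans h
    · push Not at hex
      exact ⟨x, hx, fun x' hx' => hsx.trans (hex x' hx'), hsx⟩
  have hΓx : ∀ᶠ x' in 𝓝 x₁, (x', y, s x₁) ∈ Gam U V I := by
    have hct : Continuous fun x' : Eu n => ((x', y, s x₁) : XYZ n) := by fun_prop
    exact hct.continuousAt.eventually (hG.domΓ.1.mem_nhds (hsΓ x₁ hx₁))
  -- By minimality of `s x₁` and monotonicity in z, the graph of g(·, y, s x₁) touches that of u
  -- from above at x₁. With g-convexity the augmented Hessian vanishes there, contradicting f₀ > 0.
  have hle : ∀ ξ, augHess (coefA (Gam U V I) g) u ξ ξ x₁ ≤ 0 := by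
    refine augHess_nonpos_of_touch_above hG (hu2 x₁ hx₁) (hsΓ x₁ hx₁) (hsu x₁ hx₁).symm ?_
    filter_upwards [hΓx, hΩ.mem_nhds hx₁] with x' h1 h2
    have := hmono h1 (hsΓ x' h2) (hmin x' h2)
    rw [hsu x' h2] at this
    nlinarith [hmin x' h2]
  have h0 : ∀ ξ, augHess (coefA (Gam U V I) g) u ξ ξ x₁ = 0 := fun ξ =>
    le_antisymm (hle ξ) (hc.augHess_nonneg hG hΩ hx₁ (hu2 x₁ hx₁) ξ)
  have := det_augHess_eq_zero ha hn (hu2 x₁ hx₁) (hsol x₁ hx₁).1 h0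
  rw [← matW_apply (hu2 x₁ hx₁), (hsol x₁ hx₁).2] at this
  linarith

end Comparison
end GJE

namespace GJE

/-! ### Inradius, gradient bounds and qualitative bounds -/

section Size

variable {n : ℕ} {𝒰 : Set (Jet n)} {a : Eu n → Eu n → Jet n → ℝ} {K : ℝ}

/-- If every eigenvalue were below min(m, 1), then all but one could be replaced by 1 and their
product would be less than m. -/
theorem exists_direction_ge (ha : CoefBounds 𝒰 a K) (hn : 0 < n) {u : Eu n → ℝ} {x : Eu n}
    (hu : ContDiffAt ℝ 2 u x) (hx : jet u x ∈ 𝒰) (hpos : ∀ ξ, 0 ≤ augHess a u ξ ξ x) {m : ℝ}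
    (hdet : m ≤ (Matrix.of fun i j => augHess a u (EuclideanSpace.basisFun (Fin n) ℝ i)
      (EuclideanSpace.basisFun (Fin n) ℝ j) x).det) :
    ∃ ξ : Eu n, ‖ξ‖ = 1 ∧ min m 1 ≤ augHess a u ξ ξ x := by
  obtain ⟨B, hB⟩ := augHess_bilin ha hu
  obtain ⟨b, w, hw⟩ := exists_diagonal_basis B
    (fun ξ η => by rw [← hB, ← hB, augHess_symm ha hu hx])
  have hwB : ∀ i, w i = augHess a u (b i) (b i) x := fun i => by rw [hB, hw, if_pos rfl]
  have hdet' : m ≤ ∏ i, w i := by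
    simp only [hB] at hdet
    rw [det_bilin_eq B _ b] at hdet
    have : (Matrix.of fun i j => B (b i) (b j)) = Matrix.diagonal w := by
      ext i j; rw [Matrix.of_apply, hw, Matrix.diagonal_apply]
    rwa [this, Matrix.det_diagonal] at hdet
  by_contra! hlt
  have hlt' : ∀ i, w i < min m 1 := fun i => by
    rw [hwB]; exact hlt (b i) (b.norm_eq_one i)
  have h0 : ∀ i, 0 ≤ w i := fun i => by rw [hwB]; exact hpos _
  have h1 : ∏ i, w i ≤ w ⟨0, hn⟩ := by
    rw [← Finset.mul_prod_erase _ _ (Finset.mem_univ (⟨0, hn⟩ : Fin n))]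
    exact mul_le_of_le_one_right (h0 _)
      (Finset.prod_le_one (fun i _ => h0 i) fun i _ => ((hlt' i).trans_le (min_le_right _ _)).le)
  exact absurd ((hlt' ⟨0, hn⟩).trans_le (min_le_left _ _)) (not_lt.2 (hdet'.trans h1))

/-- The radius of a ball in the domain of a solution is controlled by the height of the solution
below the function with the same boundary values. -/
theorem sq_radius_le (ha : CoefBounds 𝒰 a K) (hn : 0 < n) (hK : 0 ≤ K) {Ω : Set (Eu n)}
    (hΩ : IsOpen Ω) {u u₀ : Eu n → ℝ} {f₀ m : ℝ} (hm : 0 < m) (hmf : m ≤ f₀)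
    (hu : ContDiffOn ℝ 2 u Ω) (hu₀ : ContDiffOn ℝ 2 u₀ Ω) (hj : ∀ x ∈ Ω, jet u x ∈ 𝒰)
    (hpos : ∀ x ∈ Ω, ∀ ξ, 0 ≤ augHess a u ξ ξ x)
    (hdet : ∀ x ∈ Ω, (Matrix.of fun i j => augHess a u (EuclideanSpace.basisFun (Fin n) ℝ i)
      (EuclideanSpace.basisFun (Fin n) ℝ j) x).det = f₀)
    (hu₀eq : ∀ x ∈ Ω, ∀ ξ, dirD ξ (dirD ξ u₀) x = a ξ ξ (jet u₀ x))
    (hj1 : ∀ x ∈ Ω, ∀ q ∈ segment ℝ (∇ u x) (∇ u₀ x), (x, u x, q) ∈ 𝒰)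
    (hj2 : ∀ x ∈ Ω, ∀ r ∈ segment ℝ (u x) (u₀ x), (x, r, ∇ u₀ x) ∈ 𝒰) {L h : ℝ}
    (hv : ∀ x ∈ Ω, u x ≤ u₀ x) (hvL : ∀ x ∈ Ω, u₀ x - u x ≤ L * h) (hL : 0 ≤ L) (hh : 0 < h)
    (hh1 : h ≤ 1) (hsmall : K * (2 * L + 2 * K) * √h ≤ min m 1 / 2) {x₀ : Eu n} {ρ : ℝ}
    (hρ : √h ≤ ρ) (hball : Metric.closedBall x₀ (2 * ρ) ⊆ Ω) :
    min m 1 / 8 * ρ ^ 2 ≤ L * h := by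
  set v : Eu n → ℝ := fun x => u x + (-1) * u₀ x with hvdef
  have hs0 : 0 < √h := Real.sqrt_pos.2 hh
  have hs1 : √h ≤ 1 := Real.sqrt_le_one.2 hh1
  have hsq : √h * √h = h := Real.mul_self_sqrt hh.le
  have hρ0 : 0 < ρ := hs0.trans_le hρ
  have hux : ∀ x ∈ Ω, ContDiffAt ℝ 2 u x := fun x hx => hu.contDiffAt (hΩ.mem_nhds hx)
  have hu₀x : ∀ x ∈ Ω, ContDiffAt ℝ 2 u₀ x := fun x hx => hu₀.contDiffAt (hΩ.mem_nhds hx)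
  have hu₀x' : ∀ x ∈ Ω, ContDiffAt ℝ 2 (fun x => (-1) * u₀ x) x := fun x hx =>
    contDiffAt_const.mul (hu₀x x hx)
  have hvx : ∀ x ∈ Ω, ContDiffAt ℝ 2 v x := fun x hx => (hux x hx).add (hu₀x' x hx)
  have hj0 : ∀ x ∈ Ω, jet u₀ x ∈ 𝒰 := fun x hx => hj2 x hx _ (right_mem_segment _ _ _)
  have hd1 : ∀ x ∈ Ω, ∀ ξ, dirD ξ v x = inner ℝ ξ (∇ u x - ∇ u₀ x) := by
    intro x hx ξ
    rw [hvdef, dirD_add ((hux x hx).differentiableAt (by norm_num))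
      ((hu₀x' x hx).differentiableAt (by norm_num)),
      dirD_const_mul ((hu₀x x hx).differentiableAt (by norm_num)), inner_sub_right,
      inner_gradient, inner_gradient]
    ring
  have hd2 : ∀ x ∈ Ω, ∀ ξ, dirD ξ (dirD ξ v) x =
      augHess a u ξ ξ x + (a ξ ξ (jet u x) - a ξ ξ (jet u₀ x)) := by
    intro x hx ξ
    rw [hvdef, dirD₂_add (hux x hx) (hu₀x' x hx), dirD₂_const_mul (hu₀x x hx), hu₀eq x hx, augHess]
    ring
  have hlow : ∀ x ∈ Ω, ∀ ξ : Eu n, ‖ξ‖ = 1 → -(2 * K) ≤ dirD ξ (dirD ξ v) x := by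
    intro x hx ξ hξ
    rw [hd2 x hx]
    have e1 := abs_le.1 (ha.bound _ (hj x hx) ξ ξ hξ.le hξ.le)
    have e2 := abs_le.1 (ha.bound _ (hj0 x hx) ξ ξ hξ.le hξ.le)
    linarith [hpos x hx ξ, e1.1, e2.2]
  -- A step of length √h, which stays in the ball of radius 2ρ because √h ≤ ρ: v only varies within
  -- [-Lh, 0] and its second derivatives are at least -2K, so no slope can exceed (L + 2K)√h.
  have hgrad : ∀ x ∈ Metric.closedBall x₀ ρ, ∀ ξ : Eu n, ‖ξ‖ = 1 →
      dirD ξ v x ≤ (L + 2 * K) * √h := by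
    intro x hx ξ hξ
    have hin : ∀ t ∈ Icc (0 : ℝ) 1, x + t • (√h • ξ) ∈ Ω := by
      intro t ht
      apply hball
      rw [mem_closedBall_iff_norm] at hx ⊢
      calc ‖x + t • √h • ξ - x₀‖ = ‖(x - x₀) + t • √h • ξ‖ := by congr 1; abel
        _ ≤ ρ + t * √h := (norm_add_le _ _).trans (add_le_add hx (by
            rw [norm_smul, norm_smul, hξ, Real.norm_of_nonneg ht.1, Real.norm_of_nonneg hs0.le,
              mul_one]))
        _ ≤ 2 * ρ := by nlinarith [ht.2]
    have hxΩ : x ∈ Ω := by simpa using hin 0 ⟨le_rfl, zero_le_one⟩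
    have hsm : ∀ (f : Eu n → ℝ) (y : Eu n), dirD (√h • ξ) f y = √h * dirD ξ f y := fun f y => by
      simp [dirD]
    have hsm2 : ∀ y ∈ Ω, dirD (√h • ξ) (dirD (√h • ξ) v) y = h * dirD ξ (dirD ξ v) y := by
      intro y hy
      have : dirD (√h • ξ) v = fun y => √h * dirD ξ v y := funext (hsm v)
      rw [hsm, this, dirD_const_mul (differentiableAt_dirD (hvx y hy) ξ), ← mul_assoc, hsq]
    have key := taylor_lower_bound (f := fun t => v (x + t • (√h • ξ))) (c := 2 * K * h)
      (by positivity)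
      (fun t ht => hasDerivAt_line ((hvx _ (hin t ht)).differentiableAt (by norm_num)))
      (fun t ht => hasDerivAt_line (differentiableAt_dirD (hvx _ (hin t ht)) _))
      (fun t ht => by
        rw [hsm2 _ (hin t ht)]
        nlinarith [hlow _ (hin t ht) ξ hξ])
    simp only [zero_smul, add_zero, one_smul, hsm] at key
    have e1 : v (x + √h • ξ) ≤ 0 := by
      have := hv _ (by simpa using hin 1 ⟨zero_le_one, le_rfl⟩ : x + √h • ξ ∈ Ω)
      simp only [hvdef]; linarith
    have e2 : -(L * h) ≤ v x := by
      have := hvL x hxΩ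
      simp only [hvdef]; linarith
    have e3 : √h * dirD ξ v x ≤ √h * ((L + 2 * K) * √h) := by
      have : √h * ((L + 2 * K) * √h) = (L + 2 * K) * h := by linear_combination (L + 2 * K) * hsq
      rw [this]; linarith
    exact le_of_mul_le_mul_left e3 hs0
  have hnorm : ∀ x ∈ Metric.closedBall x₀ ρ, ‖∇ u x - ∇ u₀ x‖ ≤ (L + 2 * K) * √h := by
    intro x hx
    have hxΩ : x ∈ Ω := hball (Metric.closedBall_subset_closedBall (by linarith) hx)
    rcases eq_or_ne (∇ u x - ∇ u₀ x) 0 with h0 | h0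
    · rw [h0, norm_zero]; positivity
    · have := hgrad x hx (‖∇ u x - ∇ u₀ x‖⁻¹ • (∇ u x - ∇ u₀ x)) (norm_smul_inv_norm h0)
      rw [hd1 x hxΩ, inner_smul_left, real_inner_self_eq_norm_sq] at this
      have hne : ‖∇ u x - ∇ u₀ x‖ ≠ 0 := norm_ne_zero_iff.2 h0
      simp only [conj_trivial] at this
      rwa [sq, ← mul_assoc, inv_mul_cancel₀ hne, one_mul] at this
  have hκ : 0 < min m 1 := lt_min hm one_pos
  set κ := min m 1
  -- The subtracted paraboloid has second derivative κ/4 in every direction, while at each point of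
  -- the ball v has second derivative at least κ/2 in some direction. So φ has no interior maximum,
  -- and its maximum lies on the sphere.
  set φ : Eu n → ℝ := fun x => v x + (-(κ / 8)) * ‖x - x₀‖ ^ 2 with hφ
  have hq : ∀ x, ContDiffAt ℝ 2 (fun x : Eu n => ‖x - x₀‖ ^ 2) x := fun x =>
    (contDiffAt_id.sub contDiffAt_const).norm_sq ℝ
  have hq' : ∀ x, ContDiffAt ℝ 2 (fun x : Eu n => (-(κ / 8)) * ‖x - x₀‖ ^ 2) x := fun x =>
    contDiffAt_const.mul (hq x)
  have hsub : Metric.closedBall x₀ ρ ⊆ Ω :=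
    (Metric.closedBall_subset_closedBall (by linarith)).trans hball
  have hφc : ContinuousOn φ (Metric.closedBall x₀ ρ) := fun x hx =>
    ((hvx x (hsub hx)).add (hq' x)).continuousAt.continuousWithinAt
  obtain ⟨x₁, hx₁, hmax⟩ := (isCompact_closedBall x₀ ρ).exists_isMaxOn
    ⟨x₀, Metric.mem_closedBall_self hρ0.le⟩ hφc
  have hx₁Ω := hsub hx₁
  have hsphere : ‖x₁ - x₀‖ = ρ := by
    refine le_antisymm (mem_closedBall_iff_norm.1 hx₁) ?_
    by_contra! hlt
    have hloc : IsLocalMax φ x₁ := by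
      filter_upwards [Metric.closedBall_mem_nhds_of_mem (mem_ball_iff_norm.2 hlt)] with y hy
        using hmax hy
    obtain ⟨ξ, hξ, hξw⟩ := exists_direction_ge ha hn (hux x₁ hx₁Ω) (hj x₁ hx₁Ω) (hpos x₁ hx₁Ω)
      (m := m) (by rw [hdet x₁ hx₁Ω]; exact hmf)
    have h2 := (dirD_dirD_nonpos_of_isLocalMax hloc ((hvx x₁ hx₁Ω).add (hq' x₁)) ξ).2
    rw [hφ, dirD₂_add (hvx x₁ hx₁Ω) (hq' x₁), dirD₂_const_mul (hq x₁),
      (dirD₂_norm_sq_sub x₀ x₁ ξ).2, hξ, hd2 x₁ hx₁Ω] at h2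
    have h3 := ha.abs_sub_le (hj1 x₁ hx₁Ω) (hj2 x₁ hx₁Ω) hξ.le hξ.le
    have h4 : |u x₁ - u₀ x₁| ≤ L * √h := by
      rw [abs_sub_comm, abs_of_nonneg (by linarith [hv x₁ hx₁Ω])]
      refine (hvL x₁ hx₁Ω).trans (mul_le_mul_of_nonneg_left ?_ hL)
      nlinarith
    have h5 : K * (|u x₁ - u₀ x₁| + ‖∇ u x₁ - ∇ u₀ x₁‖) ≤ κ / 2 := by
      refine le_trans (mul_le_mul_of_nonneg_left (add_le_add h4 (hnorm x₁ hx₁)) hK) ?_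
      linarith
    have h6 := (abs_le.1 (h3.trans h5)).1
    change -(κ / 2) ≤ a ξ ξ (jet u x₁) - a ξ ξ (jet u₀ x₁) at h6
    change κ ≤ _ at hξw
    linarith
  have hle := hmax (Metric.mem_closedBall_self hρ0.le)
  change φ x₀ ≤ φ x₁ at hle
  simp only [hφ, hvdef, sub_self, norm_zero, hsphere] at hle
  have e1 := hv x₁ hx₁Ω
  have e2 := hvL x₀ (hsub (Metric.mem_closedBall_self hρ0.le))
  linarith

theorem exists_exit {E : Type*} [NormedAddCommGroup E] [NormedSpace ℝ E] {Ω : Set E}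
    (hΩ : IsOpen Ω) (hb : Bornology.IsBounded Ω) {x : E} (hx : x ∈ Ω) {e : E} (he : e ≠ 0) :
    ∃ b : ℝ, 0 < b ∧ x + b • e ∈ frontier Ω ∧ ∀ s ∈ Ico 0 b, x + s • e ∈ Ω := by
  set S : Set ℝ := {t | 0 ≤ t ∧ x + t • e ∉ Ω} with hS
  have hcont : Continuous fun t : ℝ => x + t • e := by fun_prop
  have hSne : S.Nonempty := by
    obtain ⟨R, hR⟩ := hb.subset_closedBall x
    have he0 := norm_pos_iff.2 he
    refine ⟨(|R| + 1) / ‖e‖, by positivity, fun h => ?_⟩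
    have := hR h
    rw [mem_closedBall_iff_norm, add_sub_cancel_left, norm_smul, Real.norm_of_nonneg
      (by positivity), div_mul_cancel₀ _ he0.ne'] at this
    linarith [le_abs_self R]
  have hScl : IsClosed S := isClosed_Ici.inter (hΩ.isClosed_compl.preimage hcont)
  have hbdd : BddBelow S := ⟨0, fun t ht => ht.1⟩
  have hmem := hScl.csInf_mem hSne hbdd
  set b := sInf S
  have hb0 : 0 < b := by
    refine lt_of_le_of_ne hmem.1 fun h => hmem.2 ?_
    rw [← h]; simpa using hx
  have hin : ∀ s ∈ Ico 0 b, x + s • e ∈ Ω := by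
    intro s hs
    by_contra h
    exact absurd (csInf_le hbdd (⟨hs.1, h⟩ : s ∈ S)) (not_le.2 hs.2)
  refine ⟨b, hb0, ⟨?_, by rw [hΩ.interior_eq]; exact hmem.2⟩, hin⟩
  have h1 : b ∈ closure (Ico 0 b) := by
    rw [closure_Ico hb0.ne]; exact right_mem_Icc.2 hb0.le
  exact map_mem_closure (f := fun t : ℝ => x + t • e) hcont h1 hin

/-- Rolle's theorem on the chord of Ω through x in the direction e, at whose end points v vanishes.
-/
theorem exists_dirD_eq_zero {E : Type*} [NormedAddCommGroup E] [NormedSpace ℝ E] {Ω : Set E}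
    (hΩ : IsOpen Ω) (hb : Bornology.IsBounded Ω) {v : E → ℝ} (hv : ContinuousOn v (closure Ω))
    (hd : ∀ x ∈ Ω, DifferentiableAt ℝ v x) (h0 : ∀ x ∈ frontier Ω, v x = 0) {x : E} (hx : x ∈ Ω)
    {e : E} (he : e ≠ 0) :
    ∃ t : ℝ, dirD e v (x + t • e) = 0 ∧ segment ℝ x (x + t • e) ⊆ Ω := by
  obtain ⟨b, hb0, hbf, hbi⟩ := exists_exit hΩ hb hx he
  obtain ⟨c, hc0, hcf, hci⟩ := exists_exit hΩ hb hx (neg_ne_zero.2 he)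
  have hall : ∀ s ∈ Ioo (-c) b, x + s • e ∈ Ω := by
    intro s hs
    rcases le_total 0 s with h | h
    · exact hbi s ⟨h, hs.2⟩
    · have := hci (-s) ⟨by linarith, by linarith [hs.1]⟩
      simpa using this
  have hcont : ContinuousOn (fun s : ℝ => v (x + s • e)) (Icc (-c) b) := by
    refine hv.comp (by fun_prop) fun s hs => ?_
    have h1 : s ∈ closure (Ioo (-c) b) := by rwa [closure_Ioo (by linarith)]
    exact map_mem_closure (f := fun s : ℝ => x + s • e) (by fun_prop) h1 hall
  have hcf' : x + (-c) • e ∈ frontier Ω := by simpa using hcf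
  obtain ⟨t, ht, hvt⟩ := exists_hasDerivAt_eq_zero (by linarith) hcont
    (by rw [h0 _ hcf', h0 _ hbf])
    (fun s hs => hasDerivAt_line (hd _ (hall s hs)))
  refine ⟨t, hvt, ?_⟩
  intro y hy
  rw [segment_eq_image'] at hy
  obtain ⟨θ, hθ, rfl⟩ := hy
  have : x + θ • (x + t • e - x) = x + (θ * t) • e := by simp [smul_smul]
  change x + θ • (x + t • e - x) ∈ Ω
  rw [this]
  refine hall _ ⟨?_, ?_⟩
  · rcases le_total 0 t with h | h
    · nlinarith [hθ.1, mul_nonneg hθ.1 h]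
    · nlinarith [ht.1, hθ.2]
  · rcases le_total 0 t with h | h
    · nlinarith [ht.2, hθ.2]
    · nlinarith [mul_nonneg hθ.1 (neg_nonneg.2 h)]

/-- On the chord through x in a direction ξ there is a point where the ξ-derivatives of u and u₀
agree, hence are at most M in absolute value; the bound on D²u₀ carries this back to x. In this way
no bound on the gradient of g is needed. -/
theorem norm_gradient_sub_le {Ω : Set (Eu n)} (hΩ : IsOpen Ω) {d M : ℝ} (hK : 0 ≤ K)
    (hM0 : 0 ≤ M) (hd : ∀ x ∈ Ω, ∀ y ∈ Ω, ‖x - y‖ ≤ d) {u u₀ : Eu n → ℝ}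
    (hu : ContinuousOn u (closure Ω)) (hu₀ : ContinuousOn u₀ (closure Ω))
    (hud : ∀ x ∈ Ω, DifferentiableAt ℝ u x) (hu₀d : ∀ x ∈ Ω, ContDiffAt ℝ 2 u₀ x)
    (hbd : ∀ x ∈ frontier Ω, u x = u₀ x) (hM : ∀ x ∈ Ω, ‖∇ u x‖ ≤ M)
    (hD : ∀ x ∈ Ω, ∀ ξ : Eu n, ‖ξ‖ = 1 → |dirD ξ (dirD ξ u₀) x| ≤ K) {x : Eu n} (hx : x ∈ Ω) :
    ‖∇ u x - ∇ u₀ x‖ ≤ 2 * M + K * d := by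
  have hd0 : 0 ≤ d := by simpa using hd x hx x hx
  have hb : Bornology.IsBounded Ω := by
    rw [Metric.isBounded_iff]
    exact ⟨d, fun x hx y hy => by rw [dist_eq_norm]; exact hd x hx y hy⟩
  have key : ∀ ξ : Eu n, ‖ξ‖ = 1 → |dirD ξ u₀ x| ≤ M + K * d := by
    intro ξ hξ
    have hξ0 : ξ ≠ 0 := by rintro rfl; simp at hξ
    obtain ⟨t, ht, hseg⟩ := exists_dirD_eq_zero hΩ hb (v := fun x => u x + (-1) * u₀ x)
      (hu.add (continuousOn_const.mul hu₀))
      (fun x hx => (hud x hx).add (((hu₀d x hx).differentiableAt (by norm_num)).const_mul _))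
      (fun x hx => by simp [hbd x hx]) hx hξ0
    set y := x + t • ξ with hy
    have hyΩ : y ∈ Ω := hseg (right_mem_segment _ _ _)
    have hu₀y := (hu₀d y hyΩ).differentiableAt (by norm_num)
    rw [dirD_add (hud y hyΩ) (hu₀y.const_mul _), dirD_const_mul hu₀y] at ht
    have h1 : |dirD ξ u₀ y| ≤ M := by
      have : dirD ξ u₀ y = dirD ξ u y := by linarith
      rw [this, ← inner_gradient]
      refine (abs_real_inner_le_norm _ _).trans ?_
      rw [hξ, one_mul]; exact hM y hyΩ
    have h2 : |dirD ξ u₀ y - dirD ξ u₀ x| ≤ K * |t| := by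
      have h3 := (convex_uIcc 0 t).norm_image_sub_le_of_norm_hasDerivWithin_le
        (f := fun s => dirD ξ u₀ (x + s • ξ)) (f' := fun s => dirD ξ (dirD ξ u₀) (x + s • ξ))
        (C := K) (fun s hs => ?_) (fun s hs => ?_) left_mem_uIcc right_mem_uIcc
      · simpa using h3
      all_goals
        have hs' : x + s • ξ ∈ Ω := by
          apply hseg
          rw [hy, ← segment_eq_uIcc] at *
          obtain ⟨a, b, ha, hb, hab, rfl⟩ := hs
          refine ⟨a, b, ha, hb, hab, ?_⟩
          have : a • x + b • (x + t • ξ) = (a + b) • x + (b * t) • ξ := by module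
          rw [this, hab]; simp
      · exact (hasDerivAt_line (differentiableAt_dirD (hu₀d _ hs') ξ)).hasDerivWithinAt
      · exact hD _ hs' ξ hξ
    have h3 : |t| ≤ d := by
      have := hd y hyΩ x hx
      rwa [hy, add_sub_cancel_left, norm_smul, hξ, mul_one, Real.norm_eq_abs] at this
    have h4 := mul_le_mul_of_nonneg_left h3 hK
    have h5 := abs_le.1 h1
    have h6 := abs_le.1 (h2.trans h4)
    exact abs_le.2 ⟨by linarith [h5.1, h6.2], by linarith [h5.2, h6.1]⟩
  have hnorm : ‖∇ u₀ x‖ ≤ M + K * d := by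
    rcases eq_or_ne (∇ u₀ x) 0 with h0 | h0
    · rw [h0, norm_zero]; positivity
    · have := key (‖∇ u₀ x‖⁻¹ • ∇ u₀ x) (norm_smul_inv_norm h0)
      rw [← inner_gradient, inner_smul_left, real_inner_self_eq_norm_sq] at this
      have hne : ‖∇ u₀ x‖ ≠ 0 := norm_ne_zero_iff.2 h0
      simp only [conj_trivial] at this
      rw [sq, ← mul_assoc, inv_mul_cancel₀ hne, one_mul, abs_norm] at this
      exact this
  calc ‖∇ u x - ∇ u₀ x‖ ≤ ‖∇ u x‖ + ‖∇ u₀ x‖ := norm_sub_le _ _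
    _ ≤ 2 * M + K * d := by linarith [hM x hx]

/-- A derivative with limits at the points of the closure is locally bounded there, and compactness
makes the bound global. -/
theorem CkClosure.exists_bound {E F : Type*} [NormedAddCommGroup E] [NormedSpace ℝ E]
    [ProperSpace E] [NormedAddCommGroup F] [NormedSpace ℝ F] {k : ℕ} {f : E → F} {S : Set E}
    (h : CkClosure k f S) (hb : Bornology.IsBounded S) {j : ℕ} (hj : j ≤ k) :
    ∃ R, ∀ x ∈ S, ‖iteratedFDeriv ℝ j f x‖ ≤ R := by
  have key : ∃ R, ∀ x ∈ closure S ∩ S, ‖iteratedFDeriv ℝ j f x‖ ≤ R := by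
    refine hb.isCompact_closure.induction_on
      (p := fun T => ∃ R, ∀ x ∈ T ∩ S, ‖iteratedFDeriv ℝ j f x‖ ≤ R) ⟨0, by simp⟩
      (fun T T' hTT' ⟨R, hR⟩ => ⟨R, fun x hx => hR x ⟨hTT' hx.1, hx.2⟩⟩)
      (fun T T' ⟨R, hR⟩ ⟨R', hR'⟩ => ⟨max R R', fun x hx => ?_⟩) (fun x hx => ?_)
    · rcases hx.1 with h | h
      · exact (hR x ⟨h, hx.2⟩).trans (le_max_left _ _)
      · exact (hR' x ⟨h, hx.2⟩).trans (le_max_right _ _)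
    · obtain ⟨l, hl⟩ := h.2.2 j hj x hx
      have h1 := hl.norm.eventually_le_const (lt_add_one ‖l‖)
      rw [eventually_nhdsWithin_iff] at h1
      exact ⟨_, nhdsWithin_le_nhds h1, ‖l‖ + 1, fun y hy => hy.1 hy.2⟩
  obtain ⟨R, hR⟩ := key
  exact ⟨R, fun x hx => hR x ⟨subset_closure hx, hx⟩⟩

end Size
end GJE

namespace GJE

/-! ### Minimal ellipsoids of convex sets -/

section Ellipsoids

variable {n : ℕ}

/-- The linear map that is diagonal in the orthonormal basis `b`, with entries `d`. -/
noncomputable def diagMap (b : OrthonormalBasis (Fin n) ℝ (Eu n)) (d : Fin n → ℝ) : Eu n →ₗ[ℝ] Eu n :=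
  Matrix.toLin b.toBasis b.toBasis (Matrix.diagonal d)

theorem det_diagMap (b : OrthonormalBasis (Fin n) ℝ (Eu n)) (d : Fin n → ℝ) :
    LinearMap.det (diagMap b d) = ∏ i, d i := by
  rw [diagMap, LinearMap.det_toLin, Matrix.det_diagonal]

theorem inner_diagMap (b : OrthonormalBasis (Fin n) ℝ (Eu n)) (d : Fin n → ℝ) (x : Eu n)
    (i : Fin n) : inner ℝ (b i) (diagMap b d x) = d i * inner ℝ (b i) x := by
  have h := congrFun (LinearMap.toMatrix_mulVec_repr b.toBasis b.toBasis (diagMap b d) x) i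
  rw [diagMap, LinearMap.toMatrix_toLin, Matrix.mulVec_diagonal] at h
  simp only [OrthonormalBasis.coe_toBasis_repr_apply, OrthonormalBasis.repr_apply_apply] at h
  rw [diagMap, ← h]

theorem norm_sq_diagMap (b : OrthonormalBasis (Fin n) ℝ (Eu n)) (d : Fin n → ℝ) (x : Eu n) :
    ‖diagMap b d x‖ ^ 2 = ∑ i, d i ^ 2 * inner ℝ (b i) x ^ 2 := by
  rw [← b.sum_sq_norm_inner_right]
  refine Finset.sum_congr rfl fun i _ => ?_
  rw [inner_diagMap, Real.norm_eq_abs, sq_abs, mul_pow]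

theorem ellipsoid_eq (c : Eu n) (b : OrthonormalBasis (Fin n) ℝ (Eu n)) (r : Fin n → ℝ) :
    ellipsoid c b r = {x | ‖diagMap b (fun i => (r i)⁻¹) (x - c)‖ ≤ 1} := by
  ext x
  rw [mem_ofPred_eq, ← sq_le_one_iff₀ (norm_nonneg _), norm_sq_diagMap]
  simp only [ellipsoid, mem_ofPred_eq, inv_pow, div_eq_inv_mul]

theorem volume_setOf_norm_le (A : Eu n →ₗ[ℝ] Eu n) (hA : LinearMap.det A ≠ 0) (c : Eu n) :
    volume {x | ‖A (x - c)‖ ≤ 1} =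
      ENNReal.ofReal |(LinearMap.det A)⁻¹| * volume (Metric.closedBall (0 : Eu n) 1) := by
  rw [← Measure.addHaar_preimage_linearMap _ hA, ← measure_preimage_add_right volume (-c)
    (A ⁻¹' Metric.closedBall 0 1)]
  congr 1
  ext x
  simp [sub_eq_add_neg]

/-- Diagonalise A^T A: its eigenvectors are the axis directions and the inverse square roots of its
eigenvalues the semi-axes. Linear images can thus compete in the minimality condition. -/
theorem exists_ellipsoid_eq (A : Eu n →ₗ[ℝ] Eu n) (hA : LinearMap.det A ≠ 0) (c : Eu n) :
    ∃ (b : OrthonormalBasis (Fin n) ℝ (Eu n)) (r : Fin n → ℝ), (∀ i, 0 < r i) ∧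
      ellipsoid c b r = {x | ‖A (x - c)‖ ≤ 1} := by
  obtain ⟨b, w, hw⟩ := exists_diagonal_basis
    ((innerₗ (Eu n)).compl₁₂ A A) (fun ξ η => by simp [real_inner_comm])
  have hinj : Function.Injective A := by
    refine LinearMap.ker_eq_bot.1 ?_
    by_contra hne
    exact hA (LinearMap.det_eq_zero_iff_ker_ne_bot.2 hne)
  have hw0 : ∀ i, 0 < w i := by
    intro i
    have h1 := hw i i
    rw [if_pos rfl] at h1
    rw [← h1]
    simp only [LinearMap.compl₁₂_apply, innerₗ_apply_apply]
    rw [real_inner_self_eq_norm_sq]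
    have : A (b i) ≠ 0 := fun h => b.toBasis.ne_zero i (hinj (by simpa using h))
    positivity
  refine ⟨b, fun i => (√(w i))⁻¹, fun i => by have := hw0 i; positivity, ?_⟩
  ext x
  rw [mem_ofPred_eq, ← sq_le_one_iff₀ (norm_nonneg _), ← real_inner_self_eq_norm_sq]
  have h1 := bilin_expand ((innerₗ (Eu n)).compl₁₂ A A) b (x - c) (x - c)
  simp only [hw, mul_ite, mul_zero, Finset.sum_ite_eq, Finset.mem_univ, if_true] at h1
  simp only [LinearMap.compl₁₂_apply, innerₗ_apply_apply] at h1
  rw [h1]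
  simp only [ellipsoid, mem_ofPred_eq]
  have : ∀ i, inner ℝ (b i) (x - c) ^ 2 / (√(w i))⁻¹ ^ 2 =
      inner ℝ (b i) (x - c) * inner ℝ (b i) (x - c) * w i := by
    intro i
    rw [inv_pow, Real.sq_sqrt (hw0 i).le, div_inv_eq_mul, sq]
  simp only [this]

/-- Here σ is the component along the normal of a cut and N the squared length of the rest. The part
of the unit ball with σ ≤ t lies in the ellipsoid centred at height -t with semi-axes 1 - t along
the normal and (1 - 3t²)⁻¹ across it; the two surfaces touch at σ = -1. -/
theorem cut_factor {t σ N : ℝ} (ht0 : 0 ≤ t) (ht : t ≤ 1 / 10) (h1 : -1 ≤ σ) (h2 : σ ≤ t)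
    (hN : σ ^ 2 + N ≤ 1) :
    ((1 - t)⁻¹) ^ 2 * (σ + t) ^ 2 + (1 - 3 * t ^ 2) ^ 2 * N ≤ 1 := by
  have hs : 0 < 1 - t := by linarith
  have hα : ((1 - t)⁻¹) ^ 2 = 1 / (1 - t) ^ 2 := by rw [inv_pow, one_div]
  have e1 : ((1 - t)⁻¹) ^ 2 * (σ + t) ^ 2 + (1 - 3 * t ^ 2) ^ 2 * N ≤
      ((1 - t)⁻¹) ^ 2 * (σ + t) ^ 2 + (1 - 3 * t ^ 2) ^ 2 * (1 - σ ^ 2) := by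
    have := mul_le_mul_of_nonneg_left (by linarith : N ≤ 1 - σ ^ 2) (sq_nonneg (1 - 3 * t ^ 2))
    linarith
  refine e1.trans ?_
  rw [hα, div_mul_eq_mul_div, one_mul, div_add' _ _ _ (by positivity), div_le_one (by positivity)]
  -- convexity in `σ` on `[-1, t]`
  have key : (1 - t) ^ 2 - (σ + t) ^ 2 - (1 - 3 * t ^ 2) ^ 2 * (1 - σ ^ 2) * (1 - t) ^ 2 =
      (1 + σ) * ((1 - 2 * t - σ) - (1 - 3 * t ^ 2) ^ 2 * (1 - σ) * (1 - t) ^ 2) := by ring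
  have h3 : 0 ≤ (1 - 2 * t - σ) - (1 - 3 * t ^ 2) ^ 2 * (1 - σ) * (1 - t) ^ 2 := by
    have hp : 0 ≤ (1 - 3 * t ^ 2) ^ 2 * (1 - t) ^ 2 := by positivity
    have hp1 : (1 - 3 * t ^ 2) ^ 2 * (1 - t) ^ 2 ≤ 1 := by
      apply mul_le_one₀ _ (by positivity) _
      · rw [sq_le_one_iff₀ (by nlinarith)]; nlinarith
      · rw [sq_le_one_iff₀ (by nlinarith)]; nlinarith
    have h4 : (1 - 3 * t ^ 2) ^ 2 * (1 - t) ^ 3 ≤ 1 - 3 * t := by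
      have : (1 - 3 * t ^ 2) ^ 2 ≤ 1 - 6 * t ^ 2 + 9 * t ^ 4 := by nlinarith
      have h5 : (1 - t) ^ 3 ≤ 1 - 3 * t + 3 * t ^ 2 := by nlinarith [pow_nonneg ht0 3]
      have h6 : (1 - 6 * t ^ 2 + 9 * t ^ 4) * (1 - 3 * t + 3 * t ^ 2) ≤ 1 - 3 * t := by
        nlinarith [pow_nonneg ht0 2, pow_nonneg ht0 3, pow_nonneg ht0 4, pow_nonneg ht0 5,
          pow_nonneg ht0 6, mul_le_mul_of_nonneg_left ht (pow_nonneg ht0 2),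
          mul_le_mul_of_nonneg_left ht (pow_nonneg ht0 3),
          mul_le_mul_of_nonneg_left ht (pow_nonneg ht0 4),
          mul_le_mul_of_nonneg_left ht (pow_nonneg ht0 5)]
      exact (mul_le_mul this h5 (by positivity) (by nlinarith [pow_nonneg ht0 4])).trans h6
    nlinarith
  nlinarith [mul_nonneg (by linarith : (0 : ℝ) ≤ 1 + σ) h3]

/-- By Bernoulli the transverse stretching costs at most a factor of order nt² ~ t/10, less than the
gain t along the normal. -/
theorem one_lt_cut_det (hn : 0 < n) {t : ℝ} (ht : t = 1 / (10 * n)) :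
    1 < (1 - t)⁻¹ * (1 - 3 * t ^ 2) ^ (n - 1) := by
  have hn' : (1 : ℝ) ≤ n := by exact_mod_cast hn
  have ht0 : 0 < t := by rw [ht]; positivity
  have htn : t * n = 1 / 10 := by rw [ht]; field_simp
  have ht1 : t ≤ 1 / 10 := by nlinarith
  have h1 := one_add_mul_le_pow (a := -(3 * t ^ 2)) (by nlinarith) (n - 1)
  have h2 : (1 : ℝ) - 3 * t / 10 ≤ 1 + ((n - 1 : ℕ) : ℝ) * -(3 * t ^ 2) := by
    rw [Nat.cast_sub hn]
    push_cast
    nlinarith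
  have h3 : 1 - 3 * t / 10 ≤ (1 - 3 * t ^ 2) ^ (n - 1) := by
    refine (h2.trans h1).trans_eq ?_
    ring
  have hs : 0 < 1 - t := by linarith
  rw [inv_mul_eq_div, lt_div_iff₀ hs]
  linarith

/-- A point of the ball outside S would be separated from S by a hyperplane. In coordinates where
the ellipsoid is the unit ball, S then lies in a ball cut at height at most t = 1/(10n), and the
ellipsoid of `cut_factor` contains it with strictly smaller volume. -/
theorem IsMinEllipsoid.closedBall_subset {S : Set (Eu n)} (hn : 0 < n) (hS : IsOpen S)
    (hconv : Convex ℝ S) {c : Eu n} {b : OrthonormalBasis (Fin n) ℝ (Eu n)} {r : Fin n → ℝ}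
    (h : IsMinEllipsoid S c b r) {R : ℝ} (hR0 : 0 < R) (hR : ∀ i, R ≤ r i) :
    Metric.closedBall c (R / (10 * n)) ⊆ S := by
  intro p hp
  by_contra hpS
  obtain ⟨f, hf⟩ := geometric_hahn_banach_open_point hconv hS hpS
  obtain ⟨hr, hsub, hmin⟩ := h
  set t : ℝ := 1 / (10 * n) with ht
  have hn' : (1 : ℝ) ≤ n := by exact_mod_cast hn
  have ht0 : 0 < t := by rw [ht]; positivity
  have htn : t * n = 1 / 10 := by rw [ht]; field_simp
  have ht1 : t ≤ 1 / 10 := by nlinarith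
  set L := diagMap b (fun i => (r i)⁻¹) with hL
  have hLdet : LinearMap.det L ≠ 0 := by
    rw [hL, det_diagMap]
    exact Finset.prod_ne_zero_iff.2 fun i _ => inv_ne_zero (hr i).ne'
  set L' := diagMap b r with hL'
  have hLL' : ∀ x, L (L' x) = x := by
    intro x
    refine b.repr.injective (PiLp.ext fun i => ?_)
    rw [b.repr_apply_apply, b.repr_apply_apply]
    rw [hL, hL', inner_diagMap, inner_diagMap, ← mul_assoc, inv_mul_cancel₀ (hr i).ne', one_mul]
  have hL'L : ∀ x, L' (L x) = x := by
    intro x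
    refine b.repr.injective (PiLp.ext fun i => ?_)
    rw [b.repr_apply_apply, b.repr_apply_apply]
    rw [hL, hL', inner_diagMap, inner_diagMap, ← mul_assoc, mul_inv_cancel₀ (hr i).ne', one_mul]
  -- the separating functional in the coordinates of the ellipsoid
  set F : Eu n →L[ℝ] ℝ := f.comp (LinearMap.toContinuousLinearMap L') with hF
  set w := (InnerProductSpace.toDual ℝ (Eu n)).symm F with hw
  have hwF : ∀ x, inner ℝ w x = f (L' x) := fun x => by
    rw [hw, InnerProductSpace.toDual_symm_apply]; rfl
  rcases S.eq_empty_or_nonempty with rfl | ⟨x₀, hx₀⟩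
  -- The empty set has no minimal ellipsoid, since the semi-axes can be halved.
  · have hb := hmin c b (fun i => r i / 2) (fun i => half_pos (hr i)) (empty_subset _)
    rw [ellipsoid_eq, ellipsoid_eq, volume_setOf_norm_le _ hLdet, volume_setOf_norm_le] at hb
    · have hv0 : volume (Metric.closedBall (0 : Eu n) 1) ≠ 0 :=
        (Metric.measure_closedBall_pos volume _ one_pos).ne'
      have hv1 : volume (Metric.closedBall (0 : Eu n) 1) ≠ ⊤ := measure_closedBall_lt_top.ne
      rw [ENNReal.mul_le_mul_iff_left hv0 hv1, ENNReal.ofReal_le_ofReal_iff (abs_nonneg _)] at hb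
      rw [hL, det_diagMap, det_diagMap] at hb
      simp only [Finset.prod_inv_distrib, inv_inv, Finset.prod_div_distrib, Finset.prod_const,
        Finset.card_univ, Fintype.card_fin] at hb
      have hp : 0 < ∏ i, r i := Finset.prod_pos fun i _ => hr i
      rw [abs_of_pos hp, abs_of_pos (by positivity), le_div_iff₀ (by positivity)] at hb
      have : (1 : ℝ) < 2 ^ n := one_lt_pow₀ (by norm_num) hn.ne'
      nlinarith
    · rw [det_diagMap]
      exact Finset.prod_ne_zero_iff.2 fun i _ => inv_ne_zero (half_pos (hr i)).ne'
  have hw0 : w ≠ 0 := by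
    intro h0
    have h1 := hf x₀ hx₀
    have h2 := hwF (L x₀)
    have h3 := hwF (L p)
    rw [h0, inner_zero_left, hL'L] at h2 h3
    linarith
  have hwn : 0 < ‖w‖ := norm_pos_iff.2 hw0
  set e := ‖w‖⁻¹ • w with he
  have hen : ‖e‖ = 1 := norm_smul_inv_norm hw0
  have hLp : ‖L (p - c)‖ ≤ t := by
    have h1 : ‖L (p - c)‖ ^ 2 ≤ (R⁻¹ * ‖p - c‖) ^ 2 := by
      rw [hL, norm_sq_diagMap, mul_pow, ← b.sum_sq_norm_inner_right (p - c), Finset.mul_sum]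
      refine Finset.sum_le_sum fun i _ => ?_
      rw [Real.norm_eq_abs, sq_abs]
      refine mul_le_mul_of_nonneg_right ?_ (sq_nonneg _)
      exact pow_le_pow_left₀ (inv_nonneg.2 (hr i).le) (inv_anti₀ hR0 (hR i)) 2
    have h2 := abs_le_of_sq_le_sq h1 (by positivity)
    rw [abs_of_nonneg (norm_nonneg _)] at h2
    refine h2.trans ?_
    have h3 := mem_closedBall_iff_norm.1 hp
    rw [inv_mul_le_iff₀ hR0]
    refine h3.trans_eq ?_
    rw [ht]; ring
  -- In the coordinates of the ellipsoid p is within t of the centre, so the hyperplane through p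
  -- meets the axis e at height at most t.
  have hcut : ∀ x ∈ S, inner ℝ e (L (x - c)) ≤ t := by
    intro x hx
    have h1 : inner ℝ e (L (x - c)) ≤ inner ℝ e (L (p - c)) := by
      rw [he, inner_smul_left, inner_smul_left, hwF, hwF, hL'L, hL'L, map_sub, map_sub]
      refine mul_le_mul_of_nonneg_left ?_ (by simp)
      linarith [hf x hx]
    refine h1.trans ((real_inner_le_norm _ _).trans ?_)
    rw [hen, one_mul]; exact hLp
  obtain ⟨b₁, hb₁⟩ : ∃ b₁ : OrthonormalBasis (Fin n) ℝ (Eu n), b₁ ⟨0, hn⟩ = e := by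
    have ho : Orthonormal ℝ (({⟨0, hn⟩} : Set (Fin n)).domRestrict fun _ : Fin n => e) := by
      refine ⟨fun _ => hen, fun i j hij => absurd (Subsingleton.elim i j) hij⟩
    obtain ⟨b₁, hb₁⟩ := ho.exists_orthonormalBasis_extension_of_card_eq (by simp)
    exact ⟨b₁, hb₁ _ rfl⟩
  set o : Fin n := ⟨0, hn⟩
  set d : Fin n → ℝ := fun i => if i = o then (1 - t)⁻¹ else 1 - 3 * t ^ 2 with hd
  set A := (diagMap b₁ d).comp L with hA
  have hddet : 1 < LinearMap.det (diagMap b₁ d) := by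
    rw [det_diagMap, ← Finset.mul_prod_erase _ _ (Finset.mem_univ o)]
    have h1 : ∏ i ∈ Finset.univ.erase o, d i = (1 - 3 * t ^ 2) ^ (n - 1) := by
      rw [Finset.prod_congr rfl (g := fun _ => 1 - 3 * t ^ 2)
        (fun i hi => by simp [hd, Finset.ne_of_mem_erase hi]), Finset.prod_const]
      simp
    rw [h1]
    simpa [hd] using one_lt_cut_det hn ht
  have hAdet : LinearMap.det A = LinearMap.det (diagMap b₁ d) * LinearMap.det L :=
    LinearMap.det_comp _ _
  have hAdet0 : LinearMap.det A ≠ 0 := by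
    rw [hAdet]; exact mul_ne_zero (by linarith) hLdet
  obtain ⟨b', r', hr', heq⟩ := exists_ellipsoid_eq A hAdet0 (c - L' (t • e))
  have hsub' : S ⊆ ellipsoid (c - L' (t • e)) b' r' := by
    intro x hx
    rw [heq, mem_ofPred_eq]
    have h1 : A (x - (c - L' (t • e))) = diagMap b₁ d (L (x - c) + t • e) := by
      rw [hA, LinearMap.comp_apply, sub_sub_eq_add_sub, add_sub_right_comm, map_add L, hLL']
    have h2 := hsub hx
    rw [ellipsoid_eq, mem_ofPred_eq] at h2
    change ‖L (x - c)‖ ≤ 1 at h2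
    set ξ := L (x - c) with hξ
    have hin : ∀ i, inner ℝ (b₁ i) (ξ + t • e) =
        if i = o then inner ℝ e ξ + t else inner ℝ (b₁ i) ξ := by
      intro i
      rw [inner_add_right, inner_smul_right, ← hb₁, b₁.inner_eq_ite]
      split_ifs with hi
      · rw [hi]; ring
      · ring
    have h3 : ‖ξ‖ ^ 2 = inner ℝ e ξ ^ 2 + ∑ i ∈ Finset.univ.erase o, inner ℝ (b₁ i) ξ ^ 2 := by
      rw [← b₁.sum_sq_norm_inner_right, ← Finset.add_sum_erase _ _ (Finset.mem_univ o), hb₁]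
      simp only [Real.norm_eq_abs, sq_abs]
    have h4 : ‖diagMap b₁ d (ξ + t • e)‖ ^ 2 = ((1 - t)⁻¹) ^ 2 * (inner ℝ e ξ + t) ^ 2 +
        (1 - 3 * t ^ 2) ^ 2 * ∑ i ∈ Finset.univ.erase o, inner ℝ (b₁ i) ξ ^ 2 := by
      rw [norm_sq_diagMap, Finset.mul_sum, ← Finset.add_sum_erase _
        (fun i => d i ^ 2 * inner ℝ (b₁ i) (ξ + t • e) ^ 2) (Finset.mem_univ o), hin, if_pos rfl,
        show d o = (1 - t)⁻¹ from if_pos rfl]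
      refine congrArg _ (Finset.sum_congr rfl fun i hi => ?_)
      have := Finset.ne_of_mem_erase hi
      rw [hin, if_neg this, show d i = 1 - 3 * t ^ 2 from if_neg this]
    rw [h1, ← sq_le_one_iff₀ (norm_nonneg _), h4]
    refine cut_factor ht0.le ht1 ?_ (hcut x hx) ?_
    · have := abs_real_inner_le_norm e ξ
      rw [hen, one_mul] at this
      exact (abs_le.1 (this.trans h2)).1
    · rw [← h3]; exact (sq_le_one_iff₀ (norm_nonneg _)).2 h2
  have hvol := hmin _ b' r' hr' hsub'
  rw [heq, ellipsoid_eq, volume_setOf_norm_le _ hLdet, volume_setOf_norm_le _ hAdet0,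
    ENNReal.mul_le_mul_iff_left (Metric.measure_closedBall_pos volume _ one_pos).ne'
      measure_closedBall_lt_top.ne, ENNReal.ofReal_le_ofReal_iff (abs_nonneg _), hAdet,
    abs_inv, abs_inv, abs_mul, abs_of_pos (by linarith : 0 < LinearMap.det (diagMap b₁ d))] at hvol
  have hpos : 0 < |LinearMap.det L| := abs_pos.2 hLdet
  have := (inv_le_inv₀ hpos (by positivity)).1 hvol
  nlinarith

theorem ellipsoid_subset_closedBall {c : Eu n} {b : OrthonormalBasis (Fin n) ℝ (Eu n)}
    {r : Fin n → ℝ} (hr : ∀ i, 0 < r i) {R : ℝ} (hR : 0 ≤ R) (h : ∀ i, r i ≤ R) :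
    ellipsoid c b r ⊆ Metric.closedBall c R := by
  intro x hx
  rw [mem_closedBall_iff_norm]
  refine abs_le_of_sq_le_sq' ?_ hR |>.2
  rw [← b.sum_sq_norm_inner_right]
  calc ∑ i, ‖inner ℝ (b i) (x - c)‖ ^ 2
      ≤ ∑ i, R ^ 2 * (inner ℝ (b i) (x - c) ^ 2 / r i ^ 2) := by
        refine Finset.sum_le_sum fun i _ => ?_
        have h1 : r i ^ 2 ≤ R ^ 2 := pow_le_pow_left₀ (hr i).le (h i) 2
        have h2 : 0 < r i ^ 2 := pow_pos (hr i) 2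
        rw [Real.norm_eq_abs, sq_abs, ← mul_div_assoc, le_div_iff₀ h2, mul_comm]
        exact mul_le_mul_of_nonneg_right h1 (sq_nonneg _)
    _ ≤ R ^ 2 := by
        rw [← Finset.mul_sum]
        exact mul_le_of_le_one_right (sq_nonneg _) hx

/-- R is the smallest semi-axis. That C ≥ 1 follows from comparing a semi-axis with itself. -/
theorem IsGoodShapeConst.exists_balls {C : ℝ} {S : Set (Eu n)} (hn : 0 < n)
    (h : IsGoodShapeConst C S) (hS : IsOpen S) :
    1 ≤ C ∧ ∃ (c : Eu n) (R : ℝ), 0 < R ∧ Metric.closedBall c (R / (10 * n)) ⊆ S ∧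
      S ⊆ Metric.closedBall c (C * R) := by
  obtain ⟨hconv, c, b, r, hmin, hC⟩ := h
  have : Nonempty (Fin n) := ⟨⟨0, hn⟩⟩
  obtain ⟨j, hj⟩ := Finite.exists_min r
  have hrj := hmin.1 j
  have hC1 : 1 ≤ C := by
    have := hC j j
    nlinarith
  exact ⟨hC1, c, r j, hrj, hmin.closedBall_subset hn hS hconv hrj hj,
    hmin.2.1.trans (ellipsoid_subset_closedBall hmin.1 (by positivity) fun i => hC i j)⟩

end Ellipsoids
end GJE

namespace GJE

/-! ### Balls and distances under a change of coordinates -/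

section Coordinates

variable {E : Type*} [NormedAddCommGroup E] [NormedSpace ℝ E]
  {Ω : Set E} {T : E → E} {β β' : ℝ}

theorem isOpen_image_of_hasStrictFDerivAt [CompleteSpace E] (hΩ : IsOpen Ω)
    (hT : ∀ x ∈ Ω, ∃ e : E ≃L[ℝ] E, HasStrictFDerivAt T (e : E →L[ℝ] E) x) :
    IsOpen (T '' Ω) := by
  rw [isOpen_iff_mem_nhds]
  rintro _ ⟨x, hx, rfl⟩
  obtain ⟨e, he⟩ := hT x hx
  rw [← he.map_nhds_eq_of_equiv]
  exact image_mem_map (hΩ.mem_nhds hx)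

theorem hasFDerivAt_invFunOn [Nonempty E] (hΩ : IsOpen Ω) (hinj : InjOn T Ω) [CompleteSpace E]
    {x : E} (hx : x ∈ Ω) {e : E ≃L[ℝ] E} (he : HasStrictFDerivAt T (e : E →L[ℝ] E) x) :
    HasFDerivAt (Function.invFunOn T Ω) (e.symm : E →L[ℝ] E) (T x) := by
  refine (he.to_local_left_inverse ?_).hasFDerivAt
  filter_upwards [hΩ.mem_nhds hx] with y hy using hinj.leftInvOn_invFunOn hy

/-- The mean value inequality for the inverse map, which is available because the image, and not Ω,
is convex. -/
theorem norm_sub_le_of_convex_image [CompleteSpace E] (hΩ : IsOpen Ω) (hinj : InjOn T Ω)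
    (hT : ∀ x ∈ Ω, ∃ e : E ≃L[ℝ] E, HasStrictFDerivAt T (e : E →L[ℝ] E) x ∧
      ‖(e.symm : E →L[ℝ] E)‖ ≤ β') (hconv : Convex ℝ (T '' Ω)) {x y : E} (hx : x ∈ Ω)
    (hy : y ∈ Ω) : ‖x - y‖ ≤ β' * ‖T x - T y‖ := by
  choose! e he heβ using hT
  have h1 := hconv.norm_image_sub_le_of_norm_hasFDerivWithin_le
    (f := Function.invFunOn T Ω) (C := β')
    (f' := fun s => ((e (Function.invFunOn T Ω s)).symm : E →L[ℝ] E)) ?_ ?_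
    (mem_image_of_mem T hy) (mem_image_of_mem T hx)
  · rwa [hinj.leftInvOn_invFunOn hx, hinj.leftInvOn_invFunOn hy] at h1
  · rintro _ ⟨p, hp, rfl⟩
    rw [hinj.leftInvOn_invFunOn hp]
    exact (hasFDerivAt_invFunOn hΩ hinj hp (he p hp)).hasFDerivWithinAt
  · rintro _ ⟨p, hp, rfl⟩
    rw [hinj.leftInvOn_invFunOn hp]
    exact heβ p hp

/-- Start at the preimage of c and follow a segment of length at most ρ/β. Before leaving Ω its
image stays in the ball, so the segment stays in the preimage of that ball, a compact subset of Ω;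
it can therefore never reach the frontier. -/
theorem exists_ball_subset_of_image [ProperSpace E] [CompleteSpace E] (hΩ : IsOpen Ω) (hb : Bornology.IsBounded Ω)
    (hinj : InjOn T Ω) (hβ : 0 < β)
    (hT : ∀ x ∈ Ω, ∃ e : E ≃L[ℝ] E, HasStrictFDerivAt T (e : E →L[ℝ] E) x ∧
      ‖(e : E →L[ℝ] E)‖ ≤ β) {c : E} {ρ : ℝ} (hρ : 0 < ρ)
    (hball : Metric.closedBall c ρ ⊆ T '' Ω) :
    ∃ x₀, Metric.closedBall x₀ (ρ / β) ⊆ Ω := by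
  obtain ⟨x₀, hx₀, hTx₀⟩ := hball (Metric.mem_closedBall_self hρ.le)
  refine ⟨x₀, fun x hx => ?_⟩
  by_contra hxΩ
  choose! e he heβ using hT
  have hne : x - x₀ ≠ 0 := fun h => hxΩ (by rwa [sub_eq_zero.1 h])
  obtain ⟨b, hb0, hbf, hbi⟩ := exists_exit hΩ hb hx₀ hne
  have hb1 : b ≤ 1 := by
    by_contra! h
    exact hxΩ (by simpa using hbi 1 ⟨zero_le_one, h⟩)
  have hTin : ∀ s ∈ Ico 0 b, T (x₀ + s • (x - x₀)) ∈ Metric.closedBall c ρ := by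
    intro s hs
    have hseg : segment ℝ x₀ (x₀ + s • (x - x₀)) ⊆ Ω := by
      intro y hy
      rw [segment_eq_image'] at hy
      obtain ⟨θ, hθ, rfl⟩ := hy
      have : x₀ + θ • (x₀ + s • (x - x₀) - x₀) = x₀ + (θ * s) • (x - x₀) := by simp [smul_smul]
      change x₀ + θ • (x₀ + s • (x - x₀) - x₀) ∈ Ω
      rw [this]
      exact hbi _ ⟨mul_nonneg hθ.1 hs.1, by nlinarith [hθ.2, hs.1, hs.2]⟩
    have h1 := (convex_segment x₀ (x₀ + s • (x - x₀))).norm_image_sub_le_of_norm_hasFDerivWithin_le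
      (f := T) (f' := fun y => (e y : E →L[ℝ] E)) (C := β)
      (fun y hy => (he y (hseg hy)).hasFDerivAt.hasFDerivWithinAt)
      (fun y hy => heβ y (hseg hy)) (left_mem_segment ℝ _ _) (right_mem_segment ℝ _ _)
    rw [hTx₀, add_sub_cancel_left, norm_smul, Real.norm_of_nonneg hs.1] at h1
    rw [mem_closedBall_iff_norm] at hx ⊢
    rw [le_div_iff₀ hβ] at hx
    refine h1.trans ?_
    have h2 : s * ‖x - x₀‖ ≤ ‖x - x₀‖ :=
      mul_le_of_le_one_left (norm_nonneg _) (hs.2.le.trans hb1)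
    nlinarith
  have : Nonempty E := ⟨x₀⟩
  set ψ := Function.invFunOn T Ω with hψ
  have hψT : ∀ p ∈ Ω, ψ (T p) = p := fun p hp => hinj.leftInvOn_invFunOn hp
  have hψc : ContinuousOn ψ (Metric.closedBall c ρ) := by
    intro s hs
    obtain ⟨p, hp, rfl⟩ := hball hs
    exact (hasFDerivAt_invFunOn hΩ hinj hp (he p hp)).continuousAt.continuousWithinAt
  have hcl : IsClosed (ψ '' Metric.closedBall c ρ) :=
    ((isCompact_closedBall c ρ).image_of_continuousOn hψc).isClosed
  have hsub : ψ '' Metric.closedBall c ρ ⊆ Ω := by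
    rintro _ ⟨s, hs, rfl⟩
    obtain ⟨p, hp, rfl⟩ := hball hs
    rwa [hψT p hp]
  have h1 : b ∈ closure (Ico 0 b) := by
    rw [closure_Ico hb0.ne]; exact right_mem_Icc.2 hb0.le
  have h2 := map_mem_closure (f := fun t : ℝ => x₀ + t • (x - x₀))
    (t := ψ '' Metric.closedBall c ρ) (by fun_prop) h1
    (fun s hs => ⟨_, hTin s hs, hψT _ (hbi s hs)⟩)
  rw [hcl.closure_eq] at h2
  exact hbf.2 (by rw [hΩ.interior_eq]; exact hsub h2)

end Coordinates

/-! ### The coordinates g_y/g_z -/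

section CoordChange

variable {n : ℕ} {U V : Set (Eu n)} {I : Eu n → Eu n → Set ℝ} {J : Set ℝ} {g : XYZ n → ℝ}

/-- The continuous linear map given by a matrix. -/
noncomputable def matMap (D : Matrix (Fin n) (Fin n) ℝ) : Eu n →L[ℝ] Eu n :=
  LinearMap.toContinuousLinearMap (Matrix.toEuclideanLin D)

theorem matMap_apply (D : Matrix (Fin n) (Fin n) ℝ) (ξ : Eu n) (i : Fin n) :
    matMap D ξ i = ∑ j, D i j * ξ j := by
  simp [matMap, Matrix.toEuclideanLin, Matrix.mulVec, dotProduct]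

theorem matMap_matMap (D D' : Matrix (Fin n) (Fin n) ℝ) (h : D * D' = 1) (ξ : Eu n) :
    matMap D (matMap D' ξ) = ξ := by
  ext i
  have h1 : ((D * D').mulVec ξ) i = ξ i := by rw [h, Matrix.one_mulVec]
  rw [← Matrix.mulVec_mulVec] at h1
  rw [matMap_apply]
  simp only [matMap_apply]
  exact h1

theorem norm_le_of_forall_abs_le {v : Eu n} {B : ℝ} (h : ∀ i, |v i| ≤ B) :
    ‖v‖ ≤ n * B := by
  conv_lhs => rw [← (EuclideanSpace.basisFun (Fin n) ℝ).sum_repr v]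
  refine (norm_sum_le _ _).trans ?_
  calc ∑ i, ‖(EuclideanSpace.basisFun (Fin n) ℝ).repr v i • EuclideanSpace.basisFun (Fin n) ℝ i‖
      ≤ ∑ _i : Fin n, B := Finset.sum_le_sum fun i _ => by
        rw [norm_smul, OrthonormalBasis.norm_eq_one, mul_one]; simpa using h i
    _ = n * B := by simp

theorem norm_matMap_le (D : Matrix (Fin n) (Fin n) ℝ) {B : ℝ} (hB : 0 ≤ B)
    (h : ∀ i j, |D i j| ≤ B) : ‖matMap D‖ ≤ n * (n * B) := by
  refine ContinuousLinearMap.opNorm_le_bound _ (by positivity) fun ξ => ?_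
  have h1 : ∀ i, |matMap D ξ i| ≤ n * (B * ‖ξ‖) := by
    intro i
    rw [matMap_apply]
    refine (Finset.abs_sum_le_sum_abs _ _).trans ?_
    calc ∑ j, |D i j * ξ j| ≤ ∑ _j : Fin n, B * ‖ξ‖ := Finset.sum_le_sum fun j _ => by
          rw [abs_mul]
          exact mul_le_mul (h i j) (PiLp.norm_apply_le ξ j) (abs_nonneg _) hB
      _ = n * (B * ‖ξ‖) := by simp
  refine (norm_le_of_forall_abs_le h1).trans_eq ?_
  ring

/-- The quotient rule turns ∂(g_{y_j}/g_z)/∂x_i into g_z⁻¹E_ij, so the bounds on E, E⁻¹ and g_z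
control these coordinates in both directions. -/
theorem IsGenerating.hasStrictFDerivAt_coordChange (hG : IsGenerating U V I J g) {x y : Eu n}
    {ζ : ℝ} (h : (x, y, ζ) ∈ Gam U V I) :
    HasStrictFDerivAt (coordChange g y ζ)
      (matMap ((gZ g (x, y, ζ))⁻¹ • (matE g (x, y, ζ)).transpose)) x := by
  set q : XYZ n := (x, y, ζ) with hq
  have hg := hG.contDiffAt h
  have hg' : ContDiffAt ℝ (4 : ℕ) g q := by exact_mod_cast hg
  have hg2 := hG.contDiffAt_two h
  have hz := (hG.gZ_neg h).ne
  have hT : ContDiffAt ℝ 3 (coordChange g y ζ) x := by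
    have e1 : ContDiffAt ℝ 3 (fun x => gZ g (x, y, ζ)) x :=
      ContDiffAt.slice (f := gZ g) (j := fun x => (x, y, ζ))
        (contDiffAt_gZ (k := 3) hg' le_rfl) (by fun_prop)
    have e2 : ContDiffAt ℝ 3 (fun x => gY g (x, y, ζ)) x :=
      ContDiffAt.slice (f := gY g) (j := fun x => (x, y, ζ))
        (contDiffAt_gY (k := 3) hg' le_rfl) (by fun_prop)
    exact (e1.inv hz).smul e2
  have hs := hT.hasStrictFDerivAt (by norm_num)
  suffices heq : matMap ((gZ g q)⁻¹ • (matE g q).transpose) = fderiv ℝ (coordChange g y ζ) x by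
    rwa [heq]
  refine ContinuousLinearMap.ext fun ξ => PiLp.ext fun j => ?_
  have hξ := (EuclideanSpace.basisFun (Fin n) ℝ).sum_repr ξ
  have key : ∀ i, fderiv ℝ (coordChange g y ζ) x (EuclideanSpace.single i 1) j =
      (gZ g q)⁻¹ * matE g q i j := by
    intro i
    have hp : HasFDerivAt (coordChange g y ζ) _ x := hs.hasFDerivAt
    have hj := ((EuclideanSpace.proj j : Eu n →L[ℝ] ℝ).hasFDerivAt
      (x := coordChange g y ζ x)).comp x hp
    have hev : (fun x => coordChange g y ζ x j) =ᶠ[𝓝 x] fun x =>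
        (dirD (inZ n 1) g (x, y, ζ))⁻¹ *
          dirD (inY n (EuclideanSpace.single j 1)) g (x, y, ζ) := by
      have hc : ContinuousAt (fun x : Eu n => ((x, y, ζ) : XYZ n)) x := by fun_prop
      filter_upwards [hc.eventually (hG.domΓ.1.mem_nhds h)] with x' hx'
      have := hG.differentiableAt (q := (x', y, ζ)) hx'
      simp only [coordChange, PiLp.smul_apply, smul_eq_mul]
      rw [gZ_eq this, gY_apply this]
    have e1 : HasFDerivAt (fun x => dirD (inZ n 1) g (x, y, ζ))
        ((fderiv ℝ (dirD (inZ n 1) g) q).comp (inX n)) x :=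
      hasFDerivAt_slice (j := fun x => (x, y, ζ)) (hasFDerivAt_mkX (y, ζ))
        (differentiableAt_dirD hg2 _)
    have e2 : HasFDerivAt (fun x => dirD (inY n (EuclideanSpace.single j 1)) g (x, y, ζ))
        ((fderiv ℝ (dirD (inY n (EuclideanSpace.single j 1)) g) q).comp (inX n)) x :=
      hasFDerivAt_slice (j := fun x => (x, y, ζ)) (hasFDerivAt_mkX (y, ζ))
        (differentiableAt_dirD hg2 _)
    have hz' : dirD (inZ n 1) g (x, y, ζ) ≠ 0 := by
      rw [← hq, ← gZ_eq (hG.differentiableAt h)]; exact hz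
    have e3 := ((hasDerivAt_inv hz').comp_hasFDerivAt x e1).mul e2
    have e4 := (e3.congr_of_eventuallyEq hev).unique hj
    have e5 := congrArg (fun L : Eu n →L[ℝ] ℝ => L (EuclideanSpace.single i 1)) e4
    change (dirD (inZ n 1) g q)⁻¹ * dirD (inX n (EuclideanSpace.single i 1))
        (dirD (inY n (EuclideanSpace.single j 1)) g) q + dirD (inY n (EuclideanSpace.single j 1)) g q
        * (-(dirD (inZ n 1) g q ^ 2)⁻¹ * dirD (inX n (EuclideanSpace.single i 1))
          (dirD (inZ n 1) g) q) =
      fderiv ℝ (coordChange g y ζ) x (EuclideanSpace.single i 1) j at e5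
    change dirD (inZ n 1) g q ≠ 0 at hz'
    rw [← e5, matE_apply hg2, gZ_eq (hG.differentiableAt h), dirD_comm hg2 (inY n _),
      dirD_comm hg2 (inZ n _)]
    field_simp
    ring
  conv_rhs => rw [← hξ]
  rw [map_sum, matMap_apply]
  simp only [map_smul, EuclideanSpace.basisFun_apply, EuclideanSpace.basisFun_repr]
  rw [WithLp.ofLp_sum, Finset.sum_apply]
  refine Finset.sum_congr rfl fun i _ => ?_
  rw [PiLp.smul_apply, key, smul_eq_mul, Matrix.smul_apply, Matrix.transpose_apply, smul_eq_mul]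
  ring

theorem IsGenerating.coordChange_equiv (hG : IsGenerating U V I J g) {lam Lam : ℝ}
    (hlam : 0 < lam) (hB : StructureBounds (Gam U V I) g lam Lam) {x y : Eu n} {ζ : ℝ}
    (h : (x, y, ζ) ∈ Gam U V I) :
    ∃ e : Eu n ≃L[ℝ] Eu n, HasStrictFDerivAt (coordChange g y ζ) (e : Eu n →L[ℝ] Eu n) x ∧
      ‖(e : Eu n →L[ℝ] Eu n)‖ ≤ n * (n * (Lam / lam)) ∧
      ‖(e.symm : Eu n →L[ℝ] Eu n)‖ ≤ n * (n * (Lam * Lam)) := by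
  obtain ⟨h1, h2, h3⟩ := hB _ h
  have hs := hG.hasStrictFDerivAt_coordChange h
  set q : XYZ n := (x, y, ζ)
  have hz := (hG.gZ_neg h).ne
  have hL : 0 ≤ Lam := by linarith
  have hu : IsUnit (matE g q).det := (hG.det_matE_ne_zero h).isUnit
  set D := (gZ g q)⁻¹ • (matE g q).transpose
  set D' := gZ g q • ((matE g q)⁻¹).transpose
  have hDD' : D * D' = 1 := by
    rw [smul_mul_smul_comm, inv_mul_cancel₀ hz, one_smul, ← Matrix.transpose_mul,
      Matrix.nonsing_inv_mul _ hu, Matrix.transpose_one]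
  have hD'D : D' * D = 1 := by
    rw [smul_mul_smul_comm, mul_inv_cancel₀ hz, one_smul, ← Matrix.transpose_mul,
      Matrix.mul_nonsing_inv _ hu, Matrix.transpose_one]
  have habs : |gZ g q| = -gZ g q := abs_of_neg (hG.gZ_neg h)
  refine ⟨ContinuousLinearEquiv.equivOfInverse (matMap D) (matMap D') (matMap_matMap _ _ hD'D)
    (matMap_matMap _ _ hDD'), hs, norm_matMap_le D (by positivity) fun i j => ?_,
    norm_matMap_le D' (by positivity) fun i j => ?_⟩
  · change |(gZ g q)⁻¹ * matE g q j i| ≤ _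
    rw [abs_mul, abs_inv, habs,
      inv_mul_eq_div]
    exact div_le_div₀ hL (h3 j i).1 hlam h1
  · change |gZ g q * (matE g q)⁻¹ j i| ≤ _
    rw [abs_mul, habs]
    exact mul_le_mul h2 (h3 j i).2 (abs_nonneg _) hL

end CoordChange
end GJE

/-! ### Small height forces small diameter -/

namespace GJE

variable {n : ℕ} {U V : Set (Eu n)} {I : Eu n → Eu n → Set ℝ} {J : Set ℝ} {g : XYZ n → ℝ}

theorem CoefBounds.mono {𝒰 : Set (Jet n)} {a : Eu n → Eu n → Jet n → ℝ} {K K' : ℝ}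
    (ha : CoefBounds 𝒰 a K) (h : K ≤ K') : CoefBounds 𝒰 a K' where
  isOpen := ha.isOpen
  contDiff := ha.contDiff
  bilin := ha.bilin
  symm := ha.symm
  bound := fun w hw ξ η hξ hη => (ha.bound w hw ξ η hξ hη).trans h
  bound₁ := fun w hw ξ η hξ hη => (ha.bound₁ w hw ξ η hξ hη).trans h
  bound₂ := fun w hw ξ η hξ hη => (ha.bound₂ w hw ξ η hξ hη).trans h
  a3w := ha.a3w

/-- The ratio of the diameter to the inradius of a domain of good shape `C₀`, possibly in the
coordinates `g_y / g_z`. -/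
noncomputable def shapeRatio (n : ℕ) (C₀ lam Lam : ℝ) : ℝ :=
  max 1 (max (20 * n * C₀) (20 * n * C₀ * (n * (n * (Lam / lam))) * (n * (n * (Lam * Lam)))))

theorem IsGenerating.exists_ball_of_shape (hG : IsGenerating U V I J g) (hn : 0 < n)
    {lam Lam C₀ : ℝ} (hlam : 0 < lam) (hB : StructureBounds (Gam U V I) g lam Lam)
    {Ω : Set (Eu n)} (hΩ : IsOpen Ω) (hne : Ω.Nonempty) {y : Eu n} {ζ : ℝ}
    (hΓ : ∀ x ∈ Ω, (x, y, ζ) ∈ Gam U V I)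
    (hshape : IsGoodShapeConst C₀ Ω ∨ IsGoodShapeConst C₀ (coordChange g y ζ '' Ω)) :
    ∃ (x₀ : Eu n) (ρ : ℝ), 0 < ρ ∧ Metric.closedBall x₀ ρ ⊆ Ω ∧
      ∀ x ∈ Ω, ∀ x' ∈ Ω, ‖x - x'‖ ≤ shapeRatio n C₀ lam Lam * ρ := by
  have hn' : (1 : ℝ) ≤ n := by exact_mod_cast hn
  have hdiam : ∀ {S : Set (Eu n)} {c : Eu n} {R : ℝ}, S ⊆ Metric.closedBall c R →
      ∀ x ∈ S, ∀ x' ∈ S, ‖x - x'‖ ≤ 2 * R := by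
    intro S c R hS x hx x' hx'
    have h1 := Metric.mem_closedBall.1 (hS hx)
    have h2 := Metric.mem_closedBall.1 (hS hx')
    rw [← dist_eq_norm]
    linarith [dist_triangle_right x x' c]
  rcases hshape with h | h
  · obtain ⟨hC, c, R, hR, h1, h2⟩ := h.exists_balls hn hΩ
    refine ⟨c, R / (10 * n), by positivity, h1, fun x hx x' hx' => ?_⟩
    refine (hdiam h2 x hx x' hx').trans ?_
    have e1 : 2 * (C₀ * R) = 20 * n * C₀ * (R / (10 * n)) := by field_simp; ring
    rw [e1]
    exact mul_le_mul_of_nonneg_right ((le_max_left _ _).trans (le_max_right _ _)) (by positivity)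
  · have hequiv := fun x hx => hG.coordChange_equiv hlam hB (hΓ x hx)
    have hLam : 0 < Lam := by
      obtain ⟨x, hx⟩ := hne
      obtain ⟨h1, h2, -⟩ := hB _ (hΓ x hx)
      linarith
    have hinj : InjOn (coordChange g y ζ) Ω := (hG.A1star y ζ).mono fun x hx => hΓ x hx
    have hopen : IsOpen (coordChange g y ζ '' Ω) :=
      isOpen_image_of_hasStrictFDerivAt hΩ fun x hx => let ⟨e, he, _⟩ := hequiv x hx; ⟨e, he⟩
    have hconv := h.1
    obtain ⟨hC, c, R, hR, h1, h2⟩ := h.exists_balls hn hopen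
    set β : ℝ := n * (n * (Lam / lam)) with hβ
    set β' : ℝ := n * (n * (Lam * Lam)) with hβ'
    have hβ0 : 0 < β := by positivity
    have hβ'0 : 0 < β' := by positivity
    obtain ⟨x₀, hx₀⟩ := exists_ball_subset_of_image hΩ (hG.isBounded_of_section hΓ) hinj hβ0
      (fun x hx => let ⟨e, he, he1, _⟩ := hequiv x hx; ⟨e, he, he1⟩)
      (by positivity : 0 < R / (10 * n)) h1
    refine ⟨x₀, R / (10 * n) / β, by positivity, hx₀, fun x hx x' hx' => ?_⟩
    have h3 := norm_sub_le_of_convex_image hΩ hinj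
      (fun x hx => let ⟨e, he, _, he1⟩ := hequiv x hx; ⟨e, he, he1⟩) hconv hx hx'
    have h4 := hdiam h2 _ (mem_image_of_mem _ hx) _ (mem_image_of_mem _ hx')
    refine (h3.trans (mul_le_mul_of_nonneg_left h4 hβ'0.le)).trans ?_
    have e1 : β' * (2 * (C₀ * R)) = 20 * n * C₀ * β * β' * (R / (10 * n) / β) := by
      field_simp; ring
    rw [e1]
    exact mul_le_mul_of_nonneg_right ((le_max_right _ _).trans (le_max_right _ _)) (by positivity)

theorem norm_gradient (u : Eu n → ℝ) (x : Eu n) : ‖∇ u x‖ = ‖iteratedFDeriv ℝ 1 u x‖ := by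
  rw [norm_iteratedFDeriv_one, gradient, LinearIsometryEquiv.norm_map]

/-- Polarisation together with the parallelogram law: for a symmetric form on a Euclidean space,
passing from the diagonal to the full norm loses no constant. -/
theorem norm_iteratedFDeriv_two_le {u : Eu n → ℝ} {x : Eu n} (hu : ContDiffAt ℝ 2 u x) {R : ℝ}
    (hR : 0 ≤ R) (h : ∀ ξ : Eu n, ‖ξ‖ = 1 → |dirD ξ (dirD ξ u) x| ≤ R) :
    ‖iteratedFDeriv ℝ 2 u x‖ ≤ R := by
  have hq : ∀ ξ : Eu n, |fderiv ℝ (fderiv ℝ u) x ξ ξ| ≤ R * ‖ξ‖ ^ 2 := by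
    intro ξ
    rcases eq_or_ne ξ 0 with rfl | h0
    · simp
    · have h1 := h (‖ξ‖⁻¹ • ξ) (norm_smul_inv_norm h0)
      have hp : 0 < ‖ξ‖ := norm_pos_iff.2 h0
      rw [dirD_dirD hu, map_smul, map_smul, _root_.smul_apply, smul_eq_mul,
        smul_eq_mul, ← mul_assoc, abs_mul, abs_of_pos (by positivity)] at h1
      calc |fderiv ℝ (fderiv ℝ u) x ξ ξ|
          = (‖ξ‖⁻¹ * ‖ξ‖⁻¹ * |fderiv ℝ (fderiv ℝ u) x ξ ξ|) * ‖ξ‖ ^ 2 := by field_simp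
        _ ≤ R * ‖ξ‖ ^ 2 := mul_le_mul_of_nonneg_right h1 (sq_nonneg _)
  have hb : ∀ ξ η : Eu n, ‖ξ‖ = 1 → ‖η‖ = 1 → |dirD ξ (dirD η u) x| ≤ R := by
    intro ξ η hξ hη
    have hs := dirD_comm hu ξ η
    rw [dirD_dirD hu, dirD_dirD hu] at hs
    rw [dirD_dirD hu]
    have e1 := hq (ξ + η)
    have e2 := hq (ξ - η)
    have e3 := parallelogram_law_with_norm ℝ ξ η
    rw [hξ, hη] at e3
    simp only [map_add, map_sub, _root_.add_apply, _root_.sub_apply]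
      at e1 e2
    rw [abs_le] at e1 e2 ⊢
    constructor <;> nlinarith
  refine ContinuousMultilinearMap.opNorm_le_bound hR fun m => ?_
  have hm : m = ![m 0, m 1] := by ext1 i; fin_cases i <;> rfl
  rw [hm, iteratedFDeriv_two_eq_dirD hu, Fin.prod_univ_two]
  simp only [Matrix.cons_val_zero, Matrix.cons_val_one]
  rcases eq_or_ne (m 0) 0 with h0 | h0
  · rw [h0, dirD_dirD hu]; simp
  rcases eq_or_ne (m 1) 0 with h1 | h1
  · rw [h1, dirD_dirD hu]; simp
  have h2 := hb (‖m 0‖⁻¹ • m 0) (‖m 1‖⁻¹ • m 1) (norm_smul_inv_norm h0) (norm_smul_inv_norm h1)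
  have hp0 : 0 < ‖m 0‖ := norm_pos_iff.2 h0
  have hp1 : 0 < ‖m 1‖ := norm_pos_iff.2 h1
  rw [dirD_dirD hu, map_smul, map_smul, _root_.smul_apply, smul_eq_mul,
    smul_eq_mul, ← mul_assoc, abs_mul, abs_of_pos (by positivity)] at h2
  rw [dirD_dirD hu, Real.norm_eq_abs]
  calc |fderiv ℝ (fderiv ℝ u) x (m 0) (m 1)|
      = (‖m 1‖⁻¹ * ‖m 0‖⁻¹ * |fderiv ℝ (fderiv ℝ u) x (m 0) (m 1)|) * (‖m 0‖ * ‖m 1‖) := by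
        field_simp
    _ ≤ R * (‖m 0‖ * ‖m 1‖) := mul_le_mul_of_nonneg_right h2 (by positivity)

/-- The height below which the domain of a solution is small. -/
theorem exists_height {K L m Q d : ℝ} (hK : 1 ≤ K) (hL : 1 ≤ L) (hm : 0 < m) (hQ : 1 ≤ Q)
    (hd : 0 < d) : ∃ h₀ : ℝ, 0 < h₀ ∧ ∀ h, 0 < h → h ≤ h₀ → L * h ≤ 1 ∧
      K * (2 * L + 2 * K) * √h ≤ min m 1 / 2 ∧
      ∀ ρ, 0 < ρ → (√h ≤ ρ / 2 → min m 1 / 8 * (ρ / 2) ^ 2 ≤ L * h) → Q * ρ ≤ d := by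
  have hκ : 0 < min m 1 := lt_min hm one_pos
  set κ := min m 1 with hκdef
  have hκ1 : κ ≤ 1 := min_le_right _ _
  -- The first entry keeps the change of A between the two jets below κ/2; the second turns ρ ≤
  -- (32L/κ)√h into Qρ ≤ d.
  set s := min (κ / 2 / (K * (2 * L + 2 * K))) (d / (Q * (32 * L / κ))) with hs
  have hs0 : 0 < s := by positivity
  refine ⟨min L⁻¹ (s ^ 2), by positivity, fun h hh hle => ?_⟩
  have h1 : h ≤ L⁻¹ := hle.trans (min_le_left _ _)
  have h2 : √h ≤ s := Real.sqrt_le_iff.2 ⟨hs0.le, hle.trans (min_le_right _ _)⟩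
  have hsq : √h * √h = h := Real.mul_self_sqrt hh.le
  have hsh : 0 < √h := Real.sqrt_pos.2 hh
  refine ⟨?_, ?_, fun ρ hρ hball => ?_⟩
  · have := mul_le_mul_of_nonneg_left h1 (by linarith : 0 ≤ L)
    rwa [mul_inv_cancel₀ (by linarith)] at this
  · have := h2.trans (min_le_left _ _)
    rw [le_div_iff₀ (by positivity)] at this
    linarith
  · have h3 := h2.trans (min_le_right _ _)
    rw [le_div_iff₀ (by positivity)] at h3
    have h4 : ρ ≤ 32 * L / κ * √h := by
      have hLκ : 1 ≤ L / κ := by rw [le_div_iff₀ hκ]; linarith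
      have e32 : 32 * L / κ = 32 * (L / κ) := by ring
      rw [e32]
      rcases le_total (√h) (ρ / 2) with h5 | h5
      · have h6 := hball h5
        have h7 : ρ ^ 2 ≤ (32 * (L / κ) * √h) ^ 2 := by
          have e1 : (32 * (L / κ) * √h) ^ 2 = 1024 * (L / κ) ^ 2 * h := by
            rw [mul_pow, mul_pow, sq (√h), hsq]; norm_num
          have e2 : ρ ^ 2 ≤ 32 * (L / κ) * h := by
            have : 32 * (L / κ) * h = 32 * (L * h) / κ := by ring
            rw [this, le_div_iff₀ hκ]
            nlinarith
          rw [e1]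
          nlinarith
        exact abs_le_of_sq_le_sq' h7 (by positivity) |>.2
      · nlinarith
    nlinarith

end GJE

/-! ### Assembly of the estimate -/

namespace GJE

variable {n : ℕ} {U V : Set (Eu n)} {I : Eu n → Eu n → Set ℝ} {J : Set ℝ} {g : XYZ n → ℝ}

/-- The constant `P` of the interior estimate. -/
noncomputable def estimateScale (n : ℕ) (K M : ℝ) : ℝ :=
  20 * n * K ^ 2 * (1 + (2 * M + K) + n * K) ^ 2

/-- The bound for the second derivatives at points whose depth below the boundary function is
at least `δ`. -/
noncomputable def hessianBound (n : ℕ) (K M δ : ℝ) : ℝ :=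
  (1 + 4 * estimateScale n K M ^ 3 * (40 * estimateScale n K M ^ 2)) * Real.exp 2 / δ ^ 12 + K

theorem one_le_estimateScale (hn : 0 < n) {K M : ℝ} (hK : 1 ≤ K) (hM : 0 ≤ M) :
    1 ≤ estimateScale n K M := by
  have hn' : (1 : ℝ) ≤ n := by exact_mod_cast hn
  have h1 : 1 ≤ 20 * (n : ℝ) := by linarith
  have h2 : 1 ≤ K ^ 2 := one_le_pow₀ hK
  have h3 : 1 ≤ (1 + (2 * M + K) + n * K) ^ 2 := by
    refine one_le_pow₀ ?_
    have : 0 ≤ n * K := by positivity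
    linarith
  exact one_le_mul_of_one_le_of_one_le (one_le_mul_of_one_le_of_one_le h1 h2) h3

theorem GConvex.norm_hessian_le (hG : IsGenerating U V I J g) (hn : 0 < n) {K M : ℝ}
    (hK : 1 ≤ K) (hM : 0 ≤ M)
    (ha : CoefBounds (jetSet (Gam U V I) g) (coefA (Gam U V I) g) K) {lam L C₀ m : ℝ}
    (hlam : 0 < lam) (hm : 0 < m) (hL : 1 ≤ L) (hB : StructureBounds (Gam U V I) g lam L)
    {Ω : Set (Eu n)} {u : Eu n → ℝ} {f₀ : ℝ} {xbar y : Eu n} {z h : ℝ}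
    (hΩ : IsOpen Ω) (hΩU : Ω ⊆ U) (hu : ContDiffOn ℝ 4 u Ω) (hu2 : CkClosure 2 u Ω)
    (huM : ∀ x ∈ Ω, ‖∇ u x‖ ≤ M) (hc : GConvex (Gam U V I) J g Ω u) (hf₀ : m ≤ f₀)
    (hsol : SolvesMATE (Gam U V I) g Ω u f₀) (hxbar : xbar ∈ Ω)
    (hsupp : IsGSupport (Gam U V I) J g Ω u xbar y z) (hh : 0 < h) (hLh : L * h ≤ 1)
    (hsmall : K * (2 * L + 2 * K) * √h ≤ min m 1 / 2)
    (hsize : ∀ ρ, 0 < ρ → (√h ≤ ρ / 2 → min m 1 / 8 * (ρ / 2) ^ 2 ≤ L * h) →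
      shapeRatio n C₀ lam L * ρ ≤ 1 / (100 * estimateScale n K M ^ 2))
    (hΓ : ∀ x ∈ Ω, (x, y, z - h) ∈ Gam U V I)
    (hbd : ∀ x ∈ frontier Ω, u x = g (x, y, z - h))
    (hjoin : JetsJoined (Gam U V I) g Ω u y (z - h))
    (hshape : IsGoodShapeConst C₀ Ω ∨ IsGoodShapeConst C₀ (coordChange g y (z - h) '' Ω))
    {τ : ℝ} (hτ0 : 0 < τ) (hτ1 : τ < 1) {x : Eu n} (hx : x ∈ gSection g Ω u y (z - τ * h)) :
    ‖iteratedFDeriv ℝ 2 u x‖ ≤ hessianBound n K M (lam * ((1 - τ) * h)) := by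
  set P := estimateScale n K M with hP
  have hP1 : 1 ≤ P := one_le_estimateScale hn hK hM
  set a := coefA (Gam U V I) g with hadef
  set u₀ : Eu n → ℝ := fun x => g (x, y, z - h) with hu₀def
  have hf₀' : 0 < f₀ := hm.trans_le hf₀
  have hux : ∀ x ∈ Ω, ContDiffAt ℝ 4 u x := fun x hx => hu.contDiffAt (hΩ.mem_nhds hx)
  have hux2 : ∀ x ∈ Ω, ContDiffAt ℝ 2 u x := fun x hx => (hux x hx).of_le (by norm_num)
  have hu₀x : ∀ x ∈ Ω, ContDiffAt ℝ 2 u₀ x := fun x hx =>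
    (hG.contDiffAt_section (hΓ x hx)).of_le (by norm_num)
  have hu₀2 : ContDiffOn ℝ 2 u₀ Ω := fun x hx => (hu₀x x hx).contDiffWithinAt
  have hj : ∀ x ∈ Ω, jet u x ∈ jetSet (Gam U V I) g := fun x hx => (hsol x hx).1
  have hpos : ∀ x ∈ Ω, ∀ ξ, 0 ≤ augHess a u ξ ξ x := fun x hx =>
    hc.augHess_nonneg hG hΩ hx (hux2 x hx)
  have hdet : ∀ x ∈ Ω, (Matrix.of fun i j => augHess a u (EuclideanSpace.basisFun (Fin n) ℝ i)
      (EuclideanSpace.basisFun (Fin n) ℝ j) x).det = f₀ := fun x hx => by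
    rw [← matW_apply (hux2 x hx), (hsol x hx).2]
  have hu₀eq : ∀ x ∈ Ω, ∀ ξ, dirD ξ (dirD ξ u₀) x = a ξ ξ (jet u₀ x) := fun x hx ξ =>
    hG.dirD₂_section (hΓ x hx) ξ ξ
  have hj1 : ∀ x ∈ Ω, ∀ q ∈ segment ℝ (∇ u x) (∇ u₀ x), (x, u x, q) ∈ jetSet (Gam U V I) g :=
    fun x hx => (hjoin x hx).1
  have hj2 : ∀ x ∈ Ω, ∀ r ∈ segment ℝ (u x) (u₀ x), (x, r, ∇ u₀ x) ∈ jetSet (Gam U V I) g :=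
    fun x hx => (hjoin x hx).2
  have hlt : ∀ x ∈ Ω, u x < u₀ x := fun x hx =>
    hc.lt_section hG hlam hB ha hn hΩ hΩU hu hf₀' hsol hΓ hbd hx
  have hheight : ∀ x ∈ Ω, u₀ x - u x ≤ L * h := by
    intro x hx
    have h1 := (hG.sub_bounds hB (hΓ x hx) (hsupp.1 x hx) (by linarith)).2
    have h2 : g (x, y, z) ≤ u x := by
      rcases eq_or_ne x xbar with rfl | hne
      · exact hsupp.2.1.ge
      · exact hsupp.2.2.1 x hx hne
    have h3 : u₀ x - g (x, y, z) ≤ L * (z - (z - h)) := h1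
    linarith [show L * (z - (z - h)) = L * h by ring]
  have hh1 : h ≤ 1 := by nlinarith
  -- the domain is small
  obtain ⟨x₀, ρ, hρ, hball, hdiam⟩ :=
    hG.exists_ball_of_shape hn hlam hB hΩ ⟨xbar, hxbar⟩ hΓ hshape
  -- The inradius estimate is used with ρ/2. It needs √h ≤ ρ/2; in the opposite case ρ is small
  -- already, which `hsize` takes into account.
  have hsm := hsize ρ hρ fun hle => sq_radius_le ha hn (by linarith) hΩ hm hf₀
    (hu.of_le (by norm_num)) hu₀2 hj hpos hdet hu₀eq hj1 hj2 (fun x hx => (hlt x hx).le) hheight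
    (by linarith) hh hh1 hsmall hle (x₀ := x₀) (by rwa [mul_div_cancel₀ _ (two_ne_zero)])
  have hd : ∀ x ∈ Ω, ∀ x' ∈ Ω, ‖x - x'‖ ≤ 1 / (100 * P ^ 2) := fun x hx x' hx' =>
    (hdiam x hx x' hx').trans hsm
  have hP2 : 1 ≤ P ^ 2 := one_le_pow₀ hP1
  have hd1 : 1 / (100 * P ^ 2) ≤ 1 := by
    rw [div_le_one (by positivity)]; linarith
  have hj0 : ∀ x ∈ Ω, jet u₀ x ∈ jetSet (Gam U V I) g := fun x hx =>
    hj2 x hx _ (right_mem_segment _ _ _)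
  have hgrad : ∀ x ∈ Ω, ‖∇ u x - ∇ u₀ x‖ ≤ 2 * M + K := by
    intro x hx
    have := norm_gradient_sub_le hΩ (by linarith : 0 ≤ K) hM (fun x hx x' hx' =>
      (hd x hx x' hx').trans hd1) hc.1 (hG.continuousOn_section hΓ)
      (fun x hx => (hux2 x hx).differentiableAt (by norm_num)) hu₀x hbd huM
      (fun x hx ξ hξ => by
        rw [hu₀eq x hx]
        exact ha.bound _ (hj0 x hx) ξ ξ hξ.le hξ.le) hx
    rwa [mul_one] at this
  have hbΩ : Bornology.IsBounded Ω := hG.isBounded_of_section hΓ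
  -- Regularity of u up to the boundary enters only here, to make the weighted maximum exist; R does
  -- not appear in the final constant.
  obtain ⟨R, hR⟩ := hu2.exists_bound hbΩ (j := 2) le_rfl
  have hxΩ : x ∈ Ω := hx.1
  have hΓz : (x, y, z - τ * h) ∈ Gam U V I :=
    hG.mem_of_le_of_le (hΓ x hxΩ) (hsupp.1 x hxΩ) (by nlinarith) (by nlinarith)
  set δ := lam * ((1 - τ) * h) with hδ
  have hδ0 : 0 < δ := mul_pos hlam (mul_pos (by linarith) hh)
  -- From z - h to z - τh the value of g drops by at least λ(1 - τ)h.
  have hdepth : δ ≤ u₀ x - u x := by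
    have h1 := (hG.sub_bounds hB (hΓ x hxΩ) hΓz (by nlinarith)).1
    have h2 := hx.2
    have h3 : lam * (z - τ * h - (z - h)) = δ := by rw [hδ]; ring
    rw [h3] at h1
    change δ ≤ u₀ x - g (x, y, z - τ * h) at h1
    linarith
  set B := (1 + 4 * P ^ 3 * (40 * P ^ 2)) * Real.exp 2 with hBdef
  have hB0 : 0 < B := by positivity
  have hW : ∀ ξ : Eu n, ‖ξ‖ = 1 → augHess a u ξ ξ x ≤ B / δ ^ 12 := by
    intro ξ hξ
    have key := augHess_mul_pow_le ha (M := 2 * M + K) hK (by linarith) rfl (hP.trans rfl) hΩ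
      hf₀' hu hu₀2 hj hpos hdet hu₀eq hj1 hj2 (xbar := xbar)
      (fun x hx => (huM x hx).trans (by linarith)) hgrad hlt
      (fun x hx => (hheight x hx).trans hLh)
      (fun x hx => by
        have := hd x hx xbar hxbar
        rw [le_div_iff₀ (by positivity)] at this
        linarith)
      (fun δ hδ => isCompact_superlevel hΩ hbΩ (w := fun x => u₀ x - u x)
        ((hG.continuousOn_section hΓ).sub hc.1)
        (fun x hx => by rw [hbd x hx, sub_self]) hδ)
      ⟨R + K, fun x hx ξ hξ => by
        have e1 := hR x hx
        have e2 := (iteratedFDeriv ℝ 2 u x).le_opNorm ![ξ, ξ]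
        rw [iteratedFDeriv_two_eq_dirD (hux2 x hx), Fin.prod_univ_two] at e2
        simp only [Matrix.cons_val_zero, Matrix.cons_val_one, hξ, mul_one] at e2
        have e3 := (abs_le.1 (ha.bound _ (hj x hx) ξ ξ hξ.le hξ.le)).1
        have e4 := (le_abs_self _).trans e2
        rw [augHess]
        linarith⟩ hxΩ hξ
    rw [le_div_iff₀ (pow_pos hδ0 12)]
    refine le_trans ?_ key
    exact mul_le_mul_of_nonneg_left (pow_le_pow_left₀ hδ0.le hdepth 12) (hpos x hxΩ ξ)
  refine norm_iteratedFDeriv_two_le (hux2 x hxΩ) (by rw [hessianBound]; positivity) fun ξ hξ => ?_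
  have e1 := hW ξ hξ
  have e2 := hpos x hxΩ ξ
  have e3 := abs_le.1 (ha.bound _ (hj x hxΩ) ξ ξ hξ.le hξ.le)
  rw [augHess] at e1 e2
  have e4 : 0 ≤ B / δ ^ 12 := by positivity
  change _ ≤ B / δ ^ 12 + K
  exact abs_le.2 ⟨by linarith [e3.1], by linarith [e3.2]⟩

end GJE

theorem mainTheorem5 (n : ℕ) (K M C₀ : ℝ) :
    ∃ C : ℝ → ℝ → ℝ → ℝ, ∀ lam Lam m : ℝ, 0 < lam → 0 < m →
      ∃ h₀ : ℝ, 0 < h₀ ∧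
        ∀ (U V : Set (Eu n)) (I : Eu n → Eu n → Set ℝ) (J : Set ℝ) (g : XYZ n → ℝ),
          IsGenerating U V I J g →
          A3w (Gam U V I) g →
          StructureBounds (Gam U V I) g lam Lam →
          ckNorm 2 (jetSet (Gam U V I) g) (matA (Gam U V I) g) ≤ ENNReal.ofReal K →
        ∀ (Ω : Set (Eu n)) (u : Eu n → ℝ) (f₀ : ℝ) (xbar y : Eu n) (z h : ℝ),
          IsDomainSet Ω → Ω ⊆ U →
          ContDiffOn ℝ 4 u Ω → CkClosure 2 u Ω →
          ckNorm 1 Ω u ≤ ENNReal.ofReal M →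
          GConvex (Gam U V I) J g Ω u →
          m ≤ f₀ → SolvesMATE (Gam U V I) g Ω u f₀ →
          xbar ∈ Ω → IsGSupport (Gam U V I) J g Ω u xbar y z →
          0 < h → h ≤ h₀ →
          (∀ x ∈ Ω, (x, y, z - h) ∈ Gam U V I) →
          (∀ x ∈ frontier Ω, u x = g (x, y, z - h)) →
          JetsJoined (Gam U V I) g Ω u y (z - h) →
          (IsGoodShapeConst C₀ Ω ∨ IsGoodShapeConst C₀ (coordChange g y (z - h) '' Ω)) →
        ∀ τ : ℝ, 0 < τ → τ < 1 →
          ∀ x ∈ gSection g Ω u y (z - τ * h), ‖iteratedFDeriv ℝ 2 u x‖ ≤ C τ h lam := by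
  rcases Nat.eq_zero_or_pos n with rfl | hn
  -- In dimension zero every bilinear form is zero.
  · refine ⟨fun _ _ _ => 0, fun lam Lam m _ _ => ⟨1, one_pos, ?_⟩⟩
    intros
    refine ContinuousMultilinearMap.opNorm_le_bound le_rfl fun v => ?_
    rw [ContinuousMultilinearMap.map_coord_zero _ 0 (Subsingleton.elim _ _)]
    simp
  -- The estimate needs K ≥ 1 and M ≥ 0, so both constants are enlarged, as is Λ below. The bound Λ,
  -- the lower bound m and C₀ affect only h₀.
  refine ⟨fun τ h lam => hessianBound n (max K 1) (max M 0) (lam * ((1 - τ) * h)),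
    fun lam Lam m hlam hm => ?_⟩
  have hP := one_le_estimateScale hn (le_max_right K 1) (le_max_right M 0)
  -- The target diameter d is the one for which the quadratic term of the test function is
  -- admissible, 100P²|x - x̄| ≤ 1.
  obtain ⟨h₀, hh₀, H⟩ := exists_height (Q := shapeRatio n C₀ lam (max Lam 1))
    (d := 1 / (100 * estimateScale n (max K 1) (max M 0) ^ 2)) (le_max_right K 1)
    (le_max_right Lam 1) hm (le_max_left _ _) (by positivity)
  refine ⟨h₀, hh₀, ?_⟩
  intro U V I J g hG h3 hB hK Ω u f₀ xbar y z h hΩ hΩU hu hu2 hM hc hf₀ hsol hxbar hsupp hh hle hΓ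
    hbd hjoin hshape τ hτ0 hτ1 x hx
  obtain ⟨H1, H2, H3⟩ := H h hh hle
  have hB' : StructureBounds (Gam U V I) g lam (max Lam 1) := fun q hq =>
    ⟨(hB q hq).1, (hB q hq).2.1.trans (le_max_left _ _), fun i j =>
      ⟨((hB q hq).2.2 i j).1.trans (le_max_left _ _),
        ((hB q hq).2.2 i j).2.trans (le_max_left _ _)⟩⟩
  exact hc.norm_hessian_le hG hn (le_max_right K 1) (le_max_right M 0)
    ((hG.coefBounds h3 hK).mono (max_le_max le_rfl zero_le_one)) hlam hm (le_max_right Lam 1) hB'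
    hΩ.1 hΩU hu hu2
    (fun x hx => by
      rw [norm_gradient]; exact norm_iteratedFDeriv_le_of_ckNorm_le hM le_rfl hx)
    hf₀ hsol hxbar hsupp hh H1 H2 H3 hΓ hbd hjoin hshape hτ0 hτ1 hx
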